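/- Let $n\ge 1$, let $\mathbb D^n=\{z\in\mathbb C^n:|z_i|<1 \text{ for all } i\}$ and let $\bar{\mathbb D}^n$ be its closure. Let $Z_{(0,1)}(\bar{\mathbb D}^n)$ be the space of $(0,1)$-forms $g=\sum_{j=1}^n g_j\,d\bar z_j$ with $g_j\in C(\bar{\mathbb D}^n)$ that are $\bar\partial$-closed on $\mathbb D^n$ in the sense of distributions; the equation $\bar\partial u=g$ is also understood in the sense of distributions on $\mathbb D^n$. For integers $k\ge0$ and $0<\alpha<1$ let $Z^{k+\alpha}_{(0,1)}(\bar{\mathbb D}^n)$ be the subspace of forms all of whose coefficients are of Hölder class $C^{k+\alpha}$. Define the following operators. (i) The Cauchy torus integral: for $u\in C(\bar{\mathbb D}^n)$ and $z\in\mathbb D^n$, $$K[u](z)=\frac1{(2\pi i)^n}\int_{(\partial\mathbb D)^n}\frac{u(\zeta)}{\prod_{j=1}^n(\zeta_j-z_j)}\,d\zeta_1\wedge\dots\wedge d\zeta_n .$$ (ii) Henkin's operator: for $g\in Z_{(0,1)}(\bar{\mathbb D}^n)$ and $z\in\bar{\mathbb D}^n$, $$H[g](z)=-\sum_{r=0}^{n-1}\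 \sum_{J}\ \int_{\gamma_J(z)}g(\zeta)\wedge\frac1{(2\pi i)^{n-r}}\bigwedge_{s=1}^{n-r}\frac{d\zeta_{k_s}}{\zeta_{k_s}-z_{k_s}} ,$$ where $J=(j_1,\dots,j_r)$ runs over the ordered $r$-tuples of distinct indices with $|z_{j_1}|\ge\dots\ge|z_{j_r}|$ (indices of equal modulus being listed in increasing order, so that each $r$-element set of indices occurs exactly once), $k_1<\dots<k_{n-r}$ are the indices not in $J$, and $$\gamma_J(z)=\{\zeta\in\bar{\mathbb D}^n:\ \zeta_{j}=z_{j}\text{ for } j\in J,\ |\zeta_{k_1}|=\dots=|\zeta_{k_{n-r}}|=\rho \text{ with } \rho\le|z_j| \text{ for all } j\in J\}$$ is parametrized by $\zeta_{k_s}=\rho e^{i\theta_s}$ and oriented by $d\rho\wedge d\theta_1\wedge\dots\wedge d\theta_{n-r}$. (iii) The Nijenhuis–Woolf operator: $T[g]=\sum_{j=1}^n T_jS_{j-1}\cdots S_1[g_j]$ on $\mathbb D^n$, where $$T_j[f](z)=\frac1{2\pi i}\int_{\mathbb D}\frac{f(z_1,\dots,\zeta_j,\dots,z_n)}{\zeta_j-z_j}\,d\zeta_j\wedge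 d\bar\zeta_j,\qquad S_j[f](z)=\frac1{2\pi i}\int_{\partial\mathbb D}\frac{f(z_1,\dots,\zeta_j,\dots,z_n)}{\zeta_j-z_j}\,d\zeta_j .$$ Then there is a linear operator $L:Z_{(0,1)}(\bar{\mathbb D}^n)\to C(\bar{\mathbb D}^n)$ such that $\bar\partial L[g]=g$ and $K[L[g]]=0$ on $\mathbb D^n$ for every $g\in Z_{(0,1)}(\bar{\mathbb D}^n)$. It is characterized by this: if $u\in C(\bar{\mathbb D}^n)$ satisfies $\bar\partial u=g$ and $K[u]=0$ on $\mathbb D^n$, then $u=L[g]$. Furthermore, $L[g]=H[g]$ on $\bar{\mathbb D}^n$ for every $g\in Z_{(0,1)}(\bar{\mathbb D}^n)$, and for all integers $k\ge0$, all $0<\alpha<1$ and all $g\in Z^{k+\alpha}_{(0,1)}(\bar{\mathbb D}^n)$ we have $L[g]=T[g]$ on $\mathbb D^n$. -/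

import Mathlib

noncomputable section

namespace Polydisc

open MeasureTheory Complex
open scoped ContDiff NNReal

/-- The open unit polydisc `𝔻ⁿ`. -/
def polydisc (n : ℕ) : Set (Fin n → ℂ) := {z | ∀ i, ‖z i‖ < 1}

/-- The closed unit polydisc. -/
def closedPolydisc (n : ℕ) : Set (Fin n → ℂ) := {z | ∀ i, ‖z i‖ ≤ 1}

/-- Extension by zero of a function on the closed polydisc. It only serves to write integrals and
derivatives over `ℂⁿ`; its values off the closed polydisc are never used. -/
def zeroExt {n : ℕ} (u : C(closedPolydisc n, ℂ)) (z : Fin n → ℂ) : ℂ :=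
  open Classical in if h : z ∈ closedPolydisc n then u ⟨z, h⟩ else 0

/-- The classical Wirtinger derivative `∂φ/∂z̄_j`. -/
def wirtingerBar {n : ℕ} (j : Fin n) (φ : (Fin n → ℂ) → ℂ) (z : Fin n → ℂ) : ℂ :=
  (1 / 2) * (fderiv ℝ φ z (Pi.single j 1) + I * fderiv ℝ φ z (Pi.single j I))

/-- Complex-valued test functions: smooth with compact support in the open polydisc. -/
def IsTest {n : ℕ} (φ : (Fin n → ℂ) → ℂ) : Prop :=
  ContDiff ℝ ∞ φ ∧ HasCompactSupport φ ∧ tsupport φ ⊆ polydisc n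

/-- The continuous `(0,1)`-form `g = ∑ g_j dz̄_j` is `∂̄`-closed in the sense of distributions on the
open polydisc: `∂g_j/∂z̄_k = ∂g_k/∂z̄_j` for all `j, k`. -/
def IsDbarClosed {n : ℕ} (g : Fin n → C(closedPolydisc n, ℂ)) : Prop :=
  ∀ φ : (Fin n → ℂ) → ℂ, IsTest φ → ∀ j k : Fin n,
    ∫ z in polydisc n, zeroExt (g j) z * wirtingerBar k φ z =
      ∫ z in polydisc n, zeroExt (g k) z * wirtingerBar j φ z

/-- `∂̄u = g` in the sense of distributions on the open polydisc. -/
def IsDbarSolution {n : ℕ} (u : C(closedPolydisc n, ℂ))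
    (g : Fin n → C(closedPolydisc n, ℂ)) : Prop :=
  ∀ φ : (Fin n → ℂ) → ℂ, IsTest φ → ∀ j : Fin n,
    ∫ z in polydisc n, zeroExt u z * wirtingerBar j φ z =
      - ∫ z in polydisc n, zeroExt (g j) z * φ z

lemma isCompact_closedPolydisc (n : ℕ) : IsCompact (closedPolydisc n) := by
  have h : closedPolydisc n = Set.univ.pi fun _ => Metric.closedBall (0 : ℂ) 1 := by
    ext z; simp [closedPolydisc]
  rw [h]
  exact isCompact_univ_pi fun _ => isCompact_closedBall _ _

lemma polydisc_subset (n : ℕ) : polydisc n ⊆ closedPolydisc n := fun _ hz i => (hz i).le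

lemma continuousOn_zeroExt {n : ℕ} (u : C(closedPolydisc n, ℂ)) :
    ContinuousOn (zeroExt u) (closedPolydisc n) := by
  rw [continuousOn_iff_continuous_domRestrict]
  have h : (closedPolydisc n).domRestrict (zeroExt u) = u := by
    ext z
    exact dif_pos z.2
  rw [h]
  exact u.continuous

lemma IsTest.integrableOn {n : ℕ} {φ : (Fin n → ℂ) → ℂ} (hφ : IsTest φ)
    (u : C(closedPolydisc n, ℂ)) (j : Fin n) :
    IntegrableOn (fun z => zeroExt u z * wirtingerBar j φ z) (polydisc n) := by
  have hd : Continuous (fderiv ℝ φ) := hφ.1.continuous_fderiv (by simp)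
  have hw : Continuous (wirtingerBar j φ) := by
    unfold wirtingerBar
    fun_prop
  exact (((continuousOn_zeroExt u).mul hw.continuousOn).integrableOn_compact
    (isCompact_closedPolydisc n)).mono_set (polydisc_subset n)

lemma zeroExt_add {n : ℕ} (u v : C(closedPolydisc n, ℂ)) (z : Fin n → ℂ) :
    zeroExt (u + v) z = zeroExt u z + zeroExt v z := by
  unfold zeroExt; split_ifs <;> simp

lemma zeroExt_smul {n : ℕ} (c : ℂ) (u : C(closedPolydisc n, ℂ)) (z : Fin n → ℂ) :
    zeroExt (c • u) z = c * zeroExt u z := by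
  unfold zeroExt; split_ifs <;> simp

/-- The space of continuous `∂̄`-closed `(0,1)`-forms on the closed polydisc. -/
def closedForms (n : ℕ) : Submodule ℂ (Fin n → C(closedPolydisc n, ℂ)) where
  carrier := {g | IsDbarClosed g}
  zero_mem' := by
    intro φ _ j k
    simp [zeroExt]
  add_mem' := by
    intro g h hg hh φ hφ j k
    simp only [Pi.add_apply, zeroExt_add, add_mul]
    rw [integral_add (hφ.integrableOn _ _) (hφ.integrableOn _ _),
      integral_add (hφ.integrableOn _ _) (hφ.integrableOn _ _), hg φ hφ j k, hh φ hφ j k]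
  smul_mem' := by
    intro c g hg φ hφ j k
    simp only [Pi.smul_apply, zeroExt_smul, mul_assoc]
    rw [integral_const_mul, integral_const_mul, hg φ hφ j k]

/-- Membership of a function in the Hölder space `C^{k+α}`: all derivatives up to order `k` exist,
are continuous and bounded on the open polydisc, and those of order `k` are `α`-Hölder there. -/
def IsHolder {n : ℕ} (k : ℕ) (α : ℝ≥0) (u : C(closedPolydisc n, ℂ)) : Prop :=
  ContDiffOn ℝ k (zeroExt u) (polydisc n) ∧
  (∀ m ≤ k, ∃ C : ℝ, ∀ z ∈ polydisc n, ‖iteratedFDeriv ℝ m (zeroExt u) z‖ ≤ C) ∧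
  ∃ C : ℝ≥0, HolderOnWith C α (iteratedFDeriv ℝ k (zeroExt u)) (polydisc n)

/-- The Cauchy torus integral
`K[u](z) = (2πi)⁻ⁿ ∫_{(∂𝔻)ⁿ} u(ζ) / ∏ (ζ_j - z_j) dζ_1 ∧ ⋯ ∧ dζ_n`. -/
def cauchyTorus {n : ℕ} (u : (Fin n → ℂ) → ℂ) (z : Fin n → ℂ) : ℂ :=
  ((2 * Real.pi * I) ^ n)⁻¹ *
    torusIntegral (fun ζ : Fin n → ℂ => u ζ / ∏ j, (ζ j - z j)) 0 (fun _ => 1)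

/-- `S_j[f](z) = (2πi)⁻¹ ∫_{∂𝔻} f(z_1, …, ζ_j, …, z_n) / (ζ_j - z_j) dζ_j`. -/
def cauchyCircle {n : ℕ} (j : Fin n) (f : (Fin n → ℂ) → ℂ) (z : Fin n → ℂ) : ℂ :=
  (2 * Real.pi * I)⁻¹ * circleIntegral (fun w => f (Function.update z j w) / (w - z j)) 0 1

/-- `T_j[f](z) = (2πi)⁻¹ ∫_𝔻 f(z_1, …, ζ_j, …, z_n) / (ζ_j - z_j) dζ_j ∧ dζ̄_j`, where
`dζ ∧ dζ̄ = -2i dA` with `dA` the Lebesgue measure of the plane. -/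
def cauchyDisc {n : ℕ} (j : Fin n) (f : (Fin n → ℂ) → ℂ) (z : Fin n → ℂ) : ℂ :=
  (2 * Real.pi * I)⁻¹ *
    ∫ w in Metric.ball (0 : ℂ) 1, f (Function.update z j w) / (w - z j) * (-2 * I)

/-- The composition of the first `m` of the operators `S_j`, the first one being applied first. -/
def cauchyCircles {n : ℕ} : ℕ → ((Fin n → ℂ) → ℂ) → (Fin n → ℂ) → ℂ
  | 0, f => f
  | m + 1, f => if h : m < n then cauchyCircle ⟨m, h⟩ (cauchyCircles m f) else cauchyCircles m f

/-- The Nijenhuis–Woolf operator `T[g] = ∑_j T_j S_{j-1} ⋯ S_1 [g_j]`, at points of the open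
polydisc. -/
def nijenhuisWoolf {n : ℕ} (g : Fin n → C(closedPolydisc n, ℂ)) (z : Fin n → ℂ) : ℂ :=
  ∑ j : Fin n, cauchyDisc j (cauchyCircles (j : ℕ) (zeroExt (g j))) z

/-- The indices that do not occur in the tuple `J`. -/
abbrev Rest {n r : ℕ} (J : Fin r ↪ Fin n) : Type := {k : Fin n // ∀ a, J a ≠ k}

/-- The point `ζ` with `ζ_j = z_j` for `j` in `J` and `ζ_k = ρ e^{iθ_k}` for the other indices. -/
def henkinPoint {n r : ℕ} (J : Fin r ↪ Fin n) (z : Fin n → ℂ) (ρ : ℝ) (θ : Rest J → ℝ) :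
    Fin n → ℂ :=
  fun i => if h : ∀ a, J a ≠ i then ρ * exp (θ ⟨i, h⟩ * I) else z i

/-- The parameter domain of
`γ_J(z) = {ζ : ζ_j = z_j for j in J, |ζ_k| = ρ for the other k, ρ ≤ 1, ρ ≤ |z_j| for j in J}`
in the coordinates `(ρ, θ)`. -/
def henkinDomain {n r : ℕ} (J : Fin r ↪ Fin n) (z : Fin n → ℂ) : Set (ℝ × (Rest J → ℝ)) :=
  {p | (0 ≤ p.1 ∧ p.1 ≤ 1 ∧ ∀ a, p.1 ≤ ‖z (J a)‖) ∧ ∀ k, 0 ≤ p.2 k ∧ p.2 k ≤ 2 * Real.pi}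

/-- The integral over `γ_J(z)` of `g ∧ (2πi)^{-(n-r)} ⋀_k dζ_k / (ζ_k - z_k)`, where `γ_J(z)` is
oriented by `dρ ∧ dθ_{k_1} ∧ ⋯ ∧ dθ_{k_{n-r}}`. The pullback of
`dζ̄_s ∧ dζ_{k_1} ∧ ⋯ ∧ dζ_{k_{n-r}}` under `ζ_k = ρ e^{iθ_k}` is
`2iρ ∏_{k ≠ s} (iρ e^{iθ_k}) dρ ∧ dθ_{k_1} ∧ ⋯ ∧ dθ_{k_{n-r}}`
(for a single variable, `dζ̄ ∧ dζ = 2iρ dρ ∧ dθ`), and `dζ̄_j` pulls back to zero for `j` in `J`. -/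
def henkinIntegral {n r : ℕ} (J : Fin r ↪ Fin n) (g : Fin n → C(closedPolydisc n, ℂ))
    (z : Fin n → ℂ) : ℂ :=
  ((2 * Real.pi * I) ^ (n - r))⁻¹ *
    ∫ p in henkinDomain J z,
      ∑ s : Rest J, zeroExt (g s) (henkinPoint J z p.1 p.2) *
        (2 * I * p.1 * ∏ k ∈ Finset.univ.erase s, (I * p.1 * exp (p.2 k * I))) /
          ∏ k : Rest J, (henkinPoint J z p.1 p.2 k - z k)

/-- The tuple `J` lists its indices by decreasing `|z_j|`; equal moduli are listed by increasing
index, so that every set of indices is listed by exactly one tuple. -/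
def IsDecreasing {n r : ℕ} (z : Fin n → ℂ) (J : Fin r ↪ Fin n) : Prop :=
  ∀ a b : Fin r, a < b →
    ‖z (J b)‖ < ‖z (J a)‖ ∨ (‖z (J b)‖ = ‖z (J a)‖ ∧ J a < J b)

/-- Henkin's operator `H[g](z) = - ∑_{r < n} ∑_{|J| = r} ∫_{γ_J(z)} g ∧ H_J(·, z)`, where `J` runs
over the ordered `r`-tuples of distinct indices with `|z_{j_1}| ≥ ⋯ ≥ |z_{j_r}|`. -/
def henkin {n : ℕ} (g : Fin n → C(closedPolydisc n, ℂ)) (z : Fin n → ℂ) : ℂ :=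
  open Classical in
  - ∑ r ∈ Finset.range n, ∑ J : Fin r ↪ Fin n,
      if IsDecreasing z J then henkinIntegral J g z else 0

end Polydisc

end

noncomputable section

namespace Polydisc

open MeasureTheory Complex
open scoped ContDiff NNReal Topology

/-! ### The Henkin kernel -/

/-! Everything is computed on the exact forms `∂̄p` with `p(z) = ∏ u_i(z_i)`, where the `u_i` are
smooth with compact support in `ℂ`, and then extended by density. In one variable the Cauchy–Green
formula reads `S u + T ∂̄u = u` on the disc (`circleS_add_discT`).

On `∂̄p` the Nijenhuis–Woolf sum telescopes: its `j`-th term is `∏_{i<j} S u_i · T ∂̄u_j · ∏_{i>j}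
u_i`, and with `T ∂̄u_j = u_j - S u_j` the total is `p - ∏ S u_i` (`nwFunctional_dbarProd`). The
Cauchy torus integral of `p` is `∏ S u_i`, so that `p = K[p] + T[∂̄p]`.

Henkin's sum over index sets, applied to `∂̄p`, recombines by expanding products
(`sum_finset_sum_prod`) into a single integral over the common radius `ρ`. For each variable the
mean of `u_k` over the circle of radius `ρ` against the Cauchy kernel jumps by `u_k(z_k)` at `ρ =
|z_k|`. The condition `ρ ≤ |z_j|` in `γ_J(z)` contributes exactly the term that removes this jump.
The integrand thus becomes the `ρ`-derivative of a product of continuous functions, and the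
fundamental theorem of calculus gives `H[∂̄p] = p - ∏ (u_k - T ∂̄u_k)`
(`henkinFunctional_dbarProd`). In the open polydisc this is again `p - ∏ S u_k`.

For the density, dilate and mollify with a product kernel. If `∂̄v = g` weakly, the mollifications
of `v` have `∂̄` converging to `g` uniformly on the closed polydisc, and they are Bochner integrals
of product functions (`mollify_mem`, `mem_of_isWeakSolution`). At a fixed point of the open polydisc
all three operators are continuous in the sup norm, so the identities pass to the limit: `H[g] =
T[g]` for every `g` that has a weak solution, and `u = K[u] + T[g]` for every continuous solution
`u` (`eq_torusFunctional_add_nwFunctional`).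

That a closed form has a weak solution is shown by `T[g]` itself: mollify each coefficient `g_j` as
a function, integrate by parts against a test function, and let closedness cancel the mixed terms
(`integral_nwExt_mul_wirtingerBar`).

Finally `L = H`. The Henkin kernel has an `L¹` norm bounded uniformly over the closed polydisc
(`exists_integral_polarKernel_le`), which makes `H[g]` continuous up to the boundary. The formula `u
= K[u] + T[g]` yields both `K[L g] = 0` and uniqueness. -/

lemma exists_integral_abs_sub_rpow_le {b : ℝ} (hb0 : 0 ≤ b) (hb : b < 1) (R : ℝ) :
    ∃ C : ℝ, ∀ c : ℝ, IntegrableOn (fun x : ℝ => |x - c| ^ (-b)) (Set.Icc 0 R) ∧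
      ∫ x in Set.Icc 0 R, |x - c| ^ (-b) ≤ C := by
  -- Only the singularity within distance 1 of `c` is kept. Beyond it the power is at most 1, and
  -- the integral of `G` is translation invariant, which makes the constant independent of `c`.
  set G : ℝ → ℝ := (Metric.ball (0 : ℝ) 1).indicator fun x => |x| ^ (-b) with hG
  have hmeas : Measurable fun x : ℝ => |x| ^ (-b) := by fun_prop
  have hGint : Integrable G := by
    refine IntegrableOn.integrable_indicator ?_ measurableSet_ball
    refine integrableOn_ball_of_norm_le_rpow (by simp) (α := b) (C := 1) (by simpa using hb)
      (.of_forall fun x => ?_) hmeas.aestronglyMeasurable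
    rw [Real.norm_of_nonneg (by positivity), one_mul, Real.norm_eq_abs]
  have hG0 : ∀ x, 0 ≤ G x := fun x => Set.indicator_nonneg (fun _ _ => by positivity) x
  refine ⟨(∫ x, G x) + ∫ _x in Set.Icc 0 R, (1 : ℝ), fun c => ?_⟩
  have hle : ∀ x, |x - c| ^ (-b) ≤ G (x - c) + 1 := fun x => by
    by_cases h : x - c ∈ Metric.ball (0 : ℝ) 1
    · simp [hG, Set.indicator_of_mem h]
    · rw [hG, Set.indicator_of_notMem h, zero_add]
      refine Real.rpow_le_one_of_one_le_of_nonpos ?_ (by linarith)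
      simpa using h
  have hGc : Integrable fun x => G (x - c) := hGint.comp_sub_right c
  have hb' : IntegrableOn (fun x => G (x - c) + 1) (Set.Icc 0 R) :=
    hGc.integrableOn.add (integrable_const _)
  have hint : IntegrableOn (fun x : ℝ => |x - c| ^ (-b)) (Set.Icc 0 R) := by
    refine hb'.mono' (hmeas.comp (measurable_id.sub_const c)).aestronglyMeasurable
      (.of_forall fun x => ?_)
    rw [Real.norm_of_nonneg (by positivity)]
    exact hle x
  refine ⟨hint, (integral_mono hint hb' hle).trans ?_⟩
  rw [integral_add hGc.integrableOn (integrable_const _)]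
  gcongr
  rw [← integral_sub_right_eq_self G c]
  exact setIntegral_le_integral hGc (.of_forall fun x => hG0 _)

/-- The modulus of the difference of two points controls the difference of their arguments. -/
lemma mul_abs_le_norm_sub {ρ t x : ℝ} (hρ : 0 ≤ ρ) (ht : 0 ≤ t) (hx : |x| ≤ Real.pi) :
    ρ * |x| / Real.pi ≤ ‖(ρ : ℂ) * exp (x * I) - t‖ := by
  have hpi := Real.pi_pos
  have hre : ((ρ : ℂ) * exp (x * I) - t).re = ρ * Real.cos x - t := by
    simp [exp_ofReal_mul_I_re]
  have him : ((ρ : ℂ) * exp (x * I) - t).im = ρ * Real.sin x := by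
    simp [exp_ofReal_mul_I_im]
  -- For small angles the imaginary part suffices, by Jordan's inequality. For the others `cos x ≤
  -- 0`, so the distance to `t ≥ 0` is at least `ρ`.
  rcases le_or_gt |x| (Real.pi / 2) with h | h
  · refine le_trans ?_ (abs_im_le_norm _)
    rw [him, abs_mul, abs_of_nonneg hρ, mul_div_assoc]
    refine mul_le_mul_of_nonneg_left ?_ hρ
    have h2 := Real.mul_abs_le_abs_sin h
    refine le_trans ?_ h2
    rw [div_mul_eq_mul_div]
    gcongr
    linarith [abs_nonneg x]
  · have hcos : Real.cos x ≤ 0 := by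
      rw [← Real.cos_abs]
      exact Real.cos_nonpos_of_pi_div_two_le_of_le h.le (by linarith)
    have h1 : ρ ≤ ‖(ρ : ℂ) * exp (x * I) - t‖ := by
      rw [← sq_le_sq₀ hρ (norm_nonneg _), ← normSq_eq_norm_sq, normSq_apply, hre, him]
      nlinarith [Real.sin_sq_add_cos_sq x, mul_nonneg hρ ht, mul_nonneg (mul_nonneg hρ ht) (neg_nonneg.2 hcos)]
    refine le_trans ?_ h1
    rw [div_le_iff₀ hpi]
    gcongr

lemma circle_sub_ne_zero {ρ : ℝ} {a : ℂ} (hρ : 0 ≤ ρ) (h : ρ ≠ ‖a‖) (θ : ℝ) :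
    (ρ : ℂ) * exp (θ * I) - a ≠ 0 := by
  intro h0
  apply h
  rw [← sub_eq_zero.1 h0]
  simp [abs_of_nonneg hρ]

/-- Rotating by `-arg a` moves `a` onto the nonnegative real axis, which reduces the estimates to a
real centre. -/
lemma norm_circle_sub_eq (ρ : ℝ) (a : ℂ) (θ : ℝ) :
    ‖(ρ : ℂ) * exp (θ * I) - a‖ = ‖(ρ : ℂ) * exp ((θ - a.arg : ℝ) * I) - (‖a‖ : ℝ)‖ := by
  have h : (ρ : ℂ) * exp (θ * I) - a =
      exp (a.arg * I) * ((ρ : ℂ) * exp ((θ - a.arg : ℝ) * I) - (‖a‖ : ℝ)) := by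
    have h1 := norm_mul_exp_arg_mul_I a
    have h2 : exp (θ * I) = exp (a.arg * I) * exp ((θ - a.arg : ℝ) * I) := by
      rw [← exp_add]; congr 1; push_cast; ring
    rw [h2]
    linear_combination h1
  rw [h, norm_mul, norm_exp_ofReal_mul_I, one_mul]

/-- The distance dominates both the radial gap `|ρ - t|` and the angular gap `ρ|x|/π`, hence also
their geometric mean with weights `s` and `1 - s`. This trades an integrable singularity in the
angle for a power of `|ρ - t|` with an exponent as small as desired. The leftover `ρ ≤ ρ ^ (1 - s)`
uses `ρ ≤ 1`. -/
lemma div_norm_circle_sub_le {s ρ x t : ℝ} (hs : 0 < s) (hs1 : s < 1) (hρ : 0 ≤ ρ) (hρ1 : ρ ≤ 1)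
    (ht : 0 ≤ t) (hne : ρ ≠ t) (hx : |x| ≤ Real.pi) (hx0 : x ≠ 0) :
    ρ / ‖(ρ : ℂ) * exp (x * I) - t‖ ≤
      Real.pi ^ (1 - s) * |ρ - t| ^ (-s) * |x| ^ (-(1 - s)) := by
  have hpi := Real.pi_pos
  set m := ‖(ρ : ℂ) * exp (x * I) - t‖ with hm
  rcases hρ.eq_or_lt with rfl | hρ0
  · simp only [zero_div]; positivity
  have h1 : |ρ - t| ≤ m := by
    have := abs_norm_sub_norm_le ((ρ : ℂ) * exp (x * I)) t
    simpa [abs_of_nonneg hρ, abs_of_nonneg ht] using this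
  have h2 : ρ * |x| / Real.pi ≤ m := mul_abs_le_norm_sub hρ ht hx
  have hx' : 0 < |x| := abs_pos.2 hx0
  have hd : 0 < |ρ - t| := abs_pos.2 (sub_ne_zero.2 hne)
  have hm0 : 0 < m := hd.trans_le h1
  have h3 : |ρ - t| ^ s * (ρ * |x| / Real.pi) ^ (1 - s) ≤ m := by
    calc _ ≤ m ^ s * m ^ (1 - s) := by
          gcongr
      _ = m := by rw [← Real.rpow_add hm0]; simp
  rw [div_le_iff₀ hm0]
  have h4 : ρ ≤ ρ ^ (1 - s) := by
    conv_lhs => rw [← Real.rpow_one ρ]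
    exact Real.rpow_le_rpow_of_exponent_ge hρ0 hρ1 (by linarith)
  refine h4.trans ?_
  calc ρ ^ (1 - s) = Real.pi ^ (1 - s) * |ρ - t| ^ (-s) * |x| ^ (-(1 - s)) *
        (|ρ - t| ^ s * (ρ * |x| / Real.pi) ^ (1 - s)) := by
        rw [Real.div_rpow (by positivity) hpi.le, Real.mul_rpow hρ hx'.le,
          Real.rpow_neg hd.le, Real.rpow_neg hx'.le]
        have := (Real.rpow_pos_of_pos hpi (1 - s)).ne'
        have := (Real.rpow_pos_of_pos hd s).ne'
        have := (Real.rpow_pos_of_pos hx' (1 - s)).ne'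
        field_simp
    _ ≤ _ := by gcongr

lemma continuous_div_norm_circle_sub {ρ : ℝ} {a : ℂ} (hρ : 0 ≤ ρ) (h : ρ ≠ ‖a‖) :
    Continuous fun θ : ℝ => ρ / ‖(ρ : ℂ) * exp (θ * I) - a‖ := by
  refine continuous_const.div (by fun_prop) fun θ => ?_
  exact norm_ne_zero_iff.2 (circle_sub_ne_zero hρ h θ)

lemma exists_integral_circle_kernel_le {s : ℝ} (hs : 0 < s) (hs1 : s < 1) :
    ∃ C : ℝ, 0 ≤ C ∧ ∀ (ρ : ℝ) (a : ℂ), 0 ≤ ρ → ρ ≤ 1 → ρ ≠ ‖a‖ →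
      ∫ θ in Set.Icc 0 (2 * Real.pi), ρ / ‖(ρ : ℂ) * exp (θ * I) - a‖ ≤
        C * |ρ - ‖a‖| ^ (-s) := by
  have hpi := Real.pi_pos
  obtain ⟨C, hC⟩ := exists_integral_abs_sub_rpow_le (b := 1 - s) (by linarith) (by linarith) (2 * Real.pi)
  have hC0 : 0 ≤ C := le_trans (integral_nonneg fun x => by positivity) (hC 0).2
  refine ⟨Real.pi ^ (1 - s) * (C + C), by positivity, fun ρ a hρ hρ1 hne => ?_⟩
  set φ := a.arg
  have hI1 := hC φ
  have hI2 := hC (φ + 2 * Real.pi)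
  calc ∫ θ in Set.Icc 0 (2 * Real.pi), ρ / ‖(ρ : ℂ) * exp (θ * I) - a‖
      ≤ ∫ θ in Set.Icc 0 (2 * Real.pi), Real.pi ^ (1 - s) * |ρ - ‖a‖| ^ (-s) *
          (|θ - φ| ^ (-(1 - s)) + |θ - (φ + 2 * Real.pi)| ^ (-(1 - s))) := by
        refine integral_mono_ae ?_ ((hI1.1.add hI2.1).const_mul _) ?_
        · exact (continuous_div_norm_circle_sub hρ hne).integrableOn_Icc
        · have hae : ∀ᵐ θ : ℝ, θ ≠ φ ∧ θ ≠ φ + 2 * Real.pi :=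
            (Measure.ae_ne _ _).and (Measure.ae_ne _ _)
          filter_upwards [ae_restrict_of_ae hae, ae_restrict_mem measurableSet_Icc] with θ h1 h2
          have hφ1 := neg_pi_lt_arg a
          have hφ2 := arg_le_pi a
          rw [norm_circle_sub_eq]
          -- The angle relative to `arg a` must lie in `[-π, π]`. Since `θ` ranges over `[0, 2π]`,
          -- either `θ - φ` or `θ - φ - 2π` does; this explains the two singular terms in the bound.
          rcases le_or_gt (θ - φ) Real.pi with h | h
          · refine (div_norm_circle_sub_le hs hs1 hρ hρ1 (norm_nonneg a) hne
              (abs_le.2 ⟨by linarith [h2.1], h⟩) (sub_ne_zero.2 h1.1)).trans ?_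
            gcongr
            exact le_add_of_nonneg_right (by positivity)
          · have hper : exp ((θ - φ : ℝ) * I) = exp ((θ - (φ + 2 * Real.pi) : ℝ) * I) := by
              rw [← exp_periodic ((θ - (φ + 2 * Real.pi) : ℝ) * I)]
              congr 1; push_cast; ring
            rw [hper]
            refine (div_norm_circle_sub_le hs hs1 hρ hρ1 (norm_nonneg a) hne
              (abs_le.2 ⟨by linarith [h2.1], by linarith [h2.2]⟩) (sub_ne_zero.2 h1.2)).trans ?_
            gcongr
            exact le_add_of_nonneg_left (by positivity)
    _ = Real.pi ^ (1 - s) * |ρ - ‖a‖| ^ (-s) * ((∫ θ in Set.Icc 0 (2 * Real.pi),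
          |θ - φ| ^ (-(1 - s))) + ∫ θ in Set.Icc 0 (2 * Real.pi),
            |θ - (φ + 2 * Real.pi)| ^ (-(1 - s))) := by
        rw [integral_const_mul, integral_add hI1.1 hI2.1]
    _ ≤ Real.pi ^ (1 - s) * |ρ - ‖a‖| ^ (-s) * (C + C) := by
        gcongr
        exacts [hI1.2, hI2.2]
    _ = _ := by ring

/-- Every factor is at most the one with the smallest `x k`. The exponent is chosen so that the
product of all of them still has total exponent at most `1/2`, which is integrable in one real
variable. -/
lemma prod_rpow_neg_le {ι : Type*} [Fintype ι] {x : ι → ℝ} (hx : ∀ k, 0 < x k)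
    (hx1 : ∀ k, x k ≤ 1) :
    ∏ k, x k ^ (-(1 / (2 * (Fintype.card ι + 1 : ℝ)))) ≤ 1 + ∑ k, x k ^ (-(1 / 2 : ℝ)) := by
  set s : ℝ := 1 / (2 * (Fintype.card ι + 1 : ℝ)) with hs
  have hs0 : 0 ≤ s := by positivity
  rcases isEmpty_or_nonempty ι with h | h
  · simp
  obtain ⟨k, hk⟩ := Finite.exists_min x
  calc ∏ j, x j ^ (-s) ≤ ∏ _j : ι, x k ^ (-s) := by
        refine Finset.prod_le_prod (fun j _ => (Real.rpow_pos_of_pos (hx j) _).le) fun j _ => ?_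
        exact Real.rpow_le_rpow_of_nonpos (hx k) (hk j) (by linarith)
    _ = x k ^ (-s * Fintype.card ι) := by
        rw [Finset.prod_const, Finset.card_univ, Real.rpow_mul (hx k).le, Real.rpow_natCast]
    _ ≤ x k ^ (-(1 / 2 : ℝ)) := by
        refine Real.rpow_le_rpow_of_exponent_ge (hx k) (hx1 k) ?_
        have : s * Fintype.card ι ≤ 1 / 2 := by
          rw [hs, div_mul_eq_mul_div, one_mul, div_le_iff₀ (by positivity)]
          linarith
        linarith
    _ ≤ ∑ j, x j ^ (-(1 / 2 : ℝ)) :=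
        Finset.single_le_sum (f := fun j => x j ^ (-(1 / 2 : ℝ)))
          (fun j _ => (Real.rpow_pos_of_pos (hx j) _).le) (Finset.mem_univ k)
    _ ≤ _ := by linarith

/-- Lebesgue measure on `[0, 1] × [0, 2π]^ι`. -/
def polarMeasure (ι : Type*) [Fintype ι] : Measure (ℝ × (ι → ℝ)) :=
  (volume.restrict (Set.Icc 0 1)).prod
    (Measure.pi fun _ : ι => volume.restrict (Set.Icc 0 (2 * Real.pi)))

/-- The modulus of the Henkin kernel. -/
def polarKernel {ι : Type*} [Fintype ι] (a : ι → ℂ) (p : ℝ × (ι → ℝ)) : ℝ :=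
  ∏ k, p.1 / ‖(p.1 : ℂ) * exp (p.2 k * I) - a k‖

lemma measurable_polarKernel {ι : Type*} [Fintype ι] (a : ι → ℂ) :
    Measurable (polarKernel a) := by
  unfold polarKernel
  refine Finset.measurable_prod _ fun k _ => ?_
  refine measurable_fst.div (Measurable.norm (Measurable.sub (Continuous.measurable ?_) measurable_const))
  fun_prop

/-- For fixed `ρ` the angular integral is a product of one-variable integrals, each bounded by a
small power of `|ρ - |a_k||`. Their product is integrable in `ρ` even if several `|a_k|` coincide.
The bound does not degenerate as the `a_k` approach the unit circle, and this is what gives control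
of Henkin's operator up to the boundary. -/
lemma exists_integral_polarKernel_le (ι : Type*) [Fintype ι] :
    ∃ C : ℝ, ∀ a : ι → ℂ, (∀ k, ‖a k‖ ≤ 1) →
      Integrable (polarKernel a) (polarMeasure ι) ∧ ∫ p, polarKernel a p ∂polarMeasure ι ≤ C := by
  set m := Fintype.card ι
  set s : ℝ := 1 / (2 * (m + 1 : ℝ)) with hs
  have hs0 : 0 < s := by positivity
  have hs1 : s < 1 := by
    rw [hs, div_lt_one (by positivity)]
    have : (0 : ℝ) ≤ m := by positivity
    linarith
  obtain ⟨C, hC0, hC⟩ := exists_integral_circle_kernel_le hs0 hs1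
  obtain ⟨C', hC'⟩ := exists_integral_abs_sub_rpow_le (b := 1 / 2) (by norm_num) (by norm_num) 1
  refine ⟨C ^ m * (1 + ∑ _k : ι, C'), fun a ha => ?_⟩
  have hnn : ∀ ρ : ℝ, 0 ≤ ρ → ∀ θ, 0 ≤ polarKernel a (ρ, θ) := fun ρ hρ θ =>
    Finset.prod_nonneg fun k _ => by positivity
  have hae : ∀ᵐ ρ : ℝ ∂volume.restrict (Set.Icc 0 1), ρ ∈ Set.Icc (0 : ℝ) 1 ∧ ∀ k, ρ ≠ ‖a k‖ :=
    (ae_restrict_mem measurableSet_Icc).and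
      (ae_restrict_of_ae (ae_all_iff.2 fun k => Measure.ae_ne _ _))
  have hsec : ∀ ρ : ℝ, ∫ θ, polarKernel a (ρ, θ)
      ∂(Measure.pi fun _ : ι => volume.restrict (Set.Icc 0 (2 * Real.pi))) =
      ∏ k, ∫ θ in Set.Icc 0 (2 * Real.pi), ρ / ‖(ρ : ℂ) * exp (θ * I) - a k‖ := fun ρ =>
    integral_fintype_prod_eq_prod (fun k θ => ρ / ‖(ρ : ℂ) * exp ((θ : ℝ) * I) - a k‖)
  have hbint : Integrable (fun ρ : ℝ => C ^ m * (1 + ∑ k, |ρ - ‖a k‖| ^ (-(1 / 2 : ℝ))))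
      (volume.restrict (Set.Icc 0 1)) :=
    ((integrable_const _).add (integrable_finsetSum _ fun k _ => (hC' ‖a k‖).1)).const_mul _
  have hle : ∀ᵐ ρ : ℝ ∂volume.restrict (Set.Icc 0 1), ∫ θ, polarKernel a (ρ, θ)
      ∂(Measure.pi fun _ : ι => volume.restrict (Set.Icc 0 (2 * Real.pi))) ≤
      C ^ m * (1 + ∑ k, |ρ - ‖a k‖| ^ (-(1 / 2 : ℝ))) := by
    filter_upwards [hae] with ρ hρ
    rw [hsec]
    calc _ ≤ ∏ k, C * |ρ - ‖a k‖| ^ (-s) := by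
          refine Finset.prod_le_prod (fun k _ => integral_nonneg fun θ => ?_) fun k _ =>
            hC ρ (a k) hρ.1.1 hρ.1.2 (hρ.2 k)
          have := hρ.1.1
          positivity
      _ = C ^ m * ∏ k, |ρ - ‖a k‖| ^ (-s) := by
          rw [Finset.prod_mul_distrib, Finset.prod_const, Finset.card_univ]
      _ ≤ _ := by
          gcongr
          refine prod_rpow_neg_le (fun k => abs_pos.2 (sub_ne_zero.2 (hρ.2 k))) fun k => ?_
          rw [abs_le]
          constructor <;> linarith [hρ.1.1, hρ.1.2, ha k, norm_nonneg (a k)]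
  have hint : Integrable (polarKernel a) (polarMeasure ι) := by
    unfold polarMeasure
    rw [integrable_prod_iff (measurable_polarKernel a).aestronglyMeasurable]
    constructor
    · filter_upwards [hae] with ρ hρ
      exact Integrable.fintype_prod (f := fun k (θ : ℝ) => ρ / ‖(ρ : ℂ) * exp (θ * I) - a k‖)
        fun k => (continuous_div_norm_circle_sub hρ.1.1 (hρ.2 k)).integrableOn_Icc
    · refine hbint.mono' (measurable_polarKernel a).norm.stronglyMeasurable.integral_prod_right.aestronglyMeasurable ?_
      filter_upwards [hae, hle] with ρ hρ hρ'
      rw [Real.norm_of_nonneg (integral_nonneg fun _ => norm_nonneg _)]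
      refine le_trans (le_of_eq ?_) hρ'
      exact integral_congr_ae (.of_forall fun θ => Real.norm_of_nonneg (hnn ρ hρ.1.1 θ))
  refine ⟨hint, ?_⟩
  unfold polarMeasure at hint ⊢
  rw [integral_prod _ hint]
  refine (integral_mono_ae hint.integral_prod_left hbint hle).trans ?_
  rw [integral_const_mul, integral_add (integrable_const _)
    (integrable_finsetSum _ fun k _ => (hC' ‖a k‖).1),
    integral_finsetSum _ fun k _ => (hC' ‖a k‖).1]
  gcongr with k
  · simp
  · exact (hC' ‖a k‖).2

/-! ### The Cauchy–Green formula on the unit disc -/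

/-- The Wirtinger derivative `∂f/∂z̄` of a function of one variable. -/
def dbar (f : ℂ → ℂ) (z : ℂ) : ℂ := (1 / 2) * (fderiv ℝ f z 1 + I * fderiv ℝ f z I)

/-- The Cauchy integral over the unit circle. -/
def circleS (f : ℂ → ℂ) (a : ℂ) : ℂ :=
  (2 * Real.pi * I)⁻¹ * circleIntegral (fun w => f w / (w - a)) 0 1

/-- The Cauchy transform on the unit disc. -/
def discT (f : ℂ → ℂ) (a : ℂ) : ℂ :=
  (2 * Real.pi * I)⁻¹ * ∫ w in Metric.ball (0 : ℂ) 1, f w / (w - a) * (-2 * I)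

/-- The mean over the circle of radius `ρ` of `f` against the Cauchy kernel. -/
def circleMean (f : ℂ → ℂ) (a : ℂ) (ρ : ℝ) : ℂ :=
  (2 * Real.pi * I)⁻¹ * ∫ θ in Set.Icc 0 (2 * Real.pi),
    f (ρ * exp (θ * I)) * (I * ρ * exp (θ * I)) / (ρ * exp (θ * I) - a)

/-- The angular integral of `h` against the Cauchy kernel. -/
def radialDensity (h : ℂ → ℂ) (a : ℂ) (ρ : ℝ) : ℂ :=
  (2 * Real.pi * I)⁻¹ * ∫ θ in Set.Icc 0 (2 * Real.pi),
    h (ρ * exp (θ * I)) * (2 * I * ρ) / (ρ * exp (θ * I) - a)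

lemma continuous_dbar {f : ℂ → ℂ} (hf : ContDiff ℝ 1 f) : Continuous (dbar f) := by
  have hd : Continuous (fderiv ℝ f) := hf.continuous_fderiv (by simp)
  unfold dbar
  fun_prop

/-! ### Wirtinger calculus and integrals over circles -/

lemma realLinear_apply (L : ℂ →L[ℝ] ℂ) (e : ℂ) : L e = e.re * L 1 + e.im * L I := by
  conv_lhs => rw [show e = e.re • (1 : ℂ) + e.im • I by simp]
  rw [map_add, map_smul, map_smul, real_smul, real_smul]

/-- Write a real-linear map as `e ↦ α e + β ē`. The complex-linear part cancels in `i L(e) - L(i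
e)`, and the antilinear part, with `β` the `∂̄` coefficient, is doubled. -/
lemma I_mul_apply_sub_apply_I_mul (L : ℂ →L[ℝ] ℂ) (e : ℂ) :
    I * L e - L (I * e) = 2 * I * ((1 / 2) * (L 1 + I * L I)) * (starRingEnd ℂ) e := by
  rw [realLinear_apply L e, realLinear_apply L (I * e)]
  have : (starRingEnd ℂ) e = e.re - e.im * I := by
    apply Complex.ext <;> simp
  rw [this]
  simp only [mul_re, mul_im, I_re, I_im]
  push_cast
  linear_combination ((e.im : ℂ) * L 1 - (e.re : ℂ) * L I + (e.im : ℂ) * I * L I) * I_sq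

lemma measurable_circle_quotient {h k : ℂ → ℂ} (hh : Continuous h) (hk : Continuous k) (a : ℂ) :
    Measurable fun p : ℝ × ℝ => h (p.1 * exp (p.2 * I)) * k p.1 / (p.1 * exp (p.2 * I) - a) :=
  Measurable.div (Continuous.measurable (by fun_prop)) (Continuous.measurable (by fun_prop))

lemma continuous_circle_quotient {h : ℂ → ℂ} (hh : Continuous h) (c : ℂ) {a : ℂ} {ρ : ℝ}
    (hρ : 0 ≤ ρ) (hne : ρ ≠ ‖a‖) :
    Continuous fun θ : ℝ => h (ρ * exp (θ * I)) * c / (ρ * exp (θ * I) - a) :=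
  Continuous.div (by fun_prop) (by fun_prop) fun θ => circle_sub_ne_zero hρ hne θ

lemma exists_norm_le_of_continuous {h : ℂ → ℂ} (hh : Continuous h) (R : ℝ) :
    ∃ C, 0 ≤ C ∧ ∀ z, ‖z‖ ≤ R → ‖h z‖ ≤ C := by
  obtain ⟨C, hC⟩ := (isCompact_closedBall (0 : ℂ) R).exists_bound_of_continuousOn hh.continuousOn
  exact ⟨max C 0, le_max_right _ _, fun z hz => (hC z (by simpa using hz)).trans (le_max_left _ _)⟩

lemma exists_integral_norm_circle_quotient_le {h : ℂ → ℂ} (hh : Continuous h) :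
    ∃ C : ℝ, ∀ (ρ : ℝ) (a : ℂ), 0 ≤ ρ → ρ ≤ 1 → ρ ≠ ‖a‖ →
      ∫ θ in Set.Icc 0 (2 * Real.pi),
        ‖h (ρ * exp (θ * I)) * (2 * I * ρ) / (ρ * exp (θ * I) - a)‖ ≤
          C * |ρ - ‖a‖| ^ (-(1 / 2 : ℝ)) := by
  obtain ⟨C, hC0, hC⟩ := exists_norm_le_of_continuous hh 1
  obtain ⟨C', hC'0, hC'⟩ := exists_integral_circle_kernel_le (s := 1 / 2) (by norm_num) (by norm_num)
  refine ⟨2 * C * C', fun ρ a hρ hρ1 hne => ?_⟩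
  rw [mul_assoc (2 * C)]
  refine le_trans ?_ (mul_le_mul_of_nonneg_left (hC' ρ a hρ hρ1 hne) (by positivity))
  rw [← integral_const_mul]
  refine integral_mono (continuous_circle_quotient hh _ hρ hne).norm.integrableOn_Icc
    ((continuous_div_norm_circle_sub hρ hne).integrableOn_Icc.const_mul _) fun θ => ?_
  have h1 : ‖h (ρ * exp (θ * I))‖ ≤ C := hC _ (by simpa [abs_of_nonneg hρ] using hρ1)
  simp only [norm_div, norm_mul, norm_I, mul_one, norm_real, Real.norm_of_nonneg hρ]
  rw [← mul_div_assoc, mul_comm 2 C, ← mul_assoc]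
  simp only [RCLike.norm_ofNat]
  gcongr

lemma integrableOn_radialDensity {h : ℂ → ℂ} (hh : Continuous h) (a : ℂ) :
    IntegrableOn (radialDensity h a) (Set.Icc 0 1) := by
  obtain ⟨C, hC⟩ := exists_integral_norm_circle_quotient_le hh
  obtain ⟨C', hC'⟩ := exists_integral_abs_sub_rpow_le (b := 1 / 2) (by norm_num) (by norm_num) 1
  refine Integrable.const_mul ?_ _
  refine ((hC' ‖a‖).1.const_mul C).mono' ?_ ?_
  · exact (measurable_circle_quotient hh (k := fun x => 2 * I * x)
      (by fun_prop) a).stronglyMeasurable.integral_prod_right.aestronglyMeasurable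
  · filter_upwards [ae_restrict_mem measurableSet_Icc, ae_restrict_of_ae (Measure.ae_ne _ ‖a‖)]
      with ρ hρ hne
    exact (norm_integral_le_integral_norm _).trans (hC ρ a hρ.1 hρ.2 hne)

lemma setIntegral_Ioo_eq_of_periodic {E : Type*} [NormedAddCommGroup E] [NormedSpace ℝ E]
    {F : ℝ → E} (hF : Function.Periodic F (2 * Real.pi)) :
    ∫ θ in Set.Ioo (-Real.pi) Real.pi, F θ = ∫ θ in Set.Icc 0 (2 * Real.pi), F θ := by
  have hpi := Real.pi_pos
  rw [← integral_Ioc_eq_integral_Ioo, integral_Icc_eq_integral_Ioc,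
    ← intervalIntegral.integral_of_le (by linarith), ← intervalIntegral.integral_of_le (by linarith)]
  have := hF.intervalIntegral_add_eq (-Real.pi) 0
  rw [show -Real.pi + 2 * Real.pi = Real.pi by ring, zero_add] at this
  exact this

lemma periodic_exp_mul_I : Function.Periodic (fun θ : ℝ => exp (θ * I)) (2 * Real.pi) := fun θ => by
  simp only
  rw [← exp_periodic (θ * I)]
  congr 1; push_cast; ring

lemma periodic_circle_quotient (h : ℂ → ℂ) (c a : ℂ) (ρ : ℝ) : Function.Periodic
    (fun θ : ℝ => h (ρ * exp (θ * I)) * c / (ρ * exp (θ * I) - a)) (2 * Real.pi) := fun θ => by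
  have := periodic_exp_mul_I θ
  simp only at this ⊢
  rw [this]

lemma integrableOn_polar_quotient {h : ℂ → ℂ} (hh : Continuous h) (a : ℂ) :
    IntegrableOn (fun p : ℝ × ℝ =>
      h (p.1 * exp (p.2 * I)) * (2 * I * p.1) / (p.1 * exp (p.2 * I) - a))
      (Set.Ioo 0 1 ×ˢ Set.Ioo (-Real.pi) Real.pi) (volume.prod volume) := by
  have hGm := measurable_circle_quotient hh (k := fun x => 2 * I * x) (by fun_prop) a
  unfold IntegrableOn
  rw [← Measure.prod_restrict, integrable_prod_iff hGm.aestronglyMeasurable]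
  obtain ⟨C, hC⟩ := exists_integral_norm_circle_quotient_le hh
  obtain ⟨C', hC'⟩ := exists_integral_abs_sub_rpow_le (b := 1 / 2) (by norm_num) (by norm_num) 1
  have hae : ∀ᵐ ρ : ℝ ∂volume.restrict (Set.Ioo 0 1), ρ ∈ Set.Ioo (0 : ℝ) 1 ∧ ρ ≠ ‖a‖ :=
    (ae_restrict_mem measurableSet_Ioo).and (ae_restrict_of_ae (Measure.ae_ne _ _))
  constructor
  · filter_upwards [hae] with ρ hρ
    exact (Continuous.integrableOn_Icc
      (continuous_circle_quotient hh _ hρ.1.1.le hρ.2)).mono_set Set.Ioo_subset_Icc_self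
  · refine Integrable.mono' (IntegrableOn.mono_set ((hC' ‖a‖).1.const_mul C) Set.Ioo_subset_Icc_self)
      hGm.norm.stronglyMeasurable.integral_prod_right.aestronglyMeasurable ?_
    filter_upwards [hae] with ρ hρ
    rw [Real.norm_of_nonneg (integral_nonneg fun _ => norm_nonneg _)]
    exact (setIntegral_Ioo_eq_of_periodic
      ((periodic_circle_quotient h (2 * I * ρ) a ρ).comp norm)).trans_le
        (hC ρ a hρ.1.1.le hρ.1.2.le hρ.2)

/-- Polar coordinates for the Cauchy transform on the disc. -/
lemma discT_eq_neg_integral_radialDensity {h : ℂ → ℂ} (hh : Continuous h) (a : ℂ) :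
    discT h a = - ∫ ρ in Set.Icc 0 1, radialDensity h a ρ := by
  set G : ℝ × ℝ → ℂ := fun p => h (p.1 * exp (p.2 * I)) * (2 * I * p.1) / (p.1 * exp (p.2 * I) - a)
    with hG
  have hper : ∀ ρ : ℝ, Function.Periodic (fun θ : ℝ => G (ρ, θ)) (2 * Real.pi) := fun ρ =>
    periodic_circle_quotient h (2 * I * ρ) a ρ
  have hGi : IntegrableOn G (Set.Ioo 0 1 ×ˢ Set.Ioo (-Real.pi) Real.pi) (volume.prod volume) :=
    integrableOn_polar_quotient hh a
  have key : ∫ w in Metric.ball (0 : ℂ) 1, h w / (w - a) * (-2 * I) =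
      - ∫ ρ in Set.Icc 0 1, ∫ θ in Set.Icc 0 (2 * Real.pi), G (ρ, θ) := by
    rw [← integral_indicator measurableSet_ball, ← Complex.integral_comp_polarCoord_symm]
    calc _ = ∫ p in Set.Ioo (0 : ℝ) 1 ×ˢ Set.Ioo (-Real.pi) Real.pi, - G p := by
          have hsub : Set.Ioo (0 : ℝ) 1 ×ˢ Set.Ioo (-Real.pi) Real.pi ⊆ polarCoord.target :=
            Set.prod_mono (fun x hx => hx.1) subset_rfl
          rw [← integral_indicator polarCoord.open_target.measurableSet,
            ← integral_indicator (measurableSet_Ioo.prod measurableSet_Ioo)]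
          congr 1
          ext p
          by_cases hp : p ∈ polarCoord.target
          · rw [Set.indicator_of_mem hp]
            have hp1 : 0 < p.1 := hp.1
            have hsymm : Complex.polarCoord.symm p = p.1 * exp (p.2 * I) := by
              rw [Complex.polarCoord_symm_apply, exp_mul_I]; push_cast; rfl
            by_cases hp2 : p.1 < 1
            · rw [Set.indicator_of_mem (show p ∈ Set.Ioo (0 : ℝ) 1 ×ˢ Set.Ioo (-Real.pi) Real.pi
                from ⟨⟨hp1, hp2⟩, hp.2⟩), hsymm, Set.indicator_of_mem]
              · simp only [hG, real_smul]; ring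
              · simpa [abs_of_pos hp1] using hp2
            · rw [Set.indicator_of_notMem (s := Set.Ioo (0 : ℝ) 1 ×ˢ Set.Ioo (-Real.pi) Real.pi)
                (fun h => hp2 h.1.2), hsymm, Set.indicator_of_notMem, smul_zero]
              simpa [abs_of_pos hp1] using hp2
          · rw [Set.indicator_of_notMem hp, Set.indicator_of_notMem fun h => hp (hsub h)]
      _ = - ∫ ρ in Set.Ioo (0 : ℝ) 1, ∫ θ in Set.Ioo (-Real.pi) Real.pi, G (ρ, θ) := by
          rw [integral_neg, Measure.volume_eq_prod, setIntegral_prod _ hGi]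
      _ = _ := by
          rw [integral_Icc_eq_integral_Ioo]
          simp_rw [fun ρ => setIntegral_Ioo_eq_of_periodic (hper ρ)]
  unfold discT radialDensity
  rw [key, integral_const_mul, mul_neg]

/-- The circle mean of `f - f a`. -/
def circleRemainder (f : ℂ → ℂ) (a : ℂ) (ρ : ℝ) : ℂ := circleMean (fun z => f z - f a) a ρ

/-! ### The circle mean as a function of the radius -/

lemma exists_norm_sub_le {f : ℂ → ℂ} (hf : ContDiff ℝ 1 f) (R : ℝ) :
    ∃ C : ℝ, 0 ≤ C ∧ ∀ z w, ‖z‖ ≤ R → ‖w‖ ≤ R → ‖f z - f w‖ ≤ C * ‖z - w‖ := by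
  have hd : Continuous (fderiv ℝ f) := hf.continuous_fderiv (by simp)
  obtain ⟨C, hC⟩ := (isCompact_closedBall (0 : ℂ) R).exists_bound_of_continuousOn hd.continuousOn
  refine ⟨max C 0, le_max_right _ _, fun z w hz hw => ?_⟩
  exact (convex_closedBall (0 : ℂ) R).norm_image_sub_le_of_norm_fderiv_le (𝕜 := ℝ)
    (fun x _ => (hf.differentiable (by simp)).differentiableAt)
    (fun x hx => (hC x hx).trans (le_max_left _ _)) (by simpa using hw) (by simpa using hz)

/-- Subtracting `f a` replaces the singular kernel by a difference quotient bounded by a Lipschitz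
constant, so dominated convergence applies even at the critical radius `ρ = ‖a‖`. -/
lemma continuousOn_circleRemainder {f : ℂ → ℂ} (hf : ContDiff ℝ 1 f) (a : ℂ) (R : ℝ) :
    ContinuousOn (circleRemainder f a) (Set.Icc 0 R) := by
  obtain ⟨C, hC0, hC⟩ := exists_norm_sub_le hf (max R ‖a‖)
  have hbound : ∀ ρ ∈ Set.Icc 0 R, ∀ θ : ℝ, ‖(f (ρ * exp (θ * I)) - f a) * (I * ρ * exp (θ * I)) /
      (ρ * exp (θ * I) - a)‖ ≤ C * ρ := fun ρ hρ θ => by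
    have h1 := hC (ρ * exp (θ * I)) a
      (by simpa [abs_of_nonneg hρ.1] using Or.inl hρ.2) (le_max_right _ _)
    have h2 : ‖I * ρ * exp (θ * I)‖ = ρ := by simp [abs_of_nonneg hρ.1]
    rw [norm_div, norm_mul, h2]
    rcases eq_or_ne (ρ * exp (θ * I) - a) 0 with h0 | h0
    · rw [h0]; simpa using mul_nonneg hC0 hρ.1
    · rw [div_le_iff₀ (norm_pos_iff.2 h0)]
      nlinarith [mul_le_mul_of_nonneg_right h1 hρ.1]
  have hfc := hf.continuous
  intro ρ₀ hρ₀
  refine ContinuousWithinAt.mul continuousWithinAt_const ?_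
  refine continuousWithinAt_of_dominated (bound := fun _ => C * R) ?_ ?_ (integrable_const _) ?_
  · refine .of_forall fun ρ => Measurable.aestronglyMeasurable ?_
    exact Measurable.div (Continuous.measurable (by fun_prop)) (Continuous.measurable (by fun_prop))
  · filter_upwards [self_mem_nhdsWithin] with ρ hρ
    refine .of_forall fun θ => (hbound ρ hρ θ).trans ?_
    have := hρ.2
    gcongr
  -- At radius 0 the whole circle may collapse onto `a`, and the bound `C * ρ` is used instead. At a
  -- positive radius the circle meets `a` for only countably many angles.
  · rcases hρ₀.1.eq_or_lt with h0 | h0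
    · refine .of_forall fun θ => ?_
      have hz : (f (ρ₀ * exp (θ * I)) - f a) * (I * ρ₀ * exp (θ * I)) /
          (ρ₀ * exp (θ * I) - a) = 0 := by simp [← h0]
      simp only [ContinuousWithinAt]
      rw [hz]
      refine squeeze_zero_norm' (a := fun ρ : ℝ => C * ρ) ?_ ?_
      · filter_upwards [self_mem_nhdsWithin] with ρ hρ using hbound ρ hρ θ
      · have : Filter.Tendsto (fun ρ : ℝ => C * ρ) (𝓝 ρ₀) (𝓝 (C * ρ₀)) :=
          Continuous.tendsto (by fun_prop) _
        rw [← h0, mul_zero] at this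
        rw [← h0]
        exact this.mono_left nhdsWithin_le_nhds
    · have hcount : (circleMap 0 ρ₀ ⁻¹' {a}).Countable :=
        (Set.countable_singleton a).preimage_circleMap 0 h0.ne'
      refine ae_restrict_of_ae ?_
      filter_upwards [hcount.ae_notMem volume] with θ hθ
      refine ContinuousAt.continuousWithinAt (ContinuousAt.div (by fun_prop) (by fun_prop) ?_)
      intro h
      apply hθ
      simp [circleMap, sub_eq_zero.1 h]

/-- This is Stokes' theorem on an infinitesimal annulus: the form `(f - f(a)) dζ / (ζ - a)` has
differential `∂̄f dζ̄ ∧ dζ / (ζ - a)` away from `a`, and `dζ̄ ∧ dζ = 2iρ dρ ∧ dθ`. -/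
lemma hasDerivAt_circleRemainder {f : ℂ → ℂ} (hf : ContDiff ℝ 1 f) {a : ℂ} {ρ₀ : ℝ}
    (hρ₀ : 0 < ρ₀) (hne : ρ₀ ≠ ‖a‖) :
    HasDerivAt (circleRemainder f a) (radialDensity (dbar f) a ρ₀) ρ₀ := by
  have hpi := Real.pi_pos
  have hfc := hf.continuous
  have hd : Continuous (fderiv ℝ f) := hf.continuous_fderiv (by simp)
  have hfd : ∀ z, HasFDerivAt f (fderiv ℝ f z) z := fun z =>
    ((hf.differentiable (by simp)) z).hasFDerivAt
  set F' : ℝ → ℝ → ℂ := fun ρ θ =>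
    fderiv ℝ f (ρ * exp (θ * I)) (exp (θ * I)) * (I * ρ * exp (θ * I)) / (ρ * exp (θ * I) - a) +
    (f (ρ * exp (θ * I)) - f a) * (I * exp (θ * I) / (ρ * exp (θ * I) - a) -
      I * ρ * exp (θ * I) * exp (θ * I) / (ρ * exp (θ * I) - a) ^ 2) with hF'
  obtain ⟨δ, hδ, hδU⟩ : ∃ δ > 0, Metric.closedBall ρ₀ δ ⊆ {ρ : ℝ | 0 < ρ ∧ ρ ≠ ‖a‖} :=
    Metric.nhds_basis_closedBall.mem_iff.1
      (((isOpen_lt continuous_const continuous_id).inter isOpen_ne).mem_nhds ⟨hρ₀, hne⟩)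
  have hnz : ∀ ρ ∈ Metric.closedBall ρ₀ δ, ∀ θ : ℝ, (ρ : ℂ) * exp (θ * I) - a ≠ 0 :=
    fun ρ hρ θ => circle_sub_ne_zero (hδU hρ).1.le (hδU hρ).2 θ
  have hF'c : ContinuousOn (fun p : ℝ × ℝ => F' p.1 p.2)
      (Metric.closedBall ρ₀ δ ×ˢ Set.Icc 0 (2 * Real.pi)) := by
    have h1 : Continuous fun p : ℝ × ℝ => fderiv ℝ f (p.1 * exp (p.2 * I)) (exp (p.2 * I)) :=
      (hd.comp (by fun_prop)).clm_apply (by fun_prop)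
    refine ContinuousOn.add (ContinuousOn.div ?_ ?_ ?_) (ContinuousOn.mul ?_
      (ContinuousOn.sub (ContinuousOn.div ?_ ?_ ?_) (ContinuousOn.div ?_ ?_ ?_)))
    · exact (h1.mul (by fun_prop)).continuousOn
    · fun_prop
    · exact fun p hp => hnz _ hp.1 _
    · exact Continuous.continuousOn (by fun_prop)
    · fun_prop
    · fun_prop
    · exact fun p hp => hnz _ hp.1 _
    · fun_prop
    · fun_prop
    · exact fun p hp => pow_ne_zero 2 (hnz _ hp.1 _)
  obtain ⟨C, hC⟩ := ((isCompact_closedBall ρ₀ δ).prod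
    isCompact_Icc).exists_bound_of_continuousOn hF'c
  have hF'cθ : ContinuousOn (F' ρ₀) (Set.Icc 0 (2 * Real.pi)) :=
    hF'c.comp (f := fun θ : ℝ => (ρ₀, θ)) (by fun_prop)
      fun θ hθ => ⟨Metric.mem_closedBall_self hδ.le, hθ⟩
  have key := (hasDerivAt_integral_of_dominated_loc_of_deriv_le
    (F := fun (ρ : ℝ) (θ : ℝ) => (f (ρ * exp (θ * I)) - f a) * (I * ρ * exp (θ * I)) /
      (ρ * exp (θ * I) - a)) (F' := F') (x₀ := ρ₀) (s := Metric.closedBall ρ₀ δ)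
    (μ := volume.restrict (Set.Icc 0 (2 * Real.pi))) (bound := fun _ => C)
    (Metric.closedBall_mem_nhds _ hδ) ?_ ?_ ?_ ?_ (integrable_const _) ?_).2
  · have hval : ∫ θ in Set.Icc 0 (2 * Real.pi), F' ρ₀ θ = ∫ θ in Set.Icc 0 (2 * Real.pi),
        dbar f (ρ₀ * exp (θ * I)) * (2 * I * ρ₀) / (ρ₀ * exp (θ * I) - a) := by
      -- In polar coordinates `(f - f(a)) dζ / (ζ - a)` is `F dθ + Q dρ`. Its differential has
      -- coefficient `∂F/∂ρ - ∂Q/∂θ`, so `F'` minus the density is the `θ`-derivative of the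
      -- periodic function `Q` and integrates to zero.
      set Q : ℝ → ℂ := fun θ => (f (ρ₀ * exp (θ * I)) - f a) * exp (θ * I) /
        (ρ₀ * exp (θ * I) - a)
      have hQ : ∀ θ, HasDerivAt Q (F' ρ₀ θ - dbar f (ρ₀ * exp (θ * I)) * (2 * I * ρ₀) /
          (ρ₀ * exp (θ * I) - a)) θ := fun θ => by
        have hn := hnz ρ₀ (Metric.mem_closedBall_self hδ.le) θ
        have he : HasDerivAt (fun θ : ℝ => exp (θ * I)) (exp (θ * I) * I) θ := by
          have := ((hasDerivAt_id (θ : ℂ)).mul_const I).cexp.comp_ofReal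
          simpa using this
        have hz : HasDerivAt (fun θ : ℝ => (ρ₀ : ℂ) * exp (θ * I)) (ρ₀ * (exp (θ * I) * I)) θ :=
          he.const_mul _
        have hfz := ((hfd (ρ₀ * exp (θ * I))).comp_hasDerivAt θ hz).sub_const (f a)
        refine ((hfz.mul he).div (hz.sub_const a) hn).congr_deriv ?_
        have hL := I_mul_apply_sub_apply_I_mul (fderiv ℝ f (ρ₀ * exp (θ * I))) (exp (θ * I))
        have hsm : fderiv ℝ f (ρ₀ * exp (θ * I)) (ρ₀ * (exp (θ * I) * I)) =
            ρ₀ * fderiv ℝ f (ρ₀ * exp (θ * I)) (I * exp (θ * I)) := by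
          rw [← real_smul (x := ρ₀) (z := exp (θ * I) * I), map_smul, real_smul, mul_comm I]
        have hconj : (starRingEnd ℂ) (exp (θ * I)) * exp (θ * I) = 1 := by
          rw [mul_comm, mul_conj, normSq_eq_norm_sq, norm_exp_ofReal_mul_I]; simp
        rw [hsm]
        have hk : ((ρ₀ : ℂ) * exp (θ * I) - a) * ((ρ₀ : ℂ) * exp (θ * I) - a)⁻¹ = 1 :=
          mul_inv_cancel₀ hn
        simp only [hF', dbar, Function.comp_apply, Pi.mul_apply, div_eq_mul_inv, ← inv_pow] at hL ⊢
        generalize ((ρ₀ : ℂ) * exp (θ * I) - a)⁻¹ = k at *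
        generalize fderiv ℝ f (ρ₀ * exp (θ * I)) = D at *
        generalize D (I * exp (θ * I)) = x at *
        generalize exp (θ * I) = e at *
        linear_combination ((x * ρ₀ * e + (f (ρ₀ * e) - f a) * e * I) * k) * hk -
          k * ρ₀ * e * hL + (2 * I * (1 * (2 : ℂ)⁻¹ * (D 1 + I * D I))) * k * ρ₀ * (-1) * hconj
      have h0 : ∫ θ in Set.Icc 0 (2 * Real.pi), (F' ρ₀ θ - dbar f (ρ₀ * exp (θ * I)) *
          (2 * I * ρ₀) / (ρ₀ * exp (θ * I) - a)) = 0 := by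
        have hcont : ContinuousOn (fun θ : ℝ => F' ρ₀ θ - dbar f (ρ₀ * exp (θ * I)) *
          (2 * I * ρ₀) / (ρ₀ * exp (θ * I) - a)) (Set.Icc 0 (2 * Real.pi)) :=
          hF'cθ.sub (continuous_circle_quotient (continuous_dbar hf) _ hρ₀.le hne).continuousOn
        rw [integral_Icc_eq_integral_Ioc, ← intervalIntegral.integral_of_le (by positivity),
          intervalIntegral.integral_eq_sub_of_hasDerivAt (fun θ _ => hQ θ)]
        · have := periodic_exp_mul_I 0
          simp only [zero_add] at this
          simp only [Q, this]
          simp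
        · exact ContinuousOn.intervalIntegrable_of_Icc (by positivity) hcont
      rw [integral_sub hF'cθ.integrableOn_Icc (Continuous.integrableOn_Icc
        (continuous_circle_quotient (continuous_dbar hf) _ hρ₀.le hne))] at h0
      exact sub_eq_zero.1 h0
    rw [hval] at key
    exact key.const_mul _
  · refine .of_forall fun ρ => Measurable.aestronglyMeasurable ?_
    exact Measurable.div (Continuous.measurable (by fun_prop)) (Continuous.measurable (by fun_prop))
  · refine Continuous.integrableOn_Icc (Continuous.div (by fun_prop) (by fun_prop) fun θ => ?_)
    exact circle_sub_ne_zero hρ₀.le hne θ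
  · exact hF'cθ.aestronglyMeasurable measurableSet_Icc
  · filter_upwards [ae_restrict_mem measurableSet_Icc] with θ hθ ρ hρ
    exact hC (ρ, θ) ⟨hρ, hθ⟩
  · refine .of_forall fun θ ρ hρ => ?_
    have hn := hnz ρ hρ θ
    have hz : HasDerivAt (fun ρ : ℝ => (ρ : ℂ) * exp (θ * I)) (exp (θ * I)) ρ := by
      simpa using (ofRealCLM.hasDerivAt (x := ρ)).mul_const (exp (θ * I))
    have hz' : HasDerivAt (fun ρ : ℝ => I * (ρ : ℂ) * exp (θ * I)) (I * exp (θ * I)) ρ := by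
      simpa [mul_assoc] using hz.const_mul I
    have hfz := ((hfd (ρ * exp (θ * I))).comp_hasDerivAt ρ hz).sub_const (f a)
    refine ((hfz.mul hz').div (hz.sub_const a) hn).congr_deriv ?_
    have hk : ((ρ : ℂ) * exp (θ * I) - a) * ((ρ : ℂ) * exp (θ * I) - a)⁻¹ = 1 :=
      mul_inv_cancel₀ hn
    simp only [hF', Function.comp_apply, Pi.mul_apply, div_eq_mul_inv, ← inv_pow]
    generalize ((ρ : ℂ) * exp (θ * I) - a)⁻¹ = k at *
    linear_combination ((fderiv ℝ f (ρ * exp (θ * I)) (exp (θ * I)) * (I * ρ * exp (θ * I)) +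
      (f (ρ * exp (θ * I)) - f a) * (I * exp (θ * I))) * k) * hk

lemma circleMean_eq_circleIntegral (f : ℂ → ℂ) (a : ℂ) (ρ : ℝ) :
    circleMean f a ρ = (2 * Real.pi * I)⁻¹ * circleIntegral (fun w => f w / (w - a)) 0 ρ := by
  rw [circleMean, circleIntegral, intervalIntegral.integral_of_le Real.two_pi_pos.le,
    integral_Icc_eq_integral_Ioc]
  congr 2
  ext θ
  simp only [deriv_circleMap, circleMap, zero_add, smul_eq_mul]
  ring

lemma circleS_eq_circleMean (f : ℂ → ℂ) (a : ℂ) : circleS f a = circleMean f a 1 :=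
  (circleMean_eq_circleIntegral f a 1).symm

lemma circleMean_one {a : ℂ} {ρ : ℝ} (hρ : 0 ≤ ρ) (hne : ρ ≠ ‖a‖) :
    circleMean (fun _ => 1) a ρ = if ‖a‖ < ρ then 1 else 0 := by
  have hpi : (2 * Real.pi * I : ℂ) ≠ 0 := two_pi_I_ne_zero
  rw [circleMean_eq_circleIntegral]
  split_ifs with h
  · simp only [one_div]
    rw [circleIntegral.integral_sub_inv_of_mem_ball (by simpa using h), inv_mul_cancel₀ hpi]
  · rw [circleIntegral_eq_zero_of_differentiable_on_off_countable hρ Set.countable_empty, mul_zero]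
    · have : ∀ z ∈ Metric.closedBall (0 : ℂ) ρ, z - a ≠ 0 := fun z hz h0 => by
        rw [sub_eq_zero.1 h0] at hz
        exact h (lt_of_le_of_ne (by simpa using hz) hne.symm)
      exact ContinuousOn.div (by fun_prop) (by fun_prop) this
    · intro z hz
      have : z - a ≠ 0 := fun h0 => by
        rw [sub_eq_zero.1 h0] at hz
        exact h (by simpa using hz.1)
      fun_prop (disch := exact this)

/-- The jump of the circle mean across the radius `‖a‖`. -/
lemma circleMean_eq {f : ℂ → ℂ} (hf : Continuous f) {a : ℂ} {ρ : ℝ} (hρ : 0 ≤ ρ) (hne : ρ ≠ ‖a‖) :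
    circleMean f a ρ = circleRemainder f a ρ + if ‖a‖ < ρ then f a else 0 := by
  have h1 : (if ‖a‖ < ρ then f a else 0) = f a * circleMean (fun _ => 1) a ρ := by
    rw [circleMean_one hρ hne]; simp
  rw [h1, circleRemainder, circleMean, circleMean, circleMean, mul_left_comm (f a), ← mul_add,
    ← integral_const_mul (f a), ← integral_add]
  · congr 2
    ext θ
    ring
  all_goals
    refine Continuous.integrableOn_Icc ?_
  · exact Continuous.div (by fun_prop) (by fun_prop) fun θ => circle_sub_ne_zero hρ hne θ
  · exact continuous_const.mul
      (Continuous.div (by fun_prop) (by fun_prop) fun θ => circle_sub_ne_zero hρ hne θ)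

@[simp] lemma circleRemainder_zero (f : ℂ → ℂ) (a : ℂ) : circleRemainder f a 0 = 0 := by
  simp [circleRemainder, circleMean]

/-- Integrate the radial derivative from 0 to 1; the single exceptional radius `‖a‖` is harmless
because the remainder is continuous there. The location of `a` does not matter, so boundary points
are included. -/
lemma circleRemainder_one_eq {f : ℂ → ℂ} (hf : ContDiff ℝ 1 f) (a : ℂ) :
    circleRemainder f a 1 = - discT (dbar f) a := by
  have hint := integrableOn_radialDensity (continuous_dbar hf) a
  rw [discT_eq_neg_integral_radialDensity (continuous_dbar hf), neg_neg,
    integral_Icc_eq_integral_Ioc, ← intervalIntegral.integral_of_le zero_le_one,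
    integral_eq_of_hasDerivAt_off_countable_of_le (circleRemainder f a) _ zero_le_one
      (Set.countable_singleton ‖a‖) (continuousOn_circleRemainder hf a 1)
      (fun ρ hρ => hasDerivAt_circleRemainder hf hρ.1.1 hρ.2), circleRemainder_zero, sub_zero]
  exact (intervalIntegrable_iff_integrableOn_Icc_of_le zero_le_one).2 hint

/-- The Cauchy–Green formula on the unit disc. -/
lemma circleS_add_discT {f : ℂ → ℂ} (hf : ContDiff ℝ 1 f) {a : ℂ} (ha : ‖a‖ < 1) :
    circleS f a + discT (dbar f) a = f a := by
  rw [circleS_eq_circleMean, circleMean_eq hf.continuous zero_le_one ha.ne', if_pos ha,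
    circleRemainder_one_eq hf]
  ring

/-- Continuity up to the unit circle is visible once the area integral is replaced by the circle
integral of a bounded difference quotient. -/
lemma continuousOn_discT_dbar {f : ℂ → ℂ} (hf : ContDiff ℝ 1 f) :
    ContinuousOn (discT (dbar f)) (Metric.closedBall 0 1) := by
  have h1 : discT (dbar f) = fun a => - circleRemainder f a 1 := by
    ext a; rw [circleRemainder_one_eq hf, neg_neg]
  rw [h1]
  refine ContinuousOn.neg ?_
  obtain ⟨C, hC0, hC⟩ := exists_norm_sub_le hf 1
  have hfc := hf.continuous
  intro a₀ ha₀
  refine ContinuousWithinAt.mul continuousWithinAt_const ?_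
  refine continuousWithinAt_of_dominated (bound := fun _ => C) ?_ ?_ (integrable_const _) ?_
  · refine .of_forall fun a => Measurable.aestronglyMeasurable ?_
    exact Measurable.div (Continuous.measurable (by fun_prop)) (Continuous.measurable (by fun_prop))
  · filter_upwards [self_mem_nhdsWithin] with a ha
    refine .of_forall fun θ => ?_
    have h1 := hC ((1 : ℝ) * exp (θ * I)) a (by simp) (by simpa using ha)
    have h2 : ‖I * (1 : ℝ) * exp (θ * I)‖ = 1 := by simp
    rw [norm_div, norm_mul, h2, mul_one]
    exact div_le_of_le_mul₀ (norm_nonneg _) hC0 h1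
  · have hcount : (circleMap 0 1 ⁻¹' {a₀}).Countable :=
      (Set.countable_singleton a₀).preimage_circleMap 0 one_ne_zero
    refine ae_restrict_of_ae ?_
    filter_upwards [hcount.ae_notMem volume] with θ hθ
    refine ContinuousAt.continuousWithinAt (ContinuousAt.div (by fun_prop) (by fun_prop) ?_)
    intro h
    apply hθ
    simp [circleMap, ← sub_eq_zero.1 h]

/-! ### Regularity of the Cauchy integral and of the Cauchy transform -/

lemma differentiableOn_circleS {f : ℂ → ℂ} (hf : Continuous f) :
    DifferentiableOn ℂ (circleS f) (Metric.ball 0 1) := by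
  have h := hasFPowerSeriesOn_cauchy_integral (f := f) (c := 0) (R := 1)
    hf.continuousOn.circleIntegrable' (by simp)
  have h2 : (fun w => (2 * Real.pi * I : ℂ)⁻¹ • ∮ z in C(0, (1 : ℝ≥0)), (z - w)⁻¹ • f z) =
      circleS f := by
    ext w
    simp only [circleS, smul_eq_mul, NNReal.coe_one]
    congr 2
    ext z
    ring
  rw [h2] at h
  have := h.differentiableOn
  rwa [Metric.eball_coe, NNReal.coe_one] at this

lemma dbar_eq_zero_of_differentiableAt {f : ℂ → ℂ} {a : ℂ} (hf : DifferentiableAt ℂ f a) :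
    dbar f a = 0 := by
  rw [dbar, (hf.hasFDerivAt.restrictScalars ℝ).fderiv]
  have : fderiv ℂ f a I = I * fderiv ℂ f a 1 := by
    rw [← smul_eq_mul, ← map_smul]; simp
  simp only [ContinuousLinearMap.coe_restrictScalars', this]
  linear_combination (1 / 2) * fderiv ℂ f a 1 * I_sq

lemma dbar_sub {f g : ℂ → ℂ} {a : ℂ} (hf : DifferentiableAt ℝ f a) (hg : DifferentiableAt ℝ g a) :
    dbar (fun z => f z - g z) a = dbar f a - dbar g a := by
  simp only [dbar]
  rw [fderiv_fun_sub hf hg]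
  simp only [sub_apply]
  ring

lemma dbar_comp_affine {f : ℂ → ℂ} (hf : Differentiable ℝ f) (c : ℂ) (s : ℝ) (z : ℂ) :
    dbar (fun z => f (c + s * z)) z = s * dbar f (c + s * z) := by
  have h1 : HasFDerivAt (fun z : ℂ => c + s * z) (s • ContinuousLinearMap.id ℝ ℂ) z := by
    have : (fun z : ℂ => c + s * z) = fun z => c + s • z := by simp
    rw [this]
    exact ((hasFDerivAt_id z).const_smul s).const_add c
  have h2 := ((hf (c + s * z)).hasFDerivAt.comp z h1).fderiv
  simp only [dbar]
  rw [show (fun z => f (c + s * z)) = f ∘ fun z => c + s * z from rfl, h2]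
  have h3 : ∀ v, fderiv ℝ f (c + s * z) (s • v) = s * fderiv ℝ f (c + s * z) v := fun v => by
    rw [map_smul, real_smul]
  simp only [ContinuousLinearMap.comp_apply, smul_apply, ContinuousLinearMap.id_apply, h3]
  ring

lemma dbar_eq_zero_of_notMem_tsupport {f : ℂ → ℂ} {z : ℂ} (hz : z ∉ tsupport f) :
    dbar f z = 0 := by
  simp [dbar, fderiv_of_notMem_tsupport ℝ hz]

/-- The Cauchy kernel of the plane is a fundamental solution of `∂/∂z̄`. -/
lemma integral_dbar_mul_inv {f : ℂ → ℂ} (hf : ContDiff ℝ 1 f) (hc : HasCompactSupport f) (x : ℂ) :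
    ∫ t : ℂ, ((Real.pi : ℂ) * t)⁻¹ * dbar f (x - t) = f x := by
  have hfd : Differentiable ℝ f := hf.differentiable (by simp)
  obtain ⟨R₀, hR₀⟩ := hc.isBounded.subset_closedBall x
  -- With this radius the map `w ↦ x - R w` sends the unit circle outside the support of `f`. The
  -- Cauchy–Green formula for the rescaled function at 0 then has no boundary term.
  set R := max R₀ 0 + 1
  have hR : 0 < R := by positivity
  have hsupp : ∀ w : ℂ, 1 ≤ ‖w‖ → x + (-R : ℝ) * w ∉ tsupport f := fun w hw h => by
    have h1 := hR₀ h
    rw [Metric.mem_closedBall, dist_eq_norm, add_sub_cancel_left, norm_mul, norm_real, norm_neg,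
      Real.norm_of_nonneg hR.le] at h1
    have : R ≤ R * ‖w‖ := le_mul_of_one_le_right hR.le hw
    have := le_max_left R₀ 0
    simp only [R] at *
    linarith
  set u : ℂ → ℂ := fun w => f (x + (-R : ℝ) * w) with hu
  have huc : ContDiff ℝ 1 u := hf.comp (by fun_prop)
  have h0 := circleS_add_discT huc (a := 0) (by simp)
  have hS : circleS u 0 = 0 := by
    rw [circleS, circleIntegral.integral_congr (g := fun _ => 0) zero_le_one]
    · simp [circleIntegral]
    · intro w hw
      have : f (x + (-R : ℝ) * w) = 0 :=
        image_eq_zero_of_notMem_tsupport (hsupp w (by simp at hw; simp [hw]))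
      simp only [hu, this, zero_div]
  have hT : discT (dbar u) 0 = ∫ t : ℂ, ((Real.pi : ℂ) * t)⁻¹ * dbar f (x - t) := by
    have hdu : ∀ w, dbar u w = -R * dbar f (x - R • w) := fun w => by
      rw [hu, dbar_comp_affine hfd]
      simp [sub_eq_add_neg]
    rw [discT, ← integral_indicator measurableSet_ball, ← integral_const_mul]
    have hscale := Measure.integral_comp_smul (volume : Measure ℂ)
      (fun t => (Real.pi * t)⁻¹ * dbar f (x - t)) R
    rw [finrank_real_complex, abs_of_pos (by positivity), eq_comm, inv_smul_eq_iff₀ (by positivity),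
      real_smul, ← integral_const_mul] at hscale
    rw [hscale]
    congr 1
    ext w
    have hRC : (R : ℂ) ≠ 0 := by exact_mod_cast hR.ne'
    have hpi : (Real.pi : ℂ) ≠ 0 := by exact_mod_cast Real.pi_ne_zero
    by_cases hw : w ∈ Metric.ball (0 : ℂ) 1
    · rw [Set.indicator_of_mem hw, hdu, sub_zero, real_smul]
      rcases eq_or_ne w 0 with rfl | hw0
      · simp
      push_cast
      field_simp [I_ne_zero]
    · rw [Set.indicator_of_notMem hw]
      have hz := dbar_eq_zero_of_notMem_tsupport (hsupp w (by simpa using hw))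
      rw [show x + (-R : ℝ) * w = x - R • w by simp [sub_eq_add_neg]] at hz
      rw [hz]
      simp
  rw [hS, hT, zero_add] at h0
  rw [h0, hu]
  simp

/-- Convolve with the locally integrable kernel `1/(πt)`: derivatives fall on `f`, and
`integral_dbar_mul_inv` identifies `∂̄` of the result. -/
lemma exists_dbar_eq {f : ℂ → ℂ} (hf : ContDiff ℝ ∞ f) (hc : HasCompactSupport f) :
    ∃ F : ℂ → ℂ, ContDiff ℝ ∞ F ∧ dbar F = f := by
  have hk : LocallyIntegrable (fun t : ℂ => ((Real.pi : ℂ) * t)⁻¹) := by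
    refine locallyIntegrable_of_norm_le_rpow (α := 1) (C := Real.pi⁻¹) (by simp) (by simp)
      (.of_forall fun t => ?_) (Measurable.aestronglyMeasurable (by fun_prop))
    rw [Real.rpow_neg_one]
    simp [abs_of_pos Real.pi_pos, mul_comm]
  have hf1 : ContDiff ℝ 1 f := hf.of_le (by simp)
  refine ⟨convolution (fun t : ℂ => ((Real.pi : ℂ) * t)⁻¹) f (ContinuousLinearMap.mul ℝ ℂ) volume,
    hc.contDiff_convolution_right _ hk hf, ?_⟩
  ext x
  have hd := (hc.hasFDerivAt_convolution_right (ContinuousLinearMap.mul ℝ ℂ) hk hf1 x).fderiv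
  have hv : ∀ v, fderiv ℝ (convolution (fun t : ℂ => ((Real.pi : ℂ) * t)⁻¹) f
      (ContinuousLinearMap.mul ℝ ℂ) volume) x v =
      ∫ t, ((Real.pi : ℂ) * t)⁻¹ * fderiv ℝ f (x - t) v := fun v => by
    rw [hd, convolution_precompR_apply _ hk (hc.fderiv ℝ) (hf1.continuous_fderiv (by simp))]
    rfl
  have hi : ∀ v, Integrable fun t => ((Real.pi : ℂ) * t)⁻¹ * fderiv ℝ f (x - t) v := fun v => by
    have hcv : HasCompactSupport fun y => fderiv ℝ f y v := hc.fderiv_apply ℝ v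
    have := (hcv.convolutionExists_right (ContinuousLinearMap.mul ℝ ℂ) hk
      ((hf1.continuous_fderiv (by simp)).clm_apply continuous_const)) x
    exact this
  rw [← integral_dbar_mul_inv hf1 hc x, dbar, hv, hv, ← integral_const_mul,
    ← integral_add (hi 1) ((hi I).const_mul I), ← integral_const_mul]
  congr 1
  ext t
  simp only [dbar]
  ring

/-- The Cauchy transform of a test function is continuously differentiable on the disc and
inverts `∂/∂z̄`. -/
lemma contDiffOn_discT {f : ℂ → ℂ} (hf : ContDiff ℝ ∞ f) (hc : HasCompactSupport f) :
    ContDiffOn ℝ 1 (discT f) (Metric.ball 0 1) ∧ ∀ a ∈ Metric.ball (0 : ℂ) 1, dbar (discT f) a = f a := by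
  -- Once `f = ∂̄F`, the Cauchy–Green formula turns the transform into `F` minus the Cauchy integral
  -- of `F`, which is holomorphic in the disc.
  obtain ⟨F, hF, rfl⟩ := exists_dbar_eq hf hc
  have hF1 : ContDiff ℝ 1 F := hF.of_le (by simp)
  have hS := differentiableOn_circleS hF.continuous
  have heq : ∀ a ∈ Metric.ball (0 : ℂ) 1, discT (dbar F) a = F a - circleS F a := fun a ha => by
    rw [← circleS_add_discT hF1 (a := a) (by simpa using ha)]; ring
  refine ⟨?_, fun a ha => ?_⟩
  · refine (hF1.contDiffOn.sub ?_).congr heq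
    exact (hS.contDiffOn Metric.isOpen_ball).restrict_scalars ℝ
  · have hev : discT (dbar F) =ᶠ[𝓝 a] fun a => F a - circleS F a :=
      Filter.eventually_of_mem (Metric.isOpen_ball.mem_nhds ha) heq
    have hSa : DifferentiableAt ℂ (circleS F) a := hS.differentiableAt (Metric.isOpen_ball.mem_nhds ha)
    have : dbar (discT (dbar F)) a = dbar (fun a => F a - circleS F a) a := by
      rw [dbar, hev.fderiv_eq]; rfl
    rw [this, dbar_sub ((hF1.differentiable (by simp)) a) (hSa.restrictScalars ℝ),
      dbar_eq_zero_of_differentiableAt hSa, sub_zero]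

/-! ### Integral operators in one variable on the closed polydisc -/

instance (n : ℕ) : CompactSpace (closedPolydisc n) :=
  isCompact_iff_compactSpace.1 (isCompact_closedPolydisc n)

lemma zeroExt_of_mem {n : ℕ} (u : C(closedPolydisc n, ℂ)) {z : Fin n → ℂ}
    (hz : z ∈ closedPolydisc n) : zeroExt u z = u ⟨z, hz⟩ := dif_pos hz

@[simp] lemma zeroExt_coe {n : ℕ} (u : C(closedPolydisc n, ℂ)) (z : closedPolydisc n) :
    zeroExt u z = u z := dif_pos z.2

lemma update_mem_closedPolydisc {n : ℕ} {z : Fin n → ℂ} (hz : z ∈ closedPolydisc n) (i : Fin n)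
    {a : ℂ} (ha : ‖a‖ ≤ 1) : Function.update z i a ∈ closedPolydisc n := fun j => by
  rcases eq_or_ne j i with rfl | h
  · simpa using ha
  · simpa [h] using hz j

/-- Replacing a coordinate of a point of the closed polydisc. -/
def updatePoint {n : ℕ} (i : Fin n) :
    C(Metric.closedBall (0 : ℂ) 1 × closedPolydisc n, closedPolydisc n) where
  toFun p := ⟨Function.update p.2.1 i p.1.1,
    update_mem_closedPolydisc p.2.2 i (mem_closedBall_zero_iff.1 p.1.2)⟩
  continuous_toFun := by fun_prop

/-- The function `f` with its `i`-th variable frozen, depending continuously on the frozen value. -/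
def freeze {n : ℕ} (i : Fin n) (f : C(closedPolydisc n, ℂ)) :
    C(Metric.closedBall (0 : ℂ) 1, C(closedPolydisc n, ℂ)) :=
  (f.comp (updatePoint i)).curry

lemma freeze_apply {n : ℕ} (i : Fin n) (f : C(closedPolydisc n, ℂ))
    (a : Metric.closedBall (0 : ℂ) 1) (z : closedPolydisc n) :
    freeze i f a z = f (updatePoint i (a, z)) := rfl

lemma norm_freeze_le {n : ℕ} (i : Fin n) (f : C(closedPolydisc n, ℂ))
    (a : Metric.closedBall (0 : ℂ) 1) : ‖freeze i f a‖ ≤ ‖f‖ :=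
  (ContinuousMap.norm_le _ (norm_nonneg _)).2 fun _ => f.norm_coe_le_norm _

section Slot

variable {W : Type*} [TopologicalSpace W] [MeasurableSpace W]
  [OpensMeasurableSpace W] {n : ℕ}

lemma integrable_smul_freeze {μ : Measure W} (c : C(W, Metric.closedBall (0 : ℂ) 1)) {k : W → ℂ}
    (hk : Integrable k μ) (i : Fin n) (f : C(closedPolydisc n, ℂ)) :
    Integrable (fun w => k w • freeze i f (c w)) μ := by
  refine (hk.norm.mul_const ‖f‖).mono'
    (hk.1.smul ((freeze i f).continuous.comp c.continuous).aestronglyMeasurable)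
    (.of_forall fun w => ?_)
  rw [norm_smul]
  gcongr
  exact norm_freeze_le i f _

open Classical in
/-- The operator that integrates the `i`-th variable of a function along `c` against the kernel
`k`. -/
def slotOp (μ : Measure W) (c : C(W, Metric.closedBall (0 : ℂ) 1)) (k : W → ℂ) (i : Fin n) :
    C(closedPolydisc n, ℂ) →L[ℂ] C(closedPolydisc n, ℂ) :=
  if hk : Integrable k μ then
    LinearMap.mkContinuous
      { toFun := fun f => ∫ w, k w • freeze i f (c w) ∂μ
        map_add' := fun f g => by
          rw [← integral_add (integrable_smul_freeze c hk i f) (integrable_smul_freeze c hk i g)]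
          congr 1
          ext w z
          simp [freeze_apply, mul_add]
        map_smul' := fun a f => by
          rw [RingHom.id_apply, ← integral_smul]
          congr 1
          ext w z
          simp [freeze_apply, mul_left_comm] }
      (∫ w, ‖k w‖ ∂μ) fun f => by
        rw [← integral_mul_const]
        refine norm_integral_le_of_norm_le (hk.norm.mul_const _) (.of_forall fun w => ?_)
        rw [norm_smul]
        gcongr
        exact norm_freeze_le i f _
  else 0

lemma norm_slotOp_le (μ : Measure W) (c : C(W, Metric.closedBall (0 : ℂ) 1)) (k : W → ℂ)
    (i : Fin n) : ‖slotOp μ c k i‖ ≤ ∫ w, ‖k w‖ ∂μ := by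
  have h0 : 0 ≤ ∫ w, ‖k w‖ ∂μ := integral_nonneg fun _ => norm_nonneg _
  unfold slotOp
  split_ifs
  · exact LinearMap.mkContinuous_norm_le _ h0 _
  · simpa using h0

lemma slotOp_apply {μ : Measure W} (c : C(W, Metric.closedBall (0 : ℂ) 1)) {k : W → ℂ}
    (hk : Integrable k μ) (i : Fin n) (f : C(closedPolydisc n, ℂ)) (z : closedPolydisc n) :
    slotOp μ c k i f z = ∫ w, k w * f (updatePoint i (c w, z)) ∂μ := by
  rw [slotOp, dif_pos hk]
  exact (((ContinuousMap.evalCLM ℂ z).integral_comp_comm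
    (integrable_smul_freeze c hk i f)).symm : _)

end Slot

/-- The product function `z ↦ ∏ u_i(z_i)` on the closed polydisc. -/
def prodFn {n : ℕ} (u : Fin n → C(ℂ, ℂ)) : C(closedPolydisc n, ℂ) where
  toFun z := ∏ i, u i (z.1 i)
  continuous_toFun := continuous_finsetProd _ fun i _ =>
    (u i).continuous.comp ((continuous_apply i).comp continuous_subtype_val)

lemma prodFn_apply {n : ℕ} (u : Fin n → C(ℂ, ℂ)) (z : closedPolydisc n) :
    prodFn u z = ∏ i, u i (z.1 i) := rfl

lemma prod_update_apply {n : ℕ} (u : Fin n → C(ℂ, ℂ)) (z : Fin n → ℂ) (i : Fin n) (v : C(ℂ, ℂ)) :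
    ∏ j, Function.update u i v j (z j) = v (z i) * ∏ j ∈ Finset.univ.erase i, u j (z j) := by
  rw [← Finset.mul_prod_erase _ _ (Finset.mem_univ i), Function.update_self]
  congr 1
  refine Finset.prod_congr rfl fun j hj => ?_
  rw [Function.update_of_ne (Finset.ne_of_mem_erase hj)]

/-- Only the `i`-th factor is touched, and it becomes a constant. Product functions are therefore
stable under these operators, and compositions can be evaluated factor by factor. -/
lemma slotOp_prodFn {W : Type*} [TopologicalSpace W] [MeasurableSpace W]
    [OpensMeasurableSpace W] {n : ℕ}
    {μ : Measure W} (c : C(W, Metric.closedBall (0 : ℂ) 1)) {k : W → ℂ}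
    (hk : Integrable k μ) (i : Fin n) (u : Fin n → C(ℂ, ℂ)) :
    slotOp μ c k i (prodFn u) =
      prodFn (Function.update u i (ContinuousMap.const ℂ (∫ w, k w * u i (c w) ∂μ))) := by
  ext z
  rw [slotOp_apply c hk, prodFn_apply, prod_update_apply, ContinuousMap.const_apply,
    ← integral_mul_const]
  congr 1
  ext w
  rw [prodFn_apply, ← Finset.mul_prod_erase _ _ (Finset.mem_univ i), mul_assoc]
  congr 2
  · simp [updatePoint]
  · refine Finset.prod_congr rfl fun j hj => ?_
    simp [updatePoint, Function.update_of_ne (Finset.ne_of_mem_erase hj)]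

/-- The parametrization of the unit circle by the angle. -/
def unitCircle : C(ℝ, Metric.closedBall (0 : ℂ) 1) where
  toFun θ := ⟨exp (θ * I), by simp⟩
  continuous_toFun := by fun_prop

/-- The radial retraction of the plane onto the closed unit disc. -/
def discRetraction : C(ℂ, Metric.closedBall (0 : ℂ) 1) where
  toFun w := ⟨w / (max 1 ‖w‖ : ℝ), by
    rw [mem_closedBall_zero_iff, norm_div, norm_real, Real.norm_of_nonneg (by positivity),
      div_le_one (by positivity)]
    exact le_max_right _ _⟩
  continuous_toFun := by
    refine Continuous.subtype_mk (Continuous.div (by fun_prop) (by fun_prop) fun w => ?_) _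
    have : (0 : ℝ) < max 1 ‖w‖ := by positivity
    exact_mod_cast this.ne'

lemma discRetraction_of_mem {w : ℂ} (hw : w ∈ Metric.ball (0 : ℂ) 1) :
    (discRetraction w : ℂ) = w := by
  have : max 1 ‖w‖ = 1 := max_eq_left (mem_ball_zero_iff.1 hw).le
  simp [discRetraction, this]

/-- The Cauchy kernel of the unit circle in the angular variable. -/
def circleKernel (a : ℂ) (θ : ℝ) : ℂ :=
  (2 * Real.pi * I)⁻¹ * (I * exp (θ * I) / (exp (θ * I) - a))

/-- The kernel of the Cauchy transform on the disc. -/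
def discKernel (a w : ℂ) : ℂ := (2 * Real.pi * I)⁻¹ * (-2 * I / (w - a))

/-- The operator `S_i` with the parameter `a` in place of the `i`-th variable. -/
def circleOp {n : ℕ} (i : Fin n) (a : ℂ) : C(closedPolydisc n, ℂ) →L[ℂ] C(closedPolydisc n, ℂ) :=
  slotOp (volume.restrict (Set.Icc 0 (2 * Real.pi))) unitCircle (circleKernel a) i

/-- The operator `T_i` with the parameter `a` in place of the `i`-th variable. -/
def discOp {n : ℕ} (i : Fin n) (a : ℂ) : C(closedPolydisc n, ℂ) →L[ℂ] C(closedPolydisc n, ℂ) :=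
  slotOp (volume.restrict (Metric.ball (0 : ℂ) 1)) discRetraction (discKernel a) i

lemma continuous_circleKernel {a : ℂ} (ha : ‖a‖ < 1) : Continuous (circleKernel a) := by
  refine continuous_const.mul (Continuous.div (by fun_prop) (by fun_prop) fun θ => ?_)
  simpa using circle_sub_ne_zero zero_le_one ha.ne' θ

lemma integrable_circleKernel {a : ℂ} (ha : ‖a‖ < 1) :
    Integrable (circleKernel a) (volume.restrict (Set.Icc 0 (2 * Real.pi))) :=
  (continuous_circleKernel ha).integrableOn_Icc

lemma integrableOn_norm_inv (R : ℝ) :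
    IntegrableOn (fun w : ℂ => ‖w‖⁻¹) (Metric.ball 0 R) := by
  refine integrableOn_ball_of_norm_le_rpow (α := 1) (C := 1) (by simp) (by simp)
    (.of_forall fun t => ?_) (Measurable.aestronglyMeasurable (by fun_prop))
  rw [Real.rpow_neg_one]
  simp

lemma norm_discKernel (a w : ℂ) : ‖discKernel a w‖ = Real.pi⁻¹ * ‖w - a‖⁻¹ := by
  simp only [discKernel, norm_mul, norm_div, norm_inv, norm_neg, norm_I, norm_real,
    RCLike.norm_ofNat, Real.norm_of_nonneg Real.pi_pos.le]
  field_simp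

/-- The unit disc translated by `-a` lies in the disc of radius 2, so the bound does not depend on
`a`. -/
lemma integrableOn_norm_sub_inv {a : ℂ} (ha : ‖a‖ ≤ 1) :
    IntegrableOn (fun w : ℂ => ‖w - a‖⁻¹) (Metric.ball 0 1) ∧
      ∫ w in Metric.ball (0 : ℂ) 1, ‖w - a‖⁻¹ ≤ ∫ w in Metric.ball (0 : ℂ) 2, ‖w‖⁻¹ := by
  have h := (integrableOn_norm_inv 2).integrable_indicator measurableSet_ball
  have h2 := h.comp_sub_right a
  have hle : ∀ w ∈ Metric.ball (0 : ℂ) 1, ‖w - a‖⁻¹ =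
      (Metric.ball (0 : ℂ) 2).indicator (fun w : ℂ => ‖w‖⁻¹) (w - a) := fun w hw => by
    rw [Set.indicator_of_mem]
    rw [mem_ball_zero_iff] at hw ⊢
    linarith [norm_sub_le w a]
  refine ⟨h2.integrableOn.congr_fun (fun w hw => (hle w hw).symm) measurableSet_ball, ?_⟩
  rw [setIntegral_congr_fun measurableSet_ball hle, ← integral_indicator (s := Metric.ball (0 : ℂ) 2)
    measurableSet_ball, ← integral_sub_right_eq_self ((Metric.ball (0 : ℂ) 2).indicator _) a]
  exact setIntegral_le_integral h2
    (.of_forall fun w => Set.indicator_nonneg (fun _ _ => by positivity) _)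

lemma integrable_discKernel {a : ℂ} (ha : ‖a‖ ≤ 1) :
    Integrable (discKernel a) (volume.restrict (Metric.ball (0 : ℂ) 1)) := by
  refine ((integrableOn_norm_sub_inv ha).1.const_mul Real.pi⁻¹).mono'
    (Measurable.aestronglyMeasurable (by unfold discKernel; fun_prop)) (.of_forall fun w => ?_)
  rw [norm_discKernel]

lemma norm_discOp_le {n : ℕ} (i : Fin n) {a : ℂ} (ha : ‖a‖ ≤ 1) :
    ‖discOp i a‖ ≤ Real.pi⁻¹ * ∫ w in Metric.ball (0 : ℂ) 2, ‖w‖⁻¹ := by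
  refine (norm_slotOp_le _ _ _ _).trans ?_
  simp_rw [norm_discKernel]
  rw [integral_const_mul]
  have := (integrableOn_norm_sub_inv ha).2
  have := Real.pi_pos
  gcongr

/-- The Cauchy kernel of the circle is at most `(2π)⁻¹ (1 - R)⁻¹`. This blows up at the boundary, so
the Nijenhuis–Woolf functionals are estimated only on compact subsets of the open polydisc. -/
lemma norm_circleOp_le {n : ℕ} (i : Fin n) {a : ℂ} {R : ℝ} (hR : R < 1) (ha : ‖a‖ ≤ R) :
    ‖circleOp i a‖ ≤ (1 - R)⁻¹ := by
  have hpi := Real.pi_pos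
  refine (norm_slotOp_le _ _ _ _).trans ?_
  have hle : ∀ θ : ℝ, ‖circleKernel a θ‖ ≤ (2 * Real.pi)⁻¹ * (1 - R)⁻¹ := fun θ => by
    have h1 : 1 - R ≤ ‖exp (θ * I) - a‖ := by
      have := norm_sub_norm_le (exp (θ * I)) a
      rw [norm_exp_ofReal_mul_I] at this
      linarith
    simp only [circleKernel, norm_mul, norm_div, norm_inv, norm_I, norm_real, RCLike.norm_ofNat,
      Real.norm_of_nonneg hpi.le, norm_exp_ofReal_mul_I, mul_one, one_div]
    have : 0 < 1 - R := by linarith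
    gcongr
  calc _ ≤ ∫ θ in Set.Icc 0 (2 * Real.pi), (2 * Real.pi)⁻¹ * (1 - R)⁻¹ :=
        integral_mono (integrable_circleKernel (by linarith)).norm (integrable_const _) hle
    _ = (1 - R)⁻¹ := by
        simp only [integral_const, MeasurableSet.univ, measureReal_restrict_apply, Set.univ_inter,
          Real.volume_real_Icc, sub_zero, smul_eq_mul]
        rw [max_eq_left (by positivity)]
        field_simp

lemma integral_circleKernel_mul (f : ℂ → ℂ) (a : ℂ) :
    ∫ θ in Set.Icc 0 (2 * Real.pi), circleKernel a θ * f (exp (θ * I)) = circleS f a := by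
  rw [circleS_eq_circleMean, circleMean, ← integral_const_mul]
  congr 1
  ext θ
  simp only [circleKernel, ofReal_one, one_mul, mul_one]
  ring

lemma integral_discKernel_mul (f : ℂ → ℂ) (a : ℂ) :
    ∫ w in Metric.ball (0 : ℂ) 1, discKernel a w * f w = discT f a := by
  rw [discT, ← integral_const_mul]
  congr 1
  ext w
  simp only [discKernel]
  ring

lemma circleOp_prodFn {n : ℕ} (i : Fin n) {a : ℂ} (ha : ‖a‖ < 1) (u : Fin n → C(ℂ, ℂ)) :
    circleOp i a (prodFn u) =
      prodFn (Function.update u i (ContinuousMap.const ℂ (circleS (u i) a))) := by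
  rw [circleOp, slotOp_prodFn _ (integrable_circleKernel ha), ← integral_circleKernel_mul]
  rfl

lemma discOp_prodFn {n : ℕ} (i : Fin n) {a : ℂ} (ha : ‖a‖ ≤ 1) (u : Fin n → C(ℂ, ℂ)) :
    discOp i a (prodFn u) =
      prodFn (Function.update u i (ContinuousMap.const ℂ (discT (u i) a))) := by
  rw [discOp, slotOp_prodFn _ (integrable_discKernel ha), ← integral_discKernel_mul,
    setIntegral_congr_fun measurableSet_ball fun w hw => ?_]
  simp only [discRetraction_of_mem hw]

variable {n : ℕ}

/-! ### The Nijenhuis–Woolf operator as a family of functionals -/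

/-- The composition `S_m ⋯ S_1` with the coordinates of `z` as parameters. -/
def circleOps (z : Fin n → ℂ) : ℕ → C(closedPolydisc n, ℂ) →L[ℂ] C(closedPolydisc n, ℂ)
  | 0 => ContinuousLinearMap.id ℂ _
  | m + 1 => if h : m < n then (circleOp ⟨m, h⟩ (z ⟨m, h⟩)).comp (circleOps z m) else circleOps z m

/-- The functional `f ↦ T_j S_{j-1} ⋯ S_1 [f](z)`. -/
def nwTerm (z : closedPolydisc n) (j : Fin n) : C(closedPolydisc n, ℂ) →L[ℂ] ℂ :=
  (ContinuousMap.evalCLM ℂ z).comp ((discOp j (z.1 j)).comp (circleOps z.1 j))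

lemma circleOp_apply (i : Fin n) {a : ℂ} (ha : ‖a‖ < 1) (f : C(closedPolydisc n, ℂ))
    (ζ : closedPolydisc n) : circleOp i a f ζ =
      (2 * Real.pi * I)⁻¹ *
        circleIntegral (fun w => zeroExt f (Function.update ζ.1 i w) / (w - a)) 0 1 := by
  have h := circleS_eq_circleMean (fun w => zeroExt f (Function.update ζ.1 i w)) a
  rw [circleS] at h
  rw [h, ← circleS_eq_circleMean, ← integral_circleKernel_mul, circleOp,
    slotOp_apply _ (integrable_circleKernel ha)]
  congr 1
  ext θ
  congr 1
  exact (zeroExt_coe f _).symm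

lemma discOp_apply (i : Fin n) {a : ℂ} (ha : ‖a‖ ≤ 1) (f : C(closedPolydisc n, ℂ))
    (ζ : closedPolydisc n) : discOp i a f ζ =
      (2 * Real.pi * I)⁻¹ * ∫ w in Metric.ball (0 : ℂ) 1,
        zeroExt f (Function.update ζ.1 i w) / (w - a) * (-2 * I) := by
  change _ = discT (fun w => zeroExt f (Function.update ζ.1 i w)) a
  rw [← integral_discKernel_mul, discOp, slotOp_apply _ (integrable_discKernel ha)]
  refine setIntegral_congr_fun measurableSet_ball fun w hw => ?_
  congr 1
  rw [← zeroExt_coe]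
  simp [updatePoint, discRetraction_of_mem hw]

/-- `cauchyCircles` reads its parameters off the point of evaluation, whereas `circleOps` takes them
from a fixed `z`. They agree as soon as the coordinates already used as parameters are those of `z`.
The induction closes because the operator added at stage `m + 1` moves only coordinate `m`. -/
lemma cauchyCircles_eq {z : Fin n → ℂ} (hz : z ∈ polydisc n) (f : C(closedPolydisc n, ℂ)) (m : ℕ) :
    ∀ ζ : closedPolydisc n, (∀ i : Fin n, (i : ℕ) < m → ζ.1 i = z i) →
      cauchyCircles m (zeroExt f) ζ.1 = circleOps z m f ζ := by
  induction m with
  | zero => intro ζ _; simp [cauchyCircles, circleOps]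
  | succ m ih =>
    intro ζ hζ
    rw [cauchyCircles, circleOps]
    split_ifs with h
    · rw [ContinuousLinearMap.comp_apply, circleOp_apply _ (hz _), cauchyCircle,
        hζ ⟨m, h⟩ (Nat.lt_succ_self m)]
      congr 1
      refine circleIntegral.integral_congr zero_le_one fun w hw => ?_
      have hw1 : ‖w‖ = 1 := by simpa using hw
      have hmem := update_mem_closedPolydisc ζ.2 ⟨m, h⟩ hw1.le
      rw [zeroExt_of_mem _ hmem, ih ⟨_, hmem⟩]
      intro i hi
      have hne : i ≠ ⟨m, h⟩ := fun h' => by subst h'; simp at hi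
      simp only
      rw [Function.update_of_ne hne, hζ i (by omega)]
    · exact ih ζ fun i hi => hζ i (by omega)

lemma cauchyDisc_cauchyCircles_eq (z : closedPolydisc n) (hz : z.1 ∈ polydisc n)
    (f : C(closedPolydisc n, ℂ)) (j : Fin n) :
    cauchyDisc j (cauchyCircles (j : ℕ) (zeroExt f)) z.1 = nwTerm z j f := by
  rw [nwTerm, ContinuousLinearMap.comp_apply, ContinuousLinearMap.comp_apply,
    ContinuousMap.evalCLM_apply, discOp_apply _ (z.2 j), cauchyDisc]
  congr 1
  refine setIntegral_congr_fun measurableSet_ball fun w hw => ?_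
  have hmem := update_mem_closedPolydisc z.2 j (mem_ball_zero_iff.1 hw).le
  rw [zeroExt_of_mem _ hmem, ← cauchyCircles_eq hz]
  intro i hi
  exact Function.update_of_ne (fun h => by subst h; simp at hi) _ _

/-- The Nijenhuis–Woolf operator at a point, as a functional. -/
def nwFunctional (z : closedPolydisc n) : (Fin n → C(closedPolydisc n, ℂ)) →L[ℂ] ℂ :=
  ∑ j, (nwTerm z j).comp (ContinuousLinearMap.proj j)

lemma nwFunctional_apply (z : closedPolydisc n) (g : Fin n → C(closedPolydisc n, ℂ)) :
    nwFunctional z g = ∑ j, nwTerm z j (g j) := by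
  simp [nwFunctional]

lemma nijenhuisWoolf_eq (z : closedPolydisc n) (hz : z.1 ∈ polydisc n)
    (g : Fin n → C(closedPolydisc n, ℂ)) : nijenhuisWoolf g z.1 = nwFunctional z g := by
  rw [nwFunctional_apply, nijenhuisWoolf]
  exact Finset.sum_congr rfl fun j _ => cauchyDisc_cauchyCircles_eq z hz (g j) j

lemma circleOps_prodFn {z : Fin n → ℂ} (hz : z ∈ polydisc n) (u : Fin n → C(ℂ, ℂ)) (m : ℕ) :
    circleOps z m (prodFn u) = prodFn fun i =>
      if (i : ℕ) < m then ContinuousMap.const ℂ (circleS (u i) (z i)) else u i := by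
  induction m with
  | zero => simp [circleOps]
  | succ m ih =>
    rw [circleOps]
    split_ifs with h
    · rw [ContinuousLinearMap.comp_apply, ih, circleOp_prodFn _ (hz _)]
      congr 1
      ext i : 1
      rcases eq_or_ne i ⟨m, h⟩ with rfl | hne
      · simp
      · have : (i : ℕ) ≠ m := fun h' => hne (Fin.ext h')
        rw [Function.update_of_ne hne]
        have : (i : ℕ) < m + 1 ↔ (i : ℕ) < m := by omega
        simp only [this]
    · rw [ih]
      congr 1
      ext i : 1
      have : (i : ℕ) < m + 1 ↔ (i : ℕ) < m := by omega
      simp only [this]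

/-- The factors of `T_j S_{j-1} ⋯ S_1` applied to a product function. -/
def nwFactor (u : Fin n → C(ℂ, ℂ)) (j i : Fin n) : ℂ → ℂ :=
  if i < j then circleS (u i) else if i = j then discT (u i) else u i

lemma nwTerm_prodFn (z : closedPolydisc n) (hz : z.1 ∈ polydisc n) (u : Fin n → C(ℂ, ℂ))
    (j : Fin n) : nwTerm z j (prodFn u) = ∏ i, nwFactor u j i (z.1 i) := by
  rw [nwTerm, ContinuousLinearMap.comp_apply, ContinuousLinearMap.comp_apply,
    ContinuousMap.evalCLM_apply, circleOps_prodFn hz, discOp_prodFn _ (z.2 j), prodFn_apply]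
  refine Finset.prod_congr rfl fun i _ => ?_
  rcases eq_or_ne i j with rfl | hne
  · simp [nwFactor]
  · rw [Function.update_of_ne hne, nwFactor]
    by_cases h : i < j
    · simp [h]
    · simp [h, hne]

lemma prod_nwFactor (u : Fin n → C(ℂ, ℂ)) (z : Fin n → ℂ) (j : Fin n) :
    ∏ i, nwFactor u j i (z i) = discT (u j) (z j) * (∏ i with i < j, circleS (u i) (z i)) *
      ∏ i with j < i, u i (z i) := by
  rw [← Finset.mul_prod_erase _ _ (Finset.mem_univ j), mul_assoc]
  congr 1
  · simp [nwFactor]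
  · have : Finset.univ.erase j = (Finset.univ.filter fun i => i < j).disjUnion
        (Finset.univ.filter fun i => j < i) (by
          rw [Finset.disjoint_filter]; intro i _ h; exact not_lt.2 h.le) := by
      ext i
      simp [lt_or_lt_iff_ne]
    rw [this, Finset.prod_disjUnion]
    congr 1
    · refine Finset.prod_congr rfl fun i hi => ?_
      rw [nwFactor, if_pos (Finset.mem_filter.1 hi).2]
    · refine Finset.prod_congr rfl fun i hi => ?_
      have h := (Finset.mem_filter.1 hi).2
      rw [nwFactor, if_neg (not_lt.2 h.le), if_neg h.ne']

lemma norm_circleOps_le {R : ℝ} (hR0 : 0 ≤ R) (hR : R < 1) {z : Fin n → ℂ} (hz : ∀ i, ‖z i‖ ≤ R)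
    (m : ℕ) : ‖circleOps z m‖ ≤ ((1 - R)⁻¹) ^ m := by
  have h1 : 1 ≤ (1 - R)⁻¹ := (one_le_inv₀ (by linarith)).2 (by linarith)
  induction m with
  | zero => simpa [circleOps] using ContinuousLinearMap.norm_id_le
  | succ m ih =>
    rw [circleOps]
    split_ifs with h
    · refine (ContinuousLinearMap.opNorm_comp_le _ _).trans ?_
      rw [pow_succ']
      gcongr
      exact norm_circleOp_le _ hR (hz _)
    · refine ih.trans (pow_le_pow_right₀ h1 (Nat.le_succ m))

lemma exists_norm_nwTerm_le {R : ℝ} (hR0 : 0 ≤ R) (hR : R < 1) (j : Fin n) :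
    ∃ C, 0 ≤ C ∧ ∀ z : closedPolydisc n, (∀ i, ‖z.1 i‖ ≤ R) → ‖nwTerm z j‖ ≤ C := by
  have hpi := Real.pi_pos
  have h0 : 0 ≤ (1 - R)⁻¹ := inv_nonneg.2 (by linarith)
  have h1 : 0 ≤ ∫ w in Metric.ball (0 : ℂ) 2, ‖w‖⁻¹ := integral_nonneg fun _ => by positivity
  refine ⟨(Real.pi⁻¹ * ∫ w in Metric.ball (0 : ℂ) 2, ‖w‖⁻¹) * ((1 - R)⁻¹) ^ (j : ℕ),
    by positivity, fun z hz => ?_⟩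
  refine ContinuousLinearMap.opNorm_le_bound _ (by positivity) fun f => ?_
  rw [nwTerm, ContinuousLinearMap.comp_apply, ContinuousMap.evalCLM_apply]
  refine (ContinuousMap.norm_coe_le_norm _ _).trans ?_
  refine (ContinuousLinearMap.le_opNorm _ _).trans ?_
  gcongr
  refine (ContinuousLinearMap.opNorm_comp_le _ _).trans ?_
  gcongr
  · exact norm_discOp_le _ (z.2 j)
  · exact norm_circleOps_le hR0 hR hz _

/-! ### Functionals given by kernels -/

section Kernel

variable {W : Type*} [TopologicalSpace W] [MeasurableSpace W] [OpensMeasurableSpace W]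

lemma integrable_mul_comp {μ : Measure W} {k : W → ℂ} (hk : Integrable k μ)
    (c : C(W, closedPolydisc n)) (f : C(closedPolydisc n, ℂ)) :
    Integrable (fun w => k w * f (c w)) μ := by
  refine (hk.norm.mul_const ‖f‖).mono'
    (hk.1.mul (f.continuous.comp c.continuous).aestronglyMeasurable) (.of_forall fun w => ?_)
  rw [norm_mul]
  gcongr
  exact f.norm_coe_le_norm _

open Classical in
/-- The functional `f ↦ ∫ k(w) f(c(w)) dμ(w)`. -/
def kernelFunctional (μ : Measure W) (k : W → ℂ) (c : C(W, closedPolydisc n)) :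
    C(closedPolydisc n, ℂ) →L[ℂ] ℂ :=
  if hk : Integrable k μ then
    LinearMap.mkContinuous
      { toFun := fun f => ∫ w, k w * f (c w) ∂μ
        map_add' := fun f g => by
          rw [← integral_add (integrable_mul_comp hk c f) (integrable_mul_comp hk c g)]
          simp [mul_add]
        map_smul' := fun a f => by
          rw [RingHom.id_apply, smul_eq_mul, ← integral_const_mul]
          simp [mul_left_comm] }
      (∫ w, ‖k w‖ ∂μ) fun f => by
        rw [← integral_mul_const]
        refine norm_integral_le_of_norm_le (hk.norm.mul_const _) (.of_forall fun w => ?_)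
        rw [norm_mul]
        gcongr
        exact f.norm_coe_le_norm _
  else 0

lemma kernelFunctional_apply {μ : Measure W} {k : W → ℂ} (hk : Integrable k μ)
    (c : C(W, closedPolydisc n)) (f : C(closedPolydisc n, ℂ)) :
    kernelFunctional μ k c f = ∫ w, k w * f (c w) ∂μ := by
  rw [kernelFunctional, dif_pos hk]; rfl

lemma norm_kernelFunctional_le (μ : Measure W) (k : W → ℂ) (c : C(W, closedPolydisc n)) :
    ‖kernelFunctional μ k c‖ ≤ ∫ w, ‖k w‖ ∂μ := by
  have h0 : 0 ≤ ∫ w, ‖k w‖ ∂μ := integral_nonneg fun _ => norm_nonneg _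
  unfold kernelFunctional
  split_ifs
  · exact LinearMap.mkContinuous_norm_le _ h0 _
  · simpa using h0

end Kernel

/-! ### The Cauchy torus integral as a functional -/

/-- The parametrization of the distinguished boundary. -/
def torusPoint : C(Fin n → ℝ, closedPolydisc n) where
  toFun θ := ⟨fun i => exp (θ i * I), fun i => by simp⟩
  continuous_toFun := by fun_prop

/-- The Cauchy torus integral at `z`, as a functional. -/
def torusFunctional (z : Fin n → ℂ) : C(closedPolydisc n, ℂ) →L[ℂ] ℂ :=
  kernelFunctional (Measure.pi fun _ : Fin n => volume.restrict (Set.Icc 0 (2 * Real.pi)))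
    (fun θ => ∏ i, circleKernel (z i) (θ i)) torusPoint

lemma integrable_prod_circleKernel {z : Fin n → ℂ} (hz : z ∈ polydisc n) :
    Integrable (fun θ : Fin n → ℝ => ∏ i, circleKernel (z i) (θ i))
      (Measure.pi fun _ : Fin n => volume.restrict (Set.Icc 0 (2 * Real.pi))) :=
  Integrable.fintype_prod (f := fun i θ => circleKernel (z i) θ)
    fun i => integrable_circleKernel (hz i)

lemma cauchyTorus_eq {z : Fin n → ℂ} (hz : z ∈ polydisc n) (u : C(closedPolydisc n, ℂ)) :
    cauchyTorus (zeroExt u) z = torusFunctional z u := by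
  have hset : (Set.Icc (0 : Fin n → ℝ) fun _ => 2 * Real.pi) =
      Set.univ.pi fun _ => Set.Icc 0 (2 * Real.pi) := by
    rw [← Set.pi_univ_Icc]; rfl
  rw [torusFunctional, kernelFunctional_apply (integrable_prod_circleKernel hz), cauchyTorus,
    torusIntegral, hset, volume_pi, Measure.restrict_pi_pi, ← integral_const_mul]
  congr 1
  ext θ
  have h1 : torusMap (0 : Fin n → ℂ) (fun _ => 1) θ = (torusPoint θ).1 := by
    ext i; simp [torusMap, torusPoint]
  have h2 : ∀ i, (torusPoint θ).1 i = exp (θ i * I) := fun i => rfl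
  rw [h1, zeroExt_coe, smul_eq_mul]
  simp only [h2, circleKernel, Finset.prod_mul_distrib, Finset.prod_div_distrib, Finset.prod_const,
    Finset.card_univ, Fintype.card_fin, ofReal_one, one_mul, inv_pow]
  ring

lemma torusFunctional_prodFn {z : Fin n → ℂ} (hz : z ∈ polydisc n) (u : Fin n → C(ℂ, ℂ)) :
    torusFunctional z (prodFn u) = ∏ i, circleS (u i) (z i) := by
  rw [torusFunctional, kernelFunctional_apply (integrable_prod_circleKernel hz)]
  simp_rw [← integral_circleKernel_mul]
  rw [← integral_fintype_prod_eq_prod]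
  congr 1
  ext θ
  rw [prodFn_apply, ← Finset.prod_mul_distrib]
  rfl

/-! ### Product test functions -/

/-- Smooth functions of one variable with compact support. -/
def IsBump (f : C(ℂ, ℂ)) : Prop := ContDiff ℝ ∞ f ∧ HasCompactSupport f

lemma IsBump.contDiff_one {f : C(ℂ, ℂ)} (hf : IsBump f) : ContDiff ℝ 1 f := hf.1.of_le (by simp)

open Classical in
/-- The Wirtinger derivative as a continuous function. -/
def dbarC (f : C(ℂ, ℂ)) : C(ℂ, ℂ) := if h : Continuous (dbar f) then ⟨dbar f, h⟩ else 0

lemma IsBump.coe_dbarC {f : C(ℂ, ℂ)} (hf : IsBump f) : ⇑(dbarC f) = dbar f := by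
  rw [dbarC, dif_pos (continuous_dbar hf.contDiff_one)]; rfl

/-- The form `∂̄(∏ u_i(z_i))`. -/
def dbarProd (u : Fin n → C(ℂ, ℂ)) (j : Fin n) : C(closedPolydisc n, ℂ) :=
  prodFn (Function.update u j (dbarC (u j)))

lemma dbarProd_apply {u : Fin n → C(ℂ, ℂ)} (hu : ∀ i, IsBump (u i)) (j : Fin n)
    (z : closedPolydisc n) :
    dbarProd u j z = dbar (u j) (z.1 j) * ∏ i ∈ Finset.univ.erase j, u i (z.1 i) := by
  rw [dbarProd, prodFn_apply, prod_update_apply, (hu j).coe_dbarC]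

lemma nwTerm_dbarProd {u : Fin n → C(ℂ, ℂ)} (hu : ∀ i, IsBump (u i)) (z : closedPolydisc n)
    (hz : z.1 ∈ polydisc n) (j : Fin n) : nwTerm z j (dbarProd u j) =
      discT (dbar (u j)) (z.1 j) * (∏ i with i < j, circleS (u i) (z.1 i)) *
        ∏ i with j < i, u i (z.1 i) := by
  rw [dbarProd, nwTerm_prodFn z hz, prod_nwFactor, Function.update_self, (hu j).coe_dbarC]
  congr 1
  · congr 1
    refine Finset.prod_congr rfl fun i hi => ?_
    rw [Function.update_of_ne (Finset.mem_filter.1 hi).2.ne]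
  · refine Finset.prod_congr rfl fun i hi => ?_
    rw [Function.update_of_ne (Finset.mem_filter.1 hi).2.ne']

/-- With `S u_i = u_i - T ∂̄u_i`, the terms are the successive differences when the factors `u_i`
are replaced one after the other by `S u_i`. -/
lemma nwFunctional_dbarProd {u : Fin n → C(ℂ, ℂ)} (hu : ∀ i, IsBump (u i)) (z : closedPolydisc n)
    (hz : z.1 ∈ polydisc n) :
    nwFunctional z (dbarProd u) = prodFn u z - ∏ i, circleS (u i) (z.1 i) := by
  have h1 : ∀ i, circleS (u i) (z.1 i) = u i (z.1 i) - discT (dbar (u i)) (z.1 i) := fun i => by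
    rw [← circleS_add_discT (hu i).contDiff_one (hz i)]; ring
  rw [nwFunctional_apply]
  simp_rw [nwTerm_dbarProd hu z hz, h1]
  rw [Finset.prod_sub_ordered, prodFn_apply]
  ring

/-- The partial telescoping sum of the Nijenhuis–Woolf terms. -/
lemma sum_nwTerm_dbarProd_lt {u : Fin n → C(ℂ, ℂ)} (hu : ∀ i, IsBump (u i)) (z : closedPolydisc n)
    (hz : z.1 ∈ polydisc n) (k : Fin n) :
    ∑ i with i < k, nwTerm z i (dbarProd u i) =
      prodFn u z - (∏ i with i < k, circleS (u i) (z.1 i)) * ∏ i with k ≤ i, u i (z.1 i) := by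
  -- Setting the subtracted part to zero from index `k` on stops the telescoping identity at `k`.
  set g : Fin n → ℂ := fun i => if i < k then discT (dbar (u i)) (z.1 i) else 0 with hg
  have h1 : ∀ i < k, circleS (u i) (z.1 i) = u i (z.1 i) - g i := fun i hi => by
    rw [hg, ← circleS_add_discT (hu i).contDiff_one (hz i)]; simp [hi]
  have h2 : ∀ i, ¬ i < k → u i (z.1 i) - g i = u i (z.1 i) := fun i hi => by simp [hg, hi]
  have h3 : (∏ i with i < k, circleS (u i) (z.1 i)) * ∏ i with k ≤ i, u i (z.1 i) =
      ∏ i, (u i (z.1 i) - g i) := by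
    rw [← Finset.prod_filter_mul_prod_filter_not Finset.univ (fun i => i < k)]
    congr 1
    · exact Finset.prod_congr rfl fun i hi => h1 i (Finset.mem_filter.1 hi).2
    · simp only [not_lt]
      exact Finset.prod_congr rfl fun i hi => (h2 i (not_lt.2 (Finset.mem_filter.1 hi).2)).symm
  rw [h3, Finset.prod_sub_ordered, prodFn_apply, sub_sub_cancel, Finset.sum_filter]
  refine Finset.sum_congr rfl fun i _ => ?_
  split_ifs with hi
  · rw [nwTerm_dbarProd hu z hz]
    simp only [hg, if_pos hi]
    congr 2
    refine Finset.prod_congr rfl fun j hj => ?_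
    rw [h1 j ((Finset.mem_filter.1 hj).2.trans hi)]
  · simp [hg, hi]

/-! ### Derivatives of product functions -/

lemma hasFDerivAt_prod_apply {a : Fin n → ℂ → ℂ} {z : Fin n → ℂ}
    (ha : ∀ i, DifferentiableAt ℝ (a i) (z i)) :
    HasFDerivAt (fun z : Fin n → ℂ => ∏ i, a i (z i))
      (∑ i, (∏ j ∈ Finset.univ.erase i, a j (z j)) •
        (fderiv ℝ (a i) (z i)).comp (ContinuousLinearMap.proj (R := ℝ) (φ := fun _ : Fin n => ℂ) i)) z :=
  HasFDerivAt.finsetProd (u := Finset.univ) (g := fun i (z : Fin n → ℂ) => a i (z i))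
    (g' := fun i => (fderiv ℝ (a i) (z i)).comp
      (ContinuousLinearMap.proj (R := ℝ) (φ := fun _ : Fin n => ℂ) i))
    fun i _ => (ha i).hasFDerivAt.comp z
      (ContinuousLinearMap.proj (R := ℝ) (φ := fun _ : Fin n => ℂ) i).hasFDerivAt

lemma wirtingerBar_prod {a : Fin n → ℂ → ℂ} {z : Fin n → ℂ}
    (ha : ∀ i, DifferentiableAt ℝ (a i) (z i)) (j : Fin n) :
    wirtingerBar j (fun z : Fin n → ℂ => ∏ i, a i (z i)) z =
      dbar (a j) (z j) * ∏ i ∈ Finset.univ.erase j, a i (z i) := by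
  have h : ∀ v : ℂ, fderiv ℝ (fun z : Fin n → ℂ => ∏ i, a i (z i)) z (Pi.single j v) =
      (∏ i ∈ Finset.univ.erase j, a i (z i)) * fderiv ℝ (a j) (z j) v := fun v => by
    rw [(hasFDerivAt_prod_apply ha).fderiv, sum_apply,
      Finset.sum_eq_single j]
    · simp
    · intro i _ hij
      simp [Pi.single_eq_of_ne hij]
    · simp
  rw [wirtingerBar, h, h, dbar]
  ring

/-! ### Mollification by product kernels -/

/-- The radius of the mollifier. -/
def mollRadius (N : ℕ) : ℝ := 1 / (N + 3)

lemma mollRadius_pos (N : ℕ) : 0 < mollRadius N := by unfold mollRadius; positivity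

lemma mollRadius_lt (N : ℕ) : 2 * mollRadius N < 1 := by
  unfold mollRadius
  rw [mul_one_div, div_lt_one (by positivity)]
  have : (0 : ℝ) ≤ N := by positivity
  linarith

lemma tendsto_mollRadius : Filter.Tendsto mollRadius Filter.atTop (𝓝 0) := by
  have := (tendsto_one_div_add_atTop_nhds_zero_nat (𝕜 := ℝ)).comp (Filter.tendsto_add_atTop_nat 2)
  refine this.congr fun N => ?_
  simp only [Function.comp_apply, mollRadius]
  push_cast
  ring

/-- The dilation factor used along with the mollifier. -/
def shrink (N : ℕ) : ℝ := 1 - 2 * mollRadius N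

/-- A bump function whose support has radius `mollRadius N`. -/
def mollBump (N : ℕ) : ContDiffBump (0 : ℂ) where
  rIn := mollRadius N / 2
  rOut := mollRadius N
  rIn_pos := half_pos (mollRadius_pos N)
  rIn_lt_rOut := half_lt_self (mollRadius_pos N)

/-- The mollifier in one variable. -/
def mollifier (N : ℕ) : C(ℂ, ℂ) where
  toFun x := ((mollBump N).normed volume x : ℝ)
  continuous_toFun := continuous_ofReal.comp (mollBump N).continuous_normed

lemma mollifier_apply (N : ℕ) (x : ℂ) :
    mollifier N x = ((mollBump N).normed volume x : ℝ) := rfl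

lemma contDiff_mollifier (N : ℕ) : ContDiff ℝ ∞ (mollifier N) :=
  ofRealCLM.contDiff.comp (mollBump N).contDiff_normed

lemma mollifier_eq_zero {N : ℕ} {x : ℂ} (hx : mollRadius N ≤ ‖x‖) : mollifier N x = 0 := by
  rw [mollifier_apply, ofReal_eq_zero, ← Function.notMem_support, ContDiffBump.support_normed_eq]
  simpa [mollBump] using hx

lemma tsupport_mollifier_subset (N : ℕ) :
    tsupport (mollifier N) ⊆ Metric.closedBall 0 (mollRadius N) := by
  refine closure_minimal (fun x hx => ?_) Metric.isClosed_closedBall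
  rw [mem_closedBall_zero_iff]
  by_contra h
  exact hx (mollifier_eq_zero (not_le.1 h).le)

lemma dbar_mollifier_eq_zero {N : ℕ} {x : ℂ} (hx : mollRadius N < ‖x‖) :
    dbar (mollifier N) x = 0 :=
  dbar_eq_zero_of_notMem_tsupport fun h =>
    not_le.2 hx (mem_closedBall_zero_iff.1 (tsupport_mollifier_subset N h))

/-- The one-variable function `z ↦ ψ(r z - w)`. -/
def mollShift (N : ℕ) (w : ℂ) : C(ℂ, ℂ) :=
  (mollifier N).comp ⟨fun z => -w + shrink N * z, by fun_prop⟩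

lemma shrink_pos (N : ℕ) : 0 < shrink N := by
  unfold shrink; linarith [mollRadius_lt N]

lemma isBump_mollShift (N : ℕ) (w : ℂ) : IsBump (mollShift N w) := by
  refine ⟨(contDiff_mollifier N).comp (g := mollifier N) (f := fun z => -w + shrink N * z)
    (by fun_prop), ?_⟩
  refine HasCompactSupport.of_support_subset_isCompact
    (isCompact_closedBall 0 ((mollRadius N + ‖w‖) / shrink N)) fun z hz => ?_
  rw [mem_closedBall_zero_iff, le_div_iff₀ (shrink_pos N)]
  by_contra h
  refine hz (mollifier_eq_zero ?_)
  have h1 : ‖(shrink N : ℂ) * z‖ = ‖z‖ * shrink N := by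
    rw [norm_mul, norm_real, Real.norm_of_nonneg (shrink_pos N).le, mul_comm]
  have h2 := norm_sub_norm_le ((shrink N : ℂ) * z) w
  rw [sub_eq_neg_add ((shrink N : ℂ) * z)] at h2
  change mollRadius N ≤ ‖-w + shrink N * z‖
  linarith

lemma dbar_mollShift (N : ℕ) (w z : ℂ) :
    dbar (mollShift N w) z = shrink N * dbar (mollifier N) (-w + shrink N * z) :=
  dbar_comp_affine ((contDiff_mollifier N).differentiable (by simp)) (-w) (shrink N) z

/-- A function on the closed polydisc together with the coefficients of a `(0,1)`-form. -/
abbrev FormPair (n : ℕ) : Type := C(closedPolydisc n, ℂ) × (Fin n → C(closedPolydisc n, ℂ))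

/-- The product function and its `∂̄`. -/
def prodPair (u : Fin n → C(ℂ, ℂ)) : FormPair n := (prodFn u, dbarProd u)

/-- The mollifying kernel with parameter `w`, together with its `∂̄`. -/
def mollPair (N : ℕ) (w : Fin n → ℂ) : FormPair n := prodPair fun i => mollShift N (w i)

/-- The mollifying kernel at the point `z`, as a function of the integration variable. -/
def mollTest (N : ℕ) (z w : Fin n → ℂ) : ℂ := ∏ i, mollifier N (-w i + shrink N * z i)

lemma mollPair_fst_apply (N : ℕ) (w : Fin n → ℂ) (z : closedPolydisc n) :
    (mollPair N w).1 z = mollTest N z.1 w := rfl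

lemma mollPair_snd_apply (N : ℕ) (w : Fin n → ℂ) (j : Fin n) (z : closedPolydisc n) :
    (mollPair N w).2 j z = shrink N * dbar (mollifier N) (-w j + shrink N * z.1 j) *
      ∏ i ∈ Finset.univ.erase j, mollifier N (-w i + shrink N * z.1 i) := by
  rw [← dbar_mollShift]
  exact dbarProd_apply (fun i => isBump_mollShift N (w i)) j z

lemma wirtingerBar_mollTest (N : ℕ) (z w : Fin n → ℂ) (j : Fin n) :
    wirtingerBar j (mollTest N z) w = - (dbar (mollifier N) (-w j + shrink N * z j) *
      ∏ i ∈ Finset.univ.erase j, mollifier N (-w i + shrink N * z i)) := by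
  have hd : Differentiable ℝ (mollifier N) := (contDiff_mollifier N).differentiable (by simp)
  have h := wirtingerBar_prod (a := fun i x => mollifier N (-x + shrink N * z i)) (z := w)
    (fun i => (hd _).comp _ (by fun_prop)) j
  refine h.trans ?_
  have h2 := dbar_comp_affine hd (shrink N * z j) (-1) (w j)
  have h3 : (fun x => mollifier N (-x + shrink N * z j)) =
      fun x => mollifier N (shrink N * z j + ((-1 : ℝ) : ℂ) * x) := by
    ext x; congr 1; push_cast; ring
  rw [h3, h2]
  have h4 : (shrink N * z j + ((-1 : ℝ) : ℂ) * w j) = -w j + shrink N * z j := by push_cast; ring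
  rw [h4]
  push_cast
  ring

/-- The kernel depends only on `r z - w`, so differentiation in `z̄_j` is `-r` times differentiation
in `w̄_j`. This is how distributional equations, tested in `w`, become identities between the
mollified functions of `z`. -/
lemma mollPair_snd_eq (N : ℕ) (w : Fin n → ℂ) (j : Fin n) (z : closedPolydisc n) :
    (mollPair N w).2 j z = -(shrink N * wirtingerBar j (mollTest N z.1) w) := by
  rw [mollPair_snd_apply, wirtingerBar_mollTest]
  ring

/-- The closed polydisc in which the mollifying kernels are supported. -/
def innerPolydisc (n N : ℕ) : Set (Fin n → ℂ) := {w | ∀ i, ‖w i‖ ≤ 1 - mollRadius N}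

lemma isCompact_innerPolydisc (n N : ℕ) : IsCompact (innerPolydisc n N) := by
  have h : innerPolydisc n N = Set.univ.pi fun _ => Metric.closedBall (0 : ℂ) (1 - mollRadius N) := by
    ext z; simp [innerPolydisc]
  rw [h]
  exact isCompact_univ_pi fun _ => isCompact_closedBall _ _

lemma innerPolydisc_subset (n N : ℕ) : innerPolydisc n N ⊆ polydisc n := fun w hw i =>
  (hw i).trans_lt (by linarith [mollRadius_pos N])

/-- With `ε` the mollifying radius, the dilation factor is `1 - 2ε`. Since `|w_i| > 1 - ε` while `|r
z_i| ≤ 1 - 2ε`, the gap exceeds `ε`. The kernels thus have support inside a compact part of the open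
polydisc even for `z` on the boundary, and are admissible test functions. -/
lemma lt_norm_of_notMem_innerPolydisc {N : ℕ} {w z : Fin n → ℂ} (hw : w ∉ innerPolydisc n N)
    (hz : z ∈ closedPolydisc n) : ∃ i, mollRadius N < ‖-w i + shrink N * z i‖ := by
  simp only [innerPolydisc, Set.mem_ofPred_eq, not_forall, not_le] at hw
  obtain ⟨i, hi⟩ := hw
  refine ⟨i, ?_⟩
  have h1 : ‖(shrink N : ℂ) * z i‖ ≤ shrink N := by
    rw [norm_mul, norm_real, Real.norm_of_nonneg (shrink_pos N).le]
    exact mul_le_of_le_one_right (shrink_pos N).le (hz i)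
  have h2 := norm_sub_norm_le (w i) ((shrink N : ℂ) * z i)
  rw [norm_sub_rev, sub_eq_neg_add ((shrink N : ℂ) * z i)] at h2
  have : shrink N = 1 - 2 * mollRadius N := rfl
  linarith

lemma mollTest_eq_zero {N : ℕ} {w z : Fin n → ℂ} (hw : w ∉ innerPolydisc n N)
    (hz : z ∈ closedPolydisc n) : mollTest N z w = 0 := by
  obtain ⟨i, hi⟩ := lt_norm_of_notMem_innerPolydisc hw hz
  exact Finset.prod_eq_zero (Finset.mem_univ i) (mollifier_eq_zero hi.le)

lemma wirtingerBar_mollTest_eq_zero {N : ℕ} {w z : Fin n → ℂ} (hw : w ∉ innerPolydisc n N)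
    (hz : z ∈ closedPolydisc n) (j : Fin n) : wirtingerBar j (mollTest N z) w = 0 := by
  obtain ⟨i, hi⟩ := lt_norm_of_notMem_innerPolydisc hw hz
  rw [wirtingerBar_mollTest]
  rcases eq_or_ne i j with rfl | h
  · rw [dbar_mollifier_eq_zero hi]; ring
  · rw [Finset.prod_eq_zero (Finset.mem_erase.2 ⟨h, Finset.mem_univ i⟩) (mollifier_eq_zero hi.le)]
    ring

lemma contDiff_mollTest (N : ℕ) (z : Fin n → ℂ) : ContDiff ℝ ∞ (mollTest N z) :=
  contDiff_prod fun i _ => (contDiff_mollifier N).comp (by fun_prop)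

lemma isTest_mollTest (N : ℕ) {z : Fin n → ℂ} (hz : z ∈ closedPolydisc n) :
    IsTest (mollTest N z) := by
  have hsub : Function.support (mollTest N z) ⊆ innerPolydisc n N := fun w hw => by
    by_contra h
    exact hw (mollTest_eq_zero h hz)
  exact ⟨contDiff_mollTest N z,
    HasCompactSupport.of_support_subset_isCompact (isCompact_innerPolydisc n N) hsub,
    (closure_minimal hsub (isCompact_innerPolydisc n N).isClosed).trans (innerPolydisc_subset n N)⟩

/-- Continuity into the sup norm of `FormPair` makes the mollification a Bochner integral in that
Banach space, which commutes with continuous linear maps. -/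
lemma continuous_mollPair (N : ℕ) : Continuous (mollPair N : (Fin n → ℂ) → FormPair n) := by
  have hm : Continuous (mollifier N) := (mollifier N).continuous
  have hd : Continuous (dbar (mollifier N)) := continuous_dbar ((contDiff_mollifier N).of_le (by simp))
  have hc : ∀ i, Continuous fun p : (Fin n → ℂ) × closedPolydisc n =>
      -p.1 i + shrink N * p.2.1 i := fun i =>
    ((continuous_apply i).comp continuous_fst).neg.add (continuous_const.mul
      ((continuous_apply i).comp (continuous_subtype_val.comp continuous_snd)))
  refine Continuous.prodMk ?_ (continuous_pi fun j => ?_)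
  · refine ContinuousMap.continuous_of_continuous_uncurry
      (fun w : Fin n → ℂ => (mollPair N w).1) ?_
    exact continuous_finsetProd Finset.univ fun i _ => hm.comp (hc i)
  · refine ContinuousMap.continuous_of_continuous_uncurry
      (fun w : Fin n → ℂ => (mollPair N w).2 j) ?_
    have : (Function.uncurry fun (w : Fin n → ℂ) (z : closedPolydisc n) => (mollPair N w).2 j z) =
        fun p => shrink N * dbar (mollifier N) (-p.1 j + shrink N * p.2.1 j) *
          ∏ i ∈ Finset.univ.erase j, mollifier N (-p.1 i + shrink N * p.2.1 i) := by
      ext p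
      exact mollPair_snd_apply N p.1 j p.2
    rw [this]
    exact (continuous_const.mul (hd.comp (hc j))).mul
      (continuous_finsetProd _ fun i _ => hm.comp (hc i))

/-- The mollification of `v`, and its `∂̄`. -/
def mollify (N : ℕ) (v : (Fin n → ℂ) → ℂ) : FormPair n :=
  ∫ w in innerPolydisc n N, v w • mollPair N w

lemma integrableOn_smul_mollPair (N : ℕ) {v : (Fin n → ℂ) → ℂ} (hv : ContinuousOn v (polydisc n)) :
    IntegrableOn (fun w => v w • mollPair N w) (innerPolydisc n N) :=
  ((hv.mono (innerPolydisc_subset n N)).smul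
    (continuous_mollPair N).continuousOn).integrableOn_compact (isCompact_innerPolydisc n N)

lemma measurableSet_polydisc (n : ℕ) : MeasurableSet (polydisc n) := by
  have : polydisc n = Set.univ.pi fun _ => Metric.ball (0 : ℂ) 1 := by
    ext z; simp [polydisc]
  rw [this]
  exact MeasurableSet.univ_pi fun _ => measurableSet_ball

lemma mollify_fst_apply (N : ℕ) {v : (Fin n → ℂ) → ℂ} (hv : ContinuousOn v (polydisc n))
    (z : closedPolydisc n) :
    (mollify N v).1 z = ∫ w in polydisc n, v w * mollTest N z.1 w := by
  have h := ((ContinuousMap.evalCLM ℂ z).comp (ContinuousLinearMap.fst ℂ _ _)).integral_comp_comm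
    (integrableOn_smul_mollPair N hv)
  refine h.symm.trans ?_
  refine (setIntegral_eq_of_subset_of_forall_sdiff_eq_zero (measurableSet_polydisc n)
    (innerPolydisc_subset n N) fun w hw => ?_).symm
  simp [mollPair_fst_apply, mollTest_eq_zero hw.2 z.2]

lemma mollify_snd_apply (N : ℕ) {v : (Fin n → ℂ) → ℂ} (hv : ContinuousOn v (polydisc n))
    (j : Fin n) (z : closedPolydisc n) :
    (mollify N v).2 j z = -(shrink N * ∫ w in polydisc n, v w * wirtingerBar j (mollTest N z.1) w) := by
  have h := ((ContinuousMap.evalCLM ℂ z).comp ((ContinuousLinearMap.proj j).comp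
    (ContinuousLinearMap.snd ℂ _ _))).integral_comp_comm (integrableOn_smul_mollPair N hv)
  refine h.symm.trans ?_
  rw [← integral_const_mul, ← integral_neg]
  refine (setIntegral_congr_fun (isCompact_innerPolydisc n N).measurableSet
    (g := fun w => -((shrink N : ℂ) * (v w * wirtingerBar j (mollTest N z.1) w)))
    fun w _ => ?_).trans ?_
  · simp [mollPair_snd_eq]
    ring
  · refine (setIntegral_eq_of_subset_of_forall_sdiff_eq_zero (measurableSet_polydisc n)
      (innerPolydisc_subset n N) fun w hw => ?_).symm
    simp [wirtingerBar_mollTest_eq_zero hw.2 z.2]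

/-- A closed subspace that contains all pairs `(p, ∂̄p)` with a product function `p` contains all
mollifications. -/
lemma mollify_mem {S : Submodule ℂ (FormPair n)} (hS : IsClosed (S : Set (FormPair n)))
    (h : ∀ u : Fin n → C(ℂ, ℂ), (∀ i, IsBump (u i)) → prodPair u ∈ S) (N : ℕ)
    {v : (Fin n → ℂ) → ℂ} (hv : ContinuousOn v (polydisc n)) : mollify N v ∈ S := by
  have := hS
  -- In the Banach quotient by the closed subspace the integrand vanishes pointwise, and the
  -- quotient map commutes with the integral.
  rw [← Submodule.Quotient.mk_eq_zero, ← Submodule.mkQ_apply, ← Submodule.mkQL_apply, mollify,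
    ← S.mkQL.integral_comp_comm (integrableOn_smul_mollPair N hv)]
  refine integral_eq_zero_of_ae (.of_forall fun w => ?_)
  change S.mkQL (v w • mollPair N w) = 0
  rw [Submodule.mkQL_apply, Submodule.mkQ_apply, Submodule.Quotient.mk_eq_zero]
  exact S.smul_mem _ (h _ fun i => isBump_mollShift N (w i))

/-! ### Uniform convergence of the mollifications -/

lemma integral_mollTest (N : ℕ) (z : closedPolydisc n) :
    ∫ w in polydisc n, mollTest N z.1 w = 1 ∧ ∫ w in polydisc n, ‖mollTest N z.1 w‖ = 1 := by
  have h1 : ∀ a : ℂ, ∫ x, (mollBump N).normed volume (-x + a) = 1 := fun a => by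
    have := integral_sub_left_eq_self ((mollBump N).normed volume) volume a
    simp_rw [sub_eq_neg_add] at this
    rw [this, ContDiffBump.integral_normed]
  have h2 : ∫ w : Fin n → ℂ, ∏ i, (mollBump N).normed volume (-w i + shrink N * z.1 i) = 1 := by
    rw [integral_fintype_prod_volume_eq_prod
      (fun i x => (mollBump N).normed volume (-x + shrink N * z.1 i))]
    simp [h1]
  have h3 : ∀ w, mollTest N z.1 w =
      ((∏ i, (mollBump N).normed volume (-w i + shrink N * z.1 i) : ℝ) : ℂ) := fun w => by
    rw [mollTest, ofReal_prod]; rfl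
  have h4 : ∀ w ∉ polydisc n, mollTest N z.1 w = 0 := fun w hw =>
    mollTest_eq_zero (fun h => hw (innerPolydisc_subset n N h)) z.2
  constructor
  · rw [setIntegral_eq_integral_of_forall_compl_eq_zero h4]
    simp_rw [h3]
    rw [integral_complex_ofReal, h2, ofReal_one]
  · rw [setIntegral_eq_integral_of_forall_compl_eq_zero fun w hw => by rw [h4 w hw, norm_zero]]
    rw [← h2]
    congr 1
    ext w
    rw [h3, norm_real, Real.norm_of_nonneg]
    exact Finset.prod_nonneg fun i _ => (mollBump N).nonneg_normed _

lemma integrableOn_mul_mollTest (N : ℕ) (u : C(closedPolydisc n, ℂ)) (z : Fin n → ℂ) :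
    IntegrableOn (fun w => zeroExt u w * mollTest N z w) (polydisc n) :=
  (((continuousOn_zeroExt u).mul (contDiff_mollTest N z).continuous.continuousOn).integrableOn_compact
    (isCompact_closedPolydisc n)).mono_set (polydisc_subset n)

lemma continuousOn_zeroExt_polydisc (u : C(closedPolydisc n, ℂ)) :
    ContinuousOn (zeroExt u) (polydisc n) := (continuousOn_zeroExt u).mono (polydisc_subset n)

lemma tendsto_mollify (u : C(closedPolydisc n, ℂ)) :
    Filter.Tendsto (fun N => (mollify N (zeroExt u)).1) Filter.atTop (𝓝 u) := by
  rw [Metric.tendsto_nhds]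
  intro δ hδ
  have huc := CompactSpace.uniformContinuous_of_continuous u.continuous
  obtain ⟨η, hη, hu⟩ := Metric.uniformContinuous_iff.1 huc (δ / 2) (half_pos hδ)
  -- A point `w` in the support of the kernel at `z` differs from `z` by less than one radius from
  -- the mollifier plus two from the dilation in each coordinate.
  have h3 : ∀ᶠ N in Filter.atTop, 3 * mollRadius N < η := by
    have := tendsto_mollRadius.const_mul 3
    rw [mul_zero] at this
    exact this.eventually_lt_const hη
  filter_upwards [h3] with N hN
  rw [dist_eq_norm]
  refine lt_of_le_of_lt ?_ (half_lt_self hδ)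
  rw [ContinuousMap.norm_le _ (half_pos hδ).le]
  intro z
  obtain ⟨hi1, hi2⟩ := integral_mollTest N z
  have hcont := (contDiff_mollTest N z.1).continuous
  have hint : IntegrableOn (mollTest N z.1) (polydisc n) :=
    (hcont.continuousOn.integrableOn_compact (isCompact_closedPolydisc n)).mono_set
      (polydisc_subset n)
  have heq : (mollify N (zeroExt u)).1 z - u z =
      ∫ w in polydisc n, (zeroExt u w - u z) * mollTest N z.1 w := by
    simp_rw [sub_mul]
    rw [integral_sub (integrableOn_mul_mollTest N u z.1) (hint.const_mul _), integral_const_mul,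
      hi1, mul_one, mollify_fst_apply N (continuousOn_zeroExt_polydisc u)]
  rw [ContinuousMap.sub_apply, heq]
  calc _ ≤ ∫ w in polydisc n, δ / 2 * ‖mollTest N z.1 w‖ := by
        refine norm_integral_le_of_norm_le (hint.norm.const_mul _) ?_
        filter_upwards [ae_restrict_mem (measurableSet_polydisc n)] with w hw
        rw [norm_mul]
        by_cases h0 : mollTest N z.1 w = 0
        · simp [h0]
        gcongr
        rw [zeroExt_of_mem u (polydisc_subset n hw), ← dist_eq_norm]
        refine (hu (lt_of_le_of_lt ?_ hN)).le
        rw [Subtype.dist_eq, dist_pi_le_iff (by linarith [mollRadius_pos N])]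
        intro i
        have h5 : ‖-w i + shrink N * z.1 i‖ < mollRadius N := by
          by_contra h
          exact h0 (Finset.prod_eq_zero (Finset.mem_univ i) (mollifier_eq_zero (not_lt.1 h)))
        have h6 : w i - z.1 i = -(-w i + shrink N * z.1 i) - (2 * mollRadius N : ℝ) * z.1 i := by
          simp only [shrink]; push_cast; ring
        have h7 : ‖((2 * mollRadius N : ℝ) : ℂ) * z.1 i‖ ≤ 2 * mollRadius N := by
          have := mollRadius_pos N
          rw [norm_mul, norm_real, Real.norm_of_nonneg (by positivity)]
          exact mul_le_of_le_one_right (by positivity) (z.2 i)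
        rw [dist_eq_norm, h6]
        refine (norm_sub_le _ _).trans ?_
        rw [norm_neg]
        linarith
    _ = δ / 2 := by rw [integral_const_mul, hi2, mul_one]

/-! ### Pairings with test functions -/

lemma polydisc_eq_ball (n : ℕ) : polydisc n = Metric.ball 0 1 := by
  ext z
  rw [mem_ball_zero_iff, pi_norm_lt_iff zero_lt_one]
  rfl

lemma isOpen_polydisc (n : ℕ) : IsOpen (polydisc n) := polydisc_eq_ball n ▸ Metric.isOpen_ball

lemma exists_radius_of_isCompact {K : Set (Fin n → ℂ)} (hK : IsCompact K) (hKD : K ⊆ polydisc n) :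
    ∃ R : ℝ, 0 ≤ R ∧ R < 1 ∧ ∀ z ∈ K, ∀ i, ‖z i‖ ≤ R := by
  rcases K.eq_empty_or_nonempty with rfl | hne
  · exact ⟨0, le_rfl, one_pos, by simp⟩
  obtain ⟨z₀, hz₀, hmax⟩ := hK.exists_isMaxOn hne continuous_norm.continuousOn
  refine ⟨‖z₀‖, norm_nonneg _, ?_, fun z hz i => (norm_le_pi_norm z i).trans (hmax hz)⟩
  have := hKD hz₀
  rwa [polydisc_eq_ball, mem_ball_zero_iff] at this

lemma continuous_mul_of_tsupport_subset {v φ : (Fin n → ℂ) → ℂ} (hv : ContinuousOn v (polydisc n))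
    (hφ : Continuous φ) (hs : tsupport φ ⊆ polydisc n) : Continuous fun z => v z * φ z := by
  rw [continuous_iff_continuousAt]
  intro z
  by_cases hz : z ∈ tsupport φ
  · exact (hv.continuousAt ((isOpen_polydisc n).mem_nhds (hs hz))).mul hφ.continuousAt
  · have h0 : φ =ᶠ[𝓝 z] 0 := notMem_tsupport_iff_eventuallyEq.1 hz
    refine (continuousAt_const (y := (0 : ℂ))).congr ?_
    filter_upwards [h0] with w hw
    simp [hw]

lemma integrable_mul_of_tsupport_subset {v φ : (Fin n → ℂ) → ℂ} (hv : ContinuousOn v (polydisc n))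
    (hφ : Continuous φ) (hc : HasCompactSupport φ) (hs : tsupport φ ⊆ polydisc n) :
    Integrable fun z => v z * φ z :=
  (continuous_mul_of_tsupport_subset hv hφ hs).integrable_of_hasCompactSupport hc.mul_left

open Classical in
/-- The value at `z` of a family of functionals, extended by zero. -/
def familyExt (Λ : closedPolydisc n → C(closedPolydisc n, ℂ) →L[ℂ] ℂ) (f : C(closedPolydisc n, ℂ))
    (z : Fin n → ℂ) : ℂ := if h : z ∈ closedPolydisc n then Λ ⟨z, h⟩ f else 0

lemma familyExt_of_mem (Λ : closedPolydisc n → C(closedPolydisc n, ℂ) →L[ℂ] ℂ)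
    (f : C(closedPolydisc n, ℂ)) {z : Fin n → ℂ} (hz : z ∈ polydisc n) :
    familyExt Λ f z = Λ ⟨z, polydisc_subset n hz⟩ f := dif_pos _

/-- Families of functionals that are bounded on compact subsets of the open polydisc, and that
depend continuously on the point there. -/
structure IsRegularFamily (Λ : closedPolydisc n → C(closedPolydisc n, ℂ) →L[ℂ] ℂ) : Prop where
  bound : ∀ R : ℝ, 0 ≤ R → R < 1 → ∃ C, 0 ≤ C ∧ ∀ z : closedPolydisc n, (∀ i, ‖z.1 i‖ ≤ R) → ‖Λ z‖ ≤ C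
  continuousOn : ∀ f, ContinuousOn (familyExt Λ f) (polydisc n)

open Classical in
/-- The pairing of a family of functionals with a test function. -/
def pairing (Λ : closedPolydisc n → C(closedPolydisc n, ℂ) →L[ℂ] ℂ) (φ : (Fin n → ℂ) → ℂ) :
    C(closedPolydisc n, ℂ) →L[ℂ] ℂ :=
  if h : IsRegularFamily Λ ∧ Continuous φ ∧ HasCompactSupport φ ∧ tsupport φ ⊆ polydisc n then
    LinearMap.mkContinuousOfExistsBound
      { toFun := fun f => ∫ z in polydisc n, familyExt Λ f z * φ z
        map_add' := fun f g => by
          rw [← integral_add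
            (integrable_mul_of_tsupport_subset (h.1.continuousOn f) h.2.1 h.2.2.1 h.2.2.2).integrableOn
            (integrable_mul_of_tsupport_subset (h.1.continuousOn g) h.2.1 h.2.2.1 h.2.2.2).integrableOn]
          refine setIntegral_congr_fun (measurableSet_polydisc n) fun z hz => ?_
          simp only [familyExt_of_mem Λ _ hz, map_add, add_mul]
        map_smul' := fun a f => by
          rw [RingHom.id_apply, smul_eq_mul, ← integral_const_mul]
          refine setIntegral_congr_fun (measurableSet_polydisc n) fun z hz => ?_
          simp only [familyExt_of_mem Λ _ hz, map_smul, smul_eq_mul, mul_assoc] } (by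
      obtain ⟨R, hR0, hR1, hR⟩ := exists_radius_of_isCompact h.2.2.1.isCompact h.2.2.2
      obtain ⟨C, hC0, hC⟩ := h.1.bound R hR0 hR1
      refine ⟨C * ∫ z in polydisc n, ‖φ z‖, fun f => ?_⟩
      rw [mul_right_comm, ← integral_const_mul]
      refine norm_integral_le_of_norm_le
        ((h.2.1.integrable_of_hasCompactSupport h.2.2.1).norm.integrableOn.const_mul _) ?_
      filter_upwards [ae_restrict_mem (measurableSet_polydisc n)] with z hz
      rw [norm_mul, familyExt_of_mem Λ _ hz]
      by_cases h0 : φ z = 0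
      · simp [h0]
      gcongr
      refine ((Λ ⟨z, polydisc_subset n hz⟩).le_opNorm f).trans ?_
      gcongr
      exact hC _ (hR z (subset_tsupport φ h0)))
  else 0

lemma pairing_apply {Λ : closedPolydisc n → C(closedPolydisc n, ℂ) →L[ℂ] ℂ}
    (hΛ : IsRegularFamily Λ) {φ : (Fin n → ℂ) → ℂ} (hφ : Continuous φ) (hc : HasCompactSupport φ)
    (hs : tsupport φ ⊆ polydisc n) (f : C(closedPolydisc n, ℂ)) :
    pairing Λ φ f = ∫ z in polydisc n, familyExt Λ f z * φ z := by
  rw [pairing, dif_pos ⟨hΛ, hφ, hc, hs⟩]; rfl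

lemma familyExt_eval (f : C(closedPolydisc n, ℂ)) :
    familyExt (fun z => ContinuousMap.evalCLM ℂ z) f = zeroExt f := rfl

lemma isRegularFamily_eval :
    IsRegularFamily (n := n) (fun z => ContinuousMap.evalCLM ℂ z) where
  bound R _ _ := ⟨1, zero_le_one, fun z _ => ContinuousLinearMap.opNorm_le_bound _ zero_le_one
    fun f => by rw [one_mul]; exact f.norm_coe_le_norm z⟩
  continuousOn f := by
    rw [familyExt_eval]; exact continuousOn_zeroExt_polydisc f

/-- A closed subspace of functions that contains all product functions is everything. -/
lemma mem_of_forall_prodFn_mem {S : Submodule ℂ (C(closedPolydisc n, ℂ))}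
    (hS : IsClosed (S : Set (C(closedPolydisc n, ℂ))))
    (h : ∀ u : Fin n → C(ℂ, ℂ), (∀ i, IsBump (u i)) → prodFn u ∈ S) (f : C(closedPolydisc n, ℂ)) :
    f ∈ S := by
  refine hS.mem_of_tendsto (tendsto_mollify f) (.of_forall fun N => ?_)
  have := mollify_mem (S := S.comap (LinearMap.fst ℂ _ _)) (hS.preimage continuous_fst)
    (fun u hu => h u hu) N (continuousOn_zeroExt_polydisc f)
  exact this

lemma contDiffOn_nwFactor {u : Fin n → C(ℂ, ℂ)} (hu : ∀ i, IsBump (u i)) (j i : Fin n) :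
    ContDiffOn ℝ 1 (nwFactor u j i) (Metric.ball 0 1) := by
  unfold nwFactor
  split_ifs
  · exact ((differentiableOn_circleS (u i).continuous).contDiffOn
      Metric.isOpen_ball).restrict_scalars ℝ
  · exact (contDiffOn_discT (hu i).1 (hu i).2).1
  · exact (hu i).contDiff_one.contDiffOn

lemma contDiffOn_prod_apply {a : Fin n → ℂ → ℂ} (ha : ∀ i, ContDiffOn ℝ 1 (a i) (Metric.ball 0 1)) :
    ContDiffOn ℝ 1 (fun z : Fin n → ℂ => ∏ i, a i (z i)) (polydisc n) :=
  _root_.contDiffOn_prod fun i _ => (ha i).comp (contDiff_apply ℝ ℂ i).contDiffOn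
    fun _ hz => mem_ball_zero_iff.2 (hz i)

lemma familyExt_nwTerm_prodFn (u : Fin n → C(ℂ, ℂ)) (j : Fin n) {z : Fin n → ℂ}
    (hz : z ∈ polydisc n) :
    familyExt (fun z => nwTerm z j) (prodFn u) z = ∏ i, nwFactor u j i (z i) := by
  rw [familyExt_of_mem _ _ hz]
  exact nwTerm_prodFn ⟨z, polydisc_subset n hz⟩ hz u j

/-- On `{|z_i| ≤ R}` the functionals are uniformly bounded, so the functions with continuous image
there form a closed subspace. It contains the product functions, whose images are explicit, and
these span a dense subspace. -/
lemma isRegularFamily_nwTerm (j : Fin n) : IsRegularFamily fun z => nwTerm z j where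
  bound R hR0 hR1 := exists_norm_nwTerm_le hR0 hR1 j
  continuousOn f := by
    suffices h : ∀ R : ℝ, 0 ≤ R → R < 1 →
        ContinuousOn (familyExt (fun z => nwTerm z j) f) {z | ∀ i, ‖z i‖ ≤ R} by
      intro z hz
      obtain ⟨R, hR0, hR1, hR⟩ := exists_radius_of_isCompact isCompact_singleton
        (Set.singleton_subset_iff.2 hz)
      have hz' := hR z rfl
      refine ((h ((R + 1) / 2) (by linarith) (by linarith)).continuousAt
        (Filter.mem_of_superset (Metric.isOpen_ball.mem_nhds (show z ∈ Metric.ball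
          (0 : Fin n → ℂ) ((R + 1) / 2) from ?_)) fun w hw i => ?_)).continuousWithinAt
      · rw [mem_ball_zero_iff, pi_norm_lt_iff (by linarith)]
        intro i
        linarith [hz' i]
      · exact (norm_le_pi_norm w i).trans (mem_ball_zero_iff.1 hw).le
    intro R hR0 hR1
    obtain ⟨C, hC0, hC⟩ := exists_norm_nwTerm_le (n := n) hR0 hR1 j
    have hsub : {z : Fin n → ℂ | ∀ i, ‖z i‖ ≤ R} ⊆ polydisc n := fun z hz i => (hz i).trans_lt hR1
    let S : Submodule ℂ (C(closedPolydisc n, ℂ)) :=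
      { carrier := {f | ContinuousOn (familyExt (fun z => nwTerm z j) f) {z | ∀ i, ‖z i‖ ≤ R}}
        zero_mem' := (continuousOn_const (c := 0)).congr fun z hz => by
          rw [familyExt_of_mem _ _ (hsub hz), map_zero]
        add_mem' := fun {f g} hf hg => (hf.add hg).congr fun z hz => by
          simp only [Pi.add_apply, familyExt_of_mem _ _ (hsub hz), map_add]
        smul_mem' := fun a f hf => (hf.const_smul a).congr fun z hz => by
          simp only [Pi.smul_apply, familyExt_of_mem _ _ (hsub hz), map_smul] }
    have hS : IsClosed (S : Set (C(closedPolydisc n, ℂ))) := by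
      refine isClosed_of_closure_subset fun f hf => ?_
      refine continuousOn_of_uniform_approx_of_continuousOn fun U hU => ?_
      obtain ⟨ε, hε, hεU⟩ := Metric.mem_uniformity_dist.1 hU
      obtain ⟨f', hf', hd⟩ := Metric.mem_closure_iff.1 hf (ε / (C + 1)) (by positivity)
      refine ⟨familyExt (fun z => nwTerm z j) f', hf', fun z hz => hεU ?_⟩
      rw [dist_eq_norm, familyExt_of_mem _ _ (hsub hz), familyExt_of_mem _ _ (hsub hz), ← map_sub]
      refine (ContinuousLinearMap.le_opNorm _ _).trans_lt ?_
      rw [dist_eq_norm, lt_div_iff₀ (by positivity)] at hd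
      refine lt_of_le_of_lt ?_ hd
      have := hC ⟨z, polydisc_subset n (hsub hz)⟩ hz
      nlinarith [norm_nonneg (f - f')]
    refine mem_of_forall_prodFn_mem hS (fun u hu => ?_) f
    refine ((contDiffOn_prod_apply (contDiffOn_nwFactor hu j)).continuousOn.mono hsub).congr
      fun z hz => familyExt_nwTerm_prodFn u j (hsub hz)

/-! ### Integration by parts -/

lemma IsTest.continuous_wirtingerBar {φ : (Fin n → ℂ) → ℂ} (hφ : IsTest φ) (k : Fin n) :
    Continuous (wirtingerBar k φ) := by
  have hd : Continuous (fderiv ℝ φ) := hφ.1.continuous_fderiv (by simp)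
  unfold wirtingerBar
  fun_prop

lemma tsupport_wirtingerBar_subset (φ : (Fin n → ℂ) → ℂ) (k : Fin n) :
    tsupport (wirtingerBar k φ) ⊆ tsupport φ := by
  refine closure_minimal (fun z hz => ?_) (isClosed_tsupport φ)
  by_contra h
  exact hz (by simp [wirtingerBar, fderiv_of_notMem_tsupport ℝ h])

lemma integral_mul_wirtingerBar {V φ : (Fin n → ℂ) → ℂ} (hV : ContDiffOn ℝ 1 V (polydisc n))
    (hφ : IsTest φ) (k : Fin n) :
    ∫ z in polydisc n, V z * wirtingerBar k φ z = - ∫ z in polydisc n, wirtingerBar k V z * φ z := by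
  have hd : Continuous (fderiv ℝ φ) := hφ.1.continuous_fderiv (by simp)
  have hVd : ContinuousOn (fderiv ℝ V) (polydisc n) :=
    hV.continuousOn_fderiv_of_isOpen (isOpen_polydisc n) le_rfl
  have hz0 : ∀ z ∉ polydisc n, z ∉ tsupport φ := fun z hz h => hz (hφ.2.2 h)
  have hi1 : ∀ e, Integrable fun z => fderiv ℝ V z e * φ z := fun e =>
    integrable_mul_of_tsupport_subset (hVd.clm_apply continuousOn_const) hφ.1.continuous hφ.2.1 hφ.2.2
  have hi2 : ∀ e, Integrable fun z => V z * fderiv ℝ φ z e := fun e =>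
    integrable_mul_of_tsupport_subset hV.continuousOn (hd.clm_apply continuous_const)
      (hφ.2.1.fderiv_apply ℝ e) ((tsupport_fderiv_apply_subset ℝ e).trans hφ.2.2)
  have key : ∀ e, ∫ z, V z * fderiv ℝ φ z e = - ∫ z, fderiv ℝ V z e * φ z := fun e =>
    integral_mul_fderiv_eq_neg_fderiv_mul_of_integrable (hi1 e) (hi2 e)
      (integrable_mul_of_tsupport_subset hV.continuousOn hφ.1.continuous hφ.2.1 hφ.2.2)
      (fun z hz => (hV.differentiableOn (by simp)).differentiableAt
        ((isOpen_polydisc n).mem_nhds (hφ.2.2 hz)))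
      (fun z _ => (hφ.1.differentiable (by simp)) z)
  rw [setIntegral_eq_integral_of_forall_compl_eq_zero, setIntegral_eq_integral_of_forall_compl_eq_zero]
  · have e1 : ∀ z, V z * wirtingerBar k φ z = (1 / 2) * (V z * fderiv ℝ φ z (Pi.single k 1) +
        I * (V z * fderiv ℝ φ z (Pi.single k I))) := fun z => by rw [wirtingerBar]; ring
    have e2 : ∀ z, wirtingerBar k V z * φ z = (1 / 2) * (fderiv ℝ V z (Pi.single k 1) * φ z +
        I * (fderiv ℝ V z (Pi.single k I) * φ z)) := fun z => by rw [wirtingerBar]; ring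
    simp_rw [e1, e2]
    rw [integral_const_mul, integral_const_mul, integral_add (hi2 _) ((hi2 _).const_mul _),
      integral_add (hi1 _) ((hi1 _).const_mul _), integral_const_mul, integral_const_mul, key, key]
    ring
  · intro z hz
    rw [image_eq_zero_of_notMem_tsupport (hz0 z hz), mul_zero]
  · intro z hz
    rw [image_eq_zero_of_notMem_tsupport fun h => hz0 z hz (tsupport_wirtingerBar_subset φ k h),
      mul_zero]

/-! ### The Nijenhuis–Woolf operator solves the equation -/

lemma apply_mollify_eq {l₁ l₂ : FormPair n →L[ℂ] ℂ}
    (h : ∀ u : Fin n → C(ℂ, ℂ), (∀ i, IsBump (u i)) → l₁ (prodPair u) = l₂ (prodPair u)) (N : ℕ)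
    {v : (Fin n → ℂ) → ℂ} (hv : ContinuousOn v (polydisc n)) :
    l₁ (mollify N v) = l₂ (mollify N v) :=
  mollify_mem (S := LinearMap.eqLocus l₁.toLinearMap l₂.toLinearMap)
    (isClosed_eq l₁.continuous l₂.continuous) h N hv

/-- Three cases for `∂̄_k T_j S_{j-1} ⋯ S_1 p`. If `j < k`, the factor `u_k` is still intact and
receives the derivative. If `j = k`, then `∂̄T` is the identity, which leaves `S_{k-1} ⋯ S_1 p`,
rewritten by the partial telescoping sum. If `k < j`, the `k`-th factor is a Cauchy integral, hence
holomorphic. -/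
lemma wirtingerBar_prod_nwFactor {u : Fin n → C(ℂ, ℂ)} (hu : ∀ i, IsBump (u i))
    (z : closedPolydisc n) (hz : z.1 ∈ polydisc n) (j k : Fin n) :
    wirtingerBar k (fun z : Fin n → ℂ => ∏ i, nwFactor u j i (z i)) z.1 =
      if j < k then nwTerm z j (dbarProd u k) else
        if j = k then prodFn u z - ∑ i with i < k, nwTerm z i (dbarProd u i) else 0 := by
  have hb : ∀ i, z.1 i ∈ Metric.ball (0 : ℂ) 1 := fun i => mem_ball_zero_iff.2 (hz i)
  rw [wirtingerBar_prod fun i => ((contDiffOn_nwFactor hu j i).differentiableOn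
    (by simp)).differentiableAt (Metric.isOpen_ball.mem_nhds (hb i))]
  split_ifs with h1 h2
  · rw [dbarProd, nwTerm_prodFn z hz, ← Finset.mul_prod_erase _ _ (Finset.mem_univ k)]
    have h3 : ∀ v : Fin n → C(ℂ, ℂ), nwFactor v j k = v k := fun v => by
      rw [nwFactor, if_neg h1.not_gt, if_neg h1.ne']
    rw [h3, h3, Function.update_self, (hu k).coe_dbarC]
    congr 1
    refine Finset.prod_congr rfl fun i hi => ?_
    rw [nwFactor, nwFactor, Function.update_of_ne (Finset.ne_of_mem_erase hi)]
  · subst h2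
    have h3 : nwFactor u j j = discT (u j) := by rw [nwFactor, if_neg (lt_irrefl _), if_pos rfl]
    have h5 : ∏ i with j ≤ i, u i (z.1 i) = u j (z.1 j) * ∏ i with j < i, u i (z.1 i) := by
      rw [← Finset.prod_insert (f := fun i => u i (z.1 i)) (a := j) (by simp)]
      congr 1
      ext i
      simp [le_iff_eq_or_lt, eq_comm]
    rw [h3, (contDiffOn_discT (hu j).1 (hu j).2).2 _ (hb j), sum_nwTerm_dbarProd_lt hu z hz, h5,
      sub_sub_cancel, mul_left_comm]
    congr 1
    rw [← Finset.prod_filter_mul_prod_filter_not _ (fun i => i < j)]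
    congr 1
    · refine Finset.prod_congr ?_ fun i hi => ?_
      · ext i; simp only [Finset.mem_filter, Finset.mem_erase, Finset.mem_univ]; grind
      · rw [nwFactor, if_pos (Finset.mem_filter.1 hi).2]
    · refine Finset.prod_congr ?_ fun i hi => ?_
      · ext i; simp only [Finset.mem_filter, Finset.mem_erase, Finset.mem_univ]; grind
      · have := (Finset.mem_filter.1 hi).2
        rw [nwFactor, if_neg this.not_gt, if_neg this.ne']
  · have h3 : nwFactor u j k = circleS (u k) := by
      rw [nwFactor, if_pos (lt_of_le_of_ne (not_lt.1 h1) (Ne.symm h2))]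
    rw [h3, dbar_eq_zero_of_differentiableAt, zero_mul]
    exact (differentiableOn_circleS (u k).continuous).differentiableAt
      (Metric.isOpen_ball.mem_nhds (hb k))

/-- The weak form of the three cases above. Both sides are continuous linear in the pair `(p, ∂̄p)`,
so the identity extends to all mollifications. -/
lemma pairing_nwTerm_wirtingerBar {u : Fin n → C(ℂ, ℂ)} (hu : ∀ i, IsBump (u i))
    {φ : (Fin n → ℂ) → ℂ} (hφ : IsTest φ) (j k : Fin n) :
    pairing (fun z => nwTerm z j) (wirtingerBar k φ) (prodFn u) =
      -(if j < k then pairing (fun z => nwTerm z j) φ (dbarProd u k) else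
        if j = k then pairing (fun z => ContinuousMap.evalCLM ℂ z) φ (prodFn u) -
          ∑ i with i < k, pairing (fun z => nwTerm z i) φ (dbarProd u i) else 0) := by
  have hw : HasCompactSupport (wirtingerBar k φ) :=
    hφ.2.1.mono' ((subset_tsupport _).trans (tsupport_wirtingerBar_subset φ k))
  rw [pairing_apply (isRegularFamily_nwTerm j) (hφ.continuous_wirtingerBar k) hw
    ((tsupport_wirtingerBar_subset φ k).trans hφ.2.2)]
  have h1 := integral_mul_wirtingerBar (contDiffOn_prod_apply (contDiffOn_nwFactor hu j)) hφ k
  have h2 : ∫ z in polydisc n, familyExt (fun z => nwTerm z j) (prodFn u) z * wirtingerBar k φ z =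
      ∫ z in polydisc n, (∏ i, nwFactor u j i (z i)) * wirtingerBar k φ z :=
    setIntegral_congr_fun (measurableSet_polydisc n) fun z hz => by
      simp only [familyExt_nwTerm_prodFn u j hz]
  rw [h2, h1]
  congr 1
  have h3 := fun (z : Fin n → ℂ) (hz : z ∈ polydisc n) =>
    wirtingerBar_prod_nwFactor hu ⟨z, polydisc_subset n hz⟩ hz j k
  split_ifs with hjk hjk'
  · rw [pairing_apply (isRegularFamily_nwTerm j) hφ.1.continuous hφ.2.1 hφ.2.2]
    refine setIntegral_congr_fun (measurableSet_polydisc n) fun z hz => ?_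
    simp only [h3 z hz, if_pos hjk, familyExt_of_mem _ _ hz]
  · have hi : ∀ i f, IntegrableOn (fun z => familyExt (fun z => nwTerm z i) f z * φ z) (polydisc n) :=
      fun i f => (integrable_mul_of_tsupport_subset ((isRegularFamily_nwTerm i).continuousOn f)
        hφ.1.continuous hφ.2.1 hφ.2.2).integrableOn
    have he : IntegrableOn (fun z => familyExt (fun z => ContinuousMap.evalCLM ℂ z) (prodFn u) z *
        φ z) (polydisc n) :=
      (integrable_mul_of_tsupport_subset (isRegularFamily_eval.continuousOn _)
        hφ.1.continuous hφ.2.1 hφ.2.2).integrableOn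
    simp_rw [fun i => pairing_apply (isRegularFamily_nwTerm i) hφ.1.continuous hφ.2.1 hφ.2.2,
      pairing_apply isRegularFamily_eval hφ.1.continuous hφ.2.1 hφ.2.2]
    rw [← integral_finsetSum _ fun i _ => hi i _, ← integral_sub he
      (integrable_finsetSum _ fun i _ => hi i _)]
    refine setIntegral_congr_fun (measurableSet_polydisc n) fun z hz => ?_
    simp only [h3 z hz, if_neg hjk, if_pos hjk', familyExt_of_mem _ _ hz, sub_mul, Finset.sum_mul,
      ContinuousMap.evalCLM_apply]
  · rw [← integral_zero (Fin n → ℂ) ℂ (μ := volume.restrict (polydisc n))]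
    refine setIntegral_congr_fun (measurableSet_polydisc n) fun z hz => ?_
    simp only [h3 z hz, if_neg hjk, if_neg hjk', zero_mul]

lemma pairing_nwTerm_mollify {φ : (Fin n → ℂ) → ℂ} (hφ : IsTest φ) (j k : Fin n) (N : ℕ)
    {v : (Fin n → ℂ) → ℂ} (hv : ContinuousOn v (polydisc n)) :
    pairing (fun z => nwTerm z j) (wirtingerBar k φ) (mollify N v).1 =
      -(if j < k then pairing (fun z => nwTerm z j) φ ((mollify N v).2 k) else
        if j = k then pairing (fun z => ContinuousMap.evalCLM ℂ z) φ (mollify N v).1 -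
          ∑ i with i < k, pairing (fun z => nwTerm z i) φ ((mollify N v).2 i) else 0) := by
  have h := apply_mollify_eq
    (l₁ := (pairing (fun z => nwTerm z j) (wirtingerBar k φ)).comp (ContinuousLinearMap.fst ℂ _ _))
    (l₂ := -(if j < k then (pairing (fun z => nwTerm z j) φ).comp
        ((ContinuousLinearMap.proj k).comp (ContinuousLinearMap.snd ℂ _ _)) else
      if j = k then (pairing (fun z => ContinuousMap.evalCLM ℂ z) φ).comp
          (ContinuousLinearMap.fst ℂ _ _) -
        ∑ i with i < k, (pairing (fun z => nwTerm z i) φ).comp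
          ((ContinuousLinearMap.proj i).comp (ContinuousLinearMap.snd ℂ _ _)) else 0))
    (fun u hu => by
      have := pairing_nwTerm_wirtingerBar hu hφ j k
      split_ifs at this ⊢ <;>
        simpa [prodPair, sum_apply] using this) N hv
  split_ifs at h ⊢ <;>
    simpa [sum_apply] using h

/-- Closedness of the form enters here, tested on the mollifying kernels: the mollified coefficients
satisfy the compatibility conditions `∂̄_k g_j = ∂̄_j g_k`. -/
lemma mollify_snd_comm {g : Fin n → C(closedPolydisc n, ℂ)} (hg : IsDbarClosed g) (N : ℕ)
    (j k : Fin n) : (mollify N (zeroExt (g j))).2 k = (mollify N (zeroExt (g k))).2 j := by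
  ext z
  rw [mollify_snd_apply N (continuousOn_zeroExt_polydisc _),
    mollify_snd_apply N (continuousOn_zeroExt_polydisc _), hg _ (isTest_mollTest N z.2) j k]

/-- The Nijenhuis–Woolf operator, extended by zero. -/
def nwExt (g : Fin n → C(closedPolydisc n, ℂ)) (z : Fin n → ℂ) : ℂ :=
  ∑ j, familyExt (fun z => nwTerm z j) (g j) z

lemma nwExt_of_mem (g : Fin n → C(closedPolydisc n, ℂ)) {z : Fin n → ℂ} (hz : z ∈ polydisc n) :
    nwExt g z = nwFunctional ⟨z, polydisc_subset n hz⟩ g := by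
  rw [nwFunctional_apply]
  exact Finset.sum_congr rfl fun j _ => familyExt_of_mem _ _ hz

lemma continuousOn_nwExt (g : Fin n → C(closedPolydisc n, ℂ)) :
    ContinuousOn (nwExt g) (polydisc n) :=
  continuousOn_finsetSum _ fun j _ => (isRegularFamily_nwTerm j).continuousOn (g j)

/-- Mollify every coefficient as a function. In the sum over `j` the terms with `j < k` involve
`∂̄_k g_j`, while the term `j = k` brings `∂̄_i g_k` for `i < k` with the opposite sign. They cancel
by closedness, and only the pairing of `-g_k` with `φ` remains. No derivatives occur in what is
left, so the mollification can be removed. -/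
lemma integral_nwExt_mul_wirtingerBar {g : Fin n → C(closedPolydisc n, ℂ)} (hg : IsDbarClosed g)
    {φ : (Fin n → ℂ) → ℂ} (hφ : IsTest φ) (k : Fin n) :
    ∫ z in polydisc n, nwExt g z * wirtingerBar k φ z =
      - ∫ z in polydisc n, zeroExt (g k) z * φ z := by
  have hw : HasCompactSupport (wirtingerBar k φ) :=
    hφ.2.1.mono' ((subset_tsupport _).trans (tsupport_wirtingerBar_subset φ k))
  have hs := (tsupport_wirtingerBar_subset φ k).trans hφ.2.2
  have h1 : ∫ z in polydisc n, nwExt g z * wirtingerBar k φ z =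
      ∑ j, pairing (fun z => nwTerm z j) (wirtingerBar k φ) (g j) := by
    simp_rw [fun j => pairing_apply (isRegularFamily_nwTerm j) (hφ.continuous_wirtingerBar k) hw hs,
      nwExt, Finset.sum_mul]
    exact integral_finsetSum _ fun j _ => (integrable_mul_of_tsupport_subset
      ((isRegularFamily_nwTerm j).continuousOn _) (hφ.continuous_wirtingerBar k) hw hs).integrableOn
  have h2 : ∀ N, ∑ j, pairing (fun z => nwTerm z j) (wirtingerBar k φ) (mollify N (zeroExt (g j))).1 =
      -pairing (fun z => ContinuousMap.evalCLM ℂ z) φ (mollify N (zeroExt (g k))).1 := fun N => by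
    simp_rw [fun j => pairing_nwTerm_mollify hφ j k N (continuousOn_zeroExt_polydisc (g j))]
    rw [Finset.sum_neg_distrib, Finset.sum_ite, Finset.sum_ite_eq_of_mem']
    · simp_rw [mollify_snd_comm hg N _ k]
      ring
    · simp
  rw [h1, ← familyExt_eval, ← pairing_apply isRegularFamily_eval hφ.1.continuous hφ.2.1 hφ.2.2]
  refine tendsto_nhds_unique (tendsto_finsetSum _ fun j _ => ((pairing (fun z => nwTerm z j)
    (wirtingerBar k φ)).continuous.tendsto _).comp (tendsto_mollify (g j))) ?_
  refine ((((pairing (fun z => ContinuousMap.evalCLM ℂ z) φ).continuous.tendsto _).comp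
    (tendsto_mollify (g k))).neg).congr fun N => (h2 N).symm

/-! ### The summands of Henkin's operator -/

section Slice

variable (P : Fin n → Prop) [DecidablePred P]

/-- The point with the coordinates `ρ e^{iθ_k}` for the indices `k` with `P k`, and those of `z`
for the other indices. -/
def slicePoint (z : Fin n → ℂ) (ρ : ℝ) (θ : {k // P k} → ℝ) : Fin n → ℂ :=
  fun i => if h : P i then ρ * exp (θ ⟨i, h⟩ * I) else z i

/-- The domain of integration in polar coordinates. -/
def sliceDomain (z : Fin n → ℂ) : Set (ℝ × ({k // P k} → ℝ)) :=
  {p | (0 ≤ p.1 ∧ p.1 ≤ 1 ∧ ∀ i, ¬ P i → p.1 ≤ ‖z i‖) ∧ ∀ k, 0 ≤ p.2 k ∧ p.2 k ≤ 2 * Real.pi}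

/-- The summand of Henkin's operator in which the variables `ζ_k` with `P k` are integrated. -/
def sliceIntegral (g : Fin n → C(closedPolydisc n, ℂ)) (z : Fin n → ℂ) : ℂ :=
  ((2 * Real.pi * I) ^ Fintype.card {k // P k})⁻¹ *
    ∫ p in sliceDomain P z,
      ∑ s : {k // P k}, zeroExt (g s) (slicePoint P z p.1 p.2) *
        (2 * I * p.1 * ∏ k ∈ Finset.univ.erase s, (I * p.1 * exp (p.2 k * I))) /
          ∏ k : {k // P k}, (slicePoint P z p.1 p.2 k - z k)

lemma sliceIntegral_congr {P Q : Fin n → Prop} [hP : DecidablePred P] [hQ : DecidablePred Q]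
    (h : P = Q) (g : Fin n → C(closedPolydisc n, ℂ)) (z : Fin n → ℂ) :
    sliceIntegral P g z = sliceIntegral Q g z := by
  subst h
  rw [Subsingleton.elim hP hQ]

/-- The integral depends on the tuple only through its set of entries; the ordering merely serves to
count each set once. -/
lemma henkinIntegral_eq_sliceIntegral {r : ℕ} (J : Fin r ↪ Fin n)
    (g : Fin n → C(closedPolydisc n, ℂ)) (z : Fin n → ℂ) :
    henkinIntegral J g z = sliceIntegral (fun k => k ∉ Finset.univ.map J) g z := by
  have hP : (fun k => k ∉ Finset.univ.map J) = fun k => ∀ a, J a ≠ k := by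
    ext k; simp
  rw [sliceIntegral_congr hP]
  have hcard : Fintype.card (Rest J) = n - r := by
    have h : (Finset.univ.filter fun k => ∀ a, J a ≠ k) = (Finset.univ.map J)ᶜ := by
      ext k; simp
    rw [Fintype.card_subtype, h, Finset.card_compl]
    simp
  have hdom : henkinDomain J z = sliceDomain (fun k => ∀ a, J a ≠ k) z := by
    ext p
    simp only [henkinDomain, sliceDomain, Set.mem_ofPred_eq]
    refine and_congr_left fun _ => and_congr_right fun _ => and_congr_right fun _ =>
      ⟨fun h i hi => ?_, fun h a => h (J a) fun h' => h' a rfl⟩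
    push Not at hi
    obtain ⟨a, rfl⟩ := hi
    exact h a
  unfold henkinIntegral sliceIntegral
  rw [hdom, hcard]
  rfl

/-- The factors of the kernel of a summand; `b` says whether the differential `dζ̄` has the same
index. -/
def sliceFactor (b : Prop) [Decidable b] (a : ℂ) (ρ θ : ℝ) : ℂ :=
  (2 * Real.pi * I)⁻¹ * (if b then 2 * I * ρ else I * ρ * exp (θ * I)) / (ρ * exp (θ * I) - a)

/-- The characteristic function of `(-∞, t]`. -/
def radialCut (t ρ : ℝ) : ℂ := if ρ ≤ t then 1 else 0

lemma norm_radialCut_le (t ρ : ℝ) : ‖radialCut t ρ‖ ≤ 1 := by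
  unfold radialCut; split_ifs <;> simp

lemma measurable_radialCut (t : ℝ) : Measurable (radialCut t) :=
  Measurable.ite measurableSet_Iic measurable_const measurable_const

lemma measurable_sliceFactor {ι : Type*} (b : Prop) [Decidable b] (a : ℂ) (k : ι) :
    Measurable fun p : ℝ × (ι → ℝ) => sliceFactor b a p.1 (p.2 k) := by
  unfold sliceFactor
  split_ifs
  · fun_prop
  · fun_prop

lemma norm_sliceFactor_le (b : Prop) [Decidable b] (a : ℂ) {ρ : ℝ} (hρ : 0 ≤ ρ) (θ : ℝ) :
    ‖sliceFactor b a ρ θ‖ ≤ ρ / ‖ρ * exp (θ * I) - a‖ := by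
  have hpi := Real.pi_gt_three
  have h1 : ‖(if b then 2 * I * ρ else I * ρ * exp (θ * I) : ℂ)‖ ≤ 2 * ρ := by
    split_ifs
    · simp [abs_of_nonneg hρ]
    · simp only [norm_mul, norm_I, norm_exp_ofReal_mul_I, norm_real, Real.norm_of_nonneg hρ]
      linarith
  have h2 : ‖(2 * Real.pi * I : ℂ)⁻¹‖ ≤ 2⁻¹ := by
    simp only [norm_inv, norm_mul, norm_I, norm_real, Real.norm_of_nonneg Real.pi_pos.le,
      Complex.norm_ofNat]
    gcongr
    linarith
  rw [sliceFactor, norm_div, norm_mul]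
  gcongr
  nlinarith [norm_nonneg (if b then 2 * I * ρ else I * ρ * exp (θ * I) : ℂ)]

/-- The kernel of a summand, for the coefficient of `dζ̄_s`. -/
def sliceKernel (z : Fin n → ℂ) (s : {k // P k}) (p : ℝ × ({k // P k} → ℝ)) : ℂ :=
  (∏ i with ¬ P i, radialCut ‖z i‖ p.1) * ∏ k, sliceFactor (k = s) (z k) p.1 (p.2 k)

lemma measurable_sliceKernel (z : Fin n → ℂ) (s : {k // P k}) : Measurable (sliceKernel P z s) := by
  have h1 : ∀ i, Measurable fun p : ℝ × ({k // P k} → ℝ) => radialCut ‖z i‖ p.1 := fun i =>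
    (measurable_radialCut _).comp measurable_fst
  have h2 : ∀ k : {k // P k}, Measurable fun p : ℝ × ({k // P k} → ℝ) =>
      sliceFactor (k = s) (z k) p.1 (p.2 k) := fun k =>
    measurable_sliceFactor (k = s) (z k) k
  unfold sliceKernel
  exact (Finset.measurable_prod _ fun i _ => h1 i).mul (Finset.measurable_prod _ fun k _ => h2 k)

lemma polarMeasure_eq (ι : Type*) [Fintype ι] : polarMeasure ι = volume.restrict
    (Set.Icc 0 1 ×ˢ Set.univ.pi fun _ : ι => Set.Icc 0 (2 * Real.pi)) := by
  rw [polarMeasure, Measure.volume_eq_prod, ← Measure.prod_restrict, volume_pi,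
    Measure.restrict_pi_pi]

lemma ae_mem_polarMeasure (ι : Type*) [Fintype ι] :
    ∀ᵐ p ∂polarMeasure ι, p.1 ∈ Set.Icc (0 : ℝ) 1 := by
  rw [polarMeasure_eq]
  filter_upwards [ae_restrict_mem (measurableSet_Icc.prod
    (MeasurableSet.univ_pi fun _ => measurableSet_Icc))] with p hp using hp.1

lemma norm_sliceKernel_le (z : Fin n → ℂ) (s : {k // P k}) {p : ℝ × ({k // P k} → ℝ)}
    (hp : 0 ≤ p.1) : ‖sliceKernel P z s p‖ ≤ polarKernel (fun k : {k // P k} => z k) p := by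
  rw [sliceKernel, norm_mul, norm_prod, norm_prod, polarKernel]
  refine (mul_le_of_le_one_left (Finset.prod_nonneg fun _ _ => norm_nonneg _)
    (Finset.prod_le_one (fun _ _ => norm_nonneg _) fun i _ => norm_radialCut_le _ _)).trans ?_
  exact Finset.prod_le_prod (fun _ _ => norm_nonneg _) fun k _ => norm_sliceFactor_le _ _ hp _

lemma exists_integral_norm_sliceKernel_le : ∃ C, ∀ (z : closedPolydisc n) (s : {k // P k}),
    Integrable (sliceKernel P z.1 s) (polarMeasure {k // P k}) ∧
      ∫ p, ‖sliceKernel P z.1 s p‖ ∂polarMeasure {k // P k} ≤ C := by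
  obtain ⟨C, hC⟩ := exists_integral_polarKernel_le {k // P k}
  refine ⟨C, fun z s => ?_⟩
  obtain ⟨h1, h2⟩ := hC (fun k => z.1 k) fun k => z.2 k
  have h3 : ∀ᵐ p ∂polarMeasure {k // P k}, ‖sliceKernel P z.1 s p‖ ≤
      polarKernel (fun k : {k // P k} => z.1 k) p := by
    filter_upwards [ae_mem_polarMeasure {k // P k}] with p hp using norm_sliceKernel_le P z.1 s hp.1
  have h4 := h1.mono' (measurable_sliceKernel P z.1 s).aestronglyMeasurable h3
  exact ⟨h4, (integral_mono_ae h4.norm h1 h3).trans h2⟩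

/-- The parametrization of the domain of integration, extended to a continuous map. -/
def sliceMap (z : closedPolydisc n) : C(ℝ × ({k // P k} → ℝ), closedPolydisc n) where
  toFun p := ⟨slicePoint P z.1 (max 0 (min p.1 1)) p.2, fun i => by
    unfold slicePoint
    split_ifs
    · rw [norm_mul, norm_exp_ofReal_mul_I, mul_one, norm_real, Real.norm_of_nonneg (le_max_left _ _)]
      exact max_le zero_le_one (min_le_right _ _)
    · exact z.2 i⟩
  continuous_toFun := by
    refine Continuous.subtype_mk (continuous_pi fun i => ?_) _
    unfold slicePoint
    split_ifs
    · fun_prop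
    · fun_prop

lemma sliceMap_coe (z : closedPolydisc n) {p : ℝ × ({k // P k} → ℝ)} (hp : p.1 ∈ Set.Icc (0 : ℝ) 1) :
    (sliceMap P z p).1 = slicePoint P z.1 p.1 p.2 := by
  change slicePoint P z.1 (max 0 (min p.1 1)) p.2 = _
  rw [min_eq_left hp.2, max_eq_right hp.1]

/-- A summand of Henkin's operator, as a functional. -/
def sliceFunctional (z : closedPolydisc n) : (Fin n → C(closedPolydisc n, ℂ)) →L[ℂ] ℂ :=
  ∑ s : {k // P k}, (kernelFunctional (polarMeasure {k // P k}) (sliceKernel P z.1 s)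
    (sliceMap P z)).comp (ContinuousLinearMap.proj s.1)

lemma sliceFunctional_apply (z : closedPolydisc n) (g : Fin n → C(closedPolydisc n, ℂ)) :
    sliceFunctional P z g = ∑ s : {k // P k}, ∫ p, sliceKernel P z.1 s p * g s (sliceMap P z p)
      ∂polarMeasure {k // P k} := by
  obtain ⟨C, hC⟩ := exists_integral_norm_sliceKernel_le P
  simp_rw [← fun s f => kernelFunctional_apply (hC z s).1 (sliceMap P z) f]
  simp [sliceFunctional]

lemma exists_norm_sliceFunctional_le :
    ∃ C, ∀ (z : closedPolydisc n), ‖sliceFunctional P z‖ ≤ C := by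
  obtain ⟨C, hC⟩ := exists_integral_norm_sliceKernel_le P
  refine ⟨∑ _s : {k // P k}, C, fun z => (norm_sum_le _ _).trans (Finset.sum_le_sum fun s _ => ?_)⟩
  refine (ContinuousLinearMap.opNorm_comp_le _ _).trans ?_
  refine (mul_le_of_le_one_right (norm_nonneg _) ?_).trans
    ((norm_kernelFunctional_le _ _ _).trans (hC z s).2)
  exact ContinuousLinearMap.opNorm_le_bound _ zero_le_one fun g => by
    rw [one_mul]; exact norm_le_pi_norm g s.1

/-- The constraints `ρ ≤ |z_i|` move into the kernel as a product of cutoffs, so that the domain no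
longer depends on `z`. -/
lemma sliceIntegral_eq (z : closedPolydisc n) (g : Fin n → C(closedPolydisc n, ℂ)) :
    sliceIntegral P g z.1 = sliceFunctional P z g := by
  obtain ⟨C, hC⟩ := exists_integral_norm_sliceKernel_le P
  have hms : MeasurableSet {p : ℝ × ({k // P k} → ℝ) | ∀ i, ¬ P i → p.1 ≤ ‖z.1 i‖} := by
    simp only [Set.ofPred_forall]
    exact MeasurableSet.iInter fun i => MeasurableSet.iInter fun _ =>
      measurableSet_le measurable_fst measurable_const
  have hdom : sliceDomain P z.1 = {p | ∀ i, ¬ P i → p.1 ≤ ‖z.1 i‖} ∩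
      (Set.Icc 0 1 ×ˢ Set.univ.pi fun _ : {k // P k} => Set.Icc 0 (2 * Real.pi)) := by
    ext p
    simp only [sliceDomain, Set.mem_ofPred_eq, Set.mem_inter_iff, Set.mem_prod, Set.mem_Icc,
      Set.mem_univ_pi]
    tauto
  rw [sliceFunctional_apply, ← integral_finsetSum _ fun s _ => integrable_mul_comp (hC z s).1 _ _,
    sliceIntegral, hdom, ← Measure.restrict_restrict hms, ← polarMeasure_eq,
    ← integral_indicator hms, ← integral_const_mul]
  refine integral_congr_ae ?_
  filter_upwards [ae_mem_polarMeasure {k // P k}] with p hp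
  have hcut : (∏ i with ¬ P i, radialCut ‖z.1 i‖ p.1) =
      if p ∈ {p : ℝ × ({k // P k} → ℝ) | ∀ i, ¬ P i → p.1 ≤ ‖z.1 i‖} then 1 else 0 := by
    simp only [radialCut, Finset.prod_ite_zero, Finset.prod_const_one, Finset.mem_filter,
      Finset.mem_univ, true_and, Set.mem_ofPred_eq]
  have hpt : ∀ k : {k // P k}, slicePoint P z.1 p.1 p.2 k = p.1 * exp (p.2 k * I) := fun k => by
    rw [slicePoint, dif_pos k.2]
  rw [Set.indicator_apply]
  simp only [sliceKernel, hcut]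
  split_ifs with hmem
  · rw [Finset.mul_sum]
    refine Finset.sum_congr rfl fun s _ => ?_
    rw [← zeroExt_coe, sliceMap_coe P z hp]
    have h1 : ∏ k : {k // P k}, sliceFactor (k = s) (z.1 k) p.1 (p.2 k) =
        ((2 * Real.pi * I) ^ Fintype.card {k // P k})⁻¹ *
        (2 * I * p.1 * ∏ k ∈ Finset.univ.erase s, (I * p.1 * exp (p.2 k * I))) /
          ∏ k : {k // P k}, (slicePoint P z.1 p.1 p.2 k - z.1 k) := by
      simp only [sliceFactor, Finset.prod_div_distrib, Finset.prod_mul_distrib, Finset.prod_const,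
        Finset.card_univ, inv_pow, hpt]
      rw [← Finset.mul_prod_erase (a := s) Finset.univ (fun k : {k // P k} =>
        if k = s then 2 * I * (p.1 : ℂ) else I * p.1 * exp (p.2 k * I)) (Finset.mem_univ s), if_pos rfl,
        Finset.prod_congr rfl fun k hk => if_neg (Finset.ne_of_mem_erase hk)]
      simp only [Finset.prod_mul_distrib, Finset.prod_const]
    rw [h1]
    ring
  · simp

end Slice

/-! ### Henkin's operator on exact product forms -/

lemma integral_sliceFactor_mul (b : Prop) [Decidable b] (h f : ℂ → ℂ) (a : ℂ) (ρ : ℝ) :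
    ∫ θ in Set.Icc 0 (2 * Real.pi), sliceFactor b a ρ θ * (if b then h else f) (ρ * exp (θ * I)) =
      if b then radialDensity h a ρ else circleMean f a ρ := by
  unfold sliceFactor
  split_ifs
  · rw [radialDensity, ← integral_const_mul]
    congr 1
    ext θ
    ring
  · rw [circleMean, ← integral_const_mul]
    congr 1
    ext θ
    ring

lemma dbarProd_sliceMap (P : Fin n → Prop) [DecidablePred P] {u : Fin n → C(ℂ, ℂ)}
    (hu : ∀ i, IsBump (u i)) (z : closedPolydisc n) (s : {k // P k}) {p : ℝ × ({k // P k} → ℝ)}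
    (hp : p.1 ∈ Set.Icc (0 : ℝ) 1) :
    dbarProd u s (sliceMap P z p) = (∏ i with ¬ P i, u i (z.1 i)) *
      ∏ k : {k // P k}, (if k = s then dbar (u k) else u k) (p.1 * exp (p.2 k * I)) := by
  rw [dbarProd, prodFn_apply, sliceMap_coe P z hp, ← Finset.prod_filter_mul_prod_filter_not _ P,
    mul_comm]
  congr 1
  · refine Finset.prod_congr rfl fun i hi => ?_
    have h := (Finset.mem_filter.1 hi).2
    rw [slicePoint, dif_neg h, Function.update_of_ne]
    rintro rfl
    exact h s.2
  · rw [Finset.prod_subtype (p := P) _ (by simp)]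
    refine Finset.prod_congr rfl fun k _ => ?_
    rw [slicePoint, dif_pos k.2]
    split_ifs with h
    · subst h
      rw [Function.update_self, (hu k).coe_dbarC]
    · rw [Function.update_of_ne fun h' => h (Subtype.ext h')]

/-- Kernel and form both split into factors, one for each variable, so integrating out the angles
leaves a product of functions of the common radius. -/
lemma integral_sliceKernel_mul_dbarProd (P : Fin n → Prop) [DecidablePred P] {u : Fin n → C(ℂ, ℂ)}
    (hu : ∀ i, IsBump (u i)) (z : closedPolydisc n) (s : {k // P k}) :
    IntegrableOn (fun ρ => (∏ i with ¬ P i, radialCut ‖z.1 i‖ ρ * u i (z.1 i)) * ∏ k : {k // P k},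
      if k = s then radialDensity (dbar (u k)) (z.1 k) ρ else circleMean (u k) (z.1 k) ρ)
        (Set.Icc 0 1) ∧
    ∫ p, sliceKernel P z.1 s p * dbarProd u s (sliceMap P z p) ∂polarMeasure {k // P k} =
      ∫ ρ in Set.Icc 0 1, (∏ i with ¬ P i, radialCut ‖z.1 i‖ ρ * u i (z.1 i)) * ∏ k : {k // P k},
        if k = s then radialDensity (dbar (u k)) (z.1 k) ρ else circleMean (u k) (z.1 k) ρ := by
  obtain ⟨C, hC⟩ := exists_integral_norm_sliceKernel_le P
  set F : ℝ × ({k // P k} → ℝ) → ℂ := fun p =>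
    (∏ i with ¬ P i, radialCut ‖z.1 i‖ p.1 * u i (z.1 i)) * ∏ k : {k // P k},
      (sliceFactor (k = s) (z.1 k) p.1 (p.2 k) *
        (if k = s then dbar (u k) else u k) (p.1 * exp (p.2 k * I))) with hF
  have h1 : (fun p => sliceKernel P z.1 s p * dbarProd u s (sliceMap P z p))
      =ᵐ[polarMeasure {k // P k}] F := by
    filter_upwards [ae_mem_polarMeasure {k // P k}] with p hp
    rw [hF, dbarProd_sliceMap P hu z s hp]
    simp only [sliceKernel, Finset.prod_mul_distrib]
    ring
  have h2 : Integrable F (polarMeasure {k // P k}) :=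
    (integrable_mul_comp (hC z s).1 _ _).congr h1
  have h3 : ∀ ρ : ℝ, ∫ θ, F (ρ, θ)
      ∂(Measure.pi fun _ : {k // P k} => volume.restrict (Set.Icc 0 (2 * Real.pi))) =
      (∏ i with ¬ P i, radialCut ‖z.1 i‖ ρ * u i (z.1 i)) * ∏ k : {k // P k},
        if k = s then radialDensity (dbar (u k)) (z.1 k) ρ else circleMean (u k) (z.1 k) ρ :=
    fun ρ => by
    simp only [hF]
    rw [integral_const_mul, integral_fintype_prod_eq_prod (fun (k : {k // P k}) (θ : ℝ) =>
      sliceFactor (k = s) (z.1 k) ρ θ *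
        (if k = s then dbar (u k) else u k) (ρ * exp (θ * I)))]
    simp_rw [fun k : {k // P k} =>
      integral_sliceFactor_mul (k = s) (dbar (u k)) (u k) (z.1 k) ρ]
  unfold polarMeasure at h1 h2 ⊢
  constructor
  · simpa only [h3, IntegrableOn] using h2.integral_prod_left
  · rw [integral_congr_ae h1, integral_prod _ h2]
    simp only [h3]

/-- For fixed `s` this is the expansion of a product of sums `y k + m k` over the sets `M` that
avoid `s`. For Henkin's operator, `y` comes from the frozen variables, `m` from the integrated ones,
and `r` from the variable that carries `dζ̄`. -/
lemma sum_finset_sum_prod {ι R : Type*} [Fintype ι] [DecidableEq ι] [CommSemiring R]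
    (y m r : ι → R) :
    ∑ M : Finset ι, ∑ s : {k // k ∉ M}, (∏ i with ¬ i ∉ M, y i) *
      ∏ k : {k // k ∉ M}, (if k = s then r k else m k) =
    ∑ s, (∏ k ∈ Finset.univ.erase s, (y k + m k)) * r s := by
  have h1 : ∀ M : Finset ι, ∑ s : {k // k ∉ M}, (∏ i with ¬ i ∉ M, y i) *
      ∏ k : {k // k ∉ M}, (if k = s then r k else m k) =
      ∑ s ∈ Mᶜ, (∏ i ∈ M, y i) * ((∏ k ∈ Finset.univ.erase s \ M, m k) * r s) := fun M => by
    rw [Finset.sum_subtype (p := fun k => k ∉ M) Mᶜ (by simp)]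
    refine Finset.sum_congr rfl fun s _ => ?_
    congr 1
    · congr 1
      ext i; simp
    · rw [← Finset.mul_prod_erase _ _ (Finset.mem_univ s), if_pos rfl, mul_comm]
      congr 1
      rw [Finset.prod_congr rfl fun k hk => if_neg (Finset.ne_of_mem_erase hk)]
      refine Finset.prod_bij (fun k _ => k.1) ?_ ?_ ?_ ?_
      · intro k hk
        simpa using ⟨fun h => Finset.ne_of_mem_erase hk (Subtype.ext h), k.2⟩
      · intro a _ b _ h
        exact Subtype.ext h
      · intro k hk
        simp only [Finset.mem_sdiff, Finset.mem_erase, Finset.mem_univ, and_true] at hk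
        exact ⟨⟨k, hk.2⟩, by simpa [Subtype.ext_iff] using hk.1, rfl⟩
      · intro k _
        rfl
  simp_rw [h1]
  rw [Finset.sum_comm' (t' := Finset.univ) (s' := fun s => (Finset.univ.erase s).powerset)]
  · refine Finset.sum_congr rfl fun s _ => ?_
    rw [Finset.prod_add, Finset.sum_mul]
    exact Finset.sum_congr rfl fun M _ => by ring
  · intro M s
    simp only [Finset.mem_univ, true_and, Finset.mem_compl, Finset.mem_powerset, and_true]
    exact ⟨fun h i hi => by simpa using fun h' : i = s => h (h' ▸ hi),
      fun h hs => by simpa using h hs⟩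

/-- Henkin's operator at a point, as a functional. -/
def henkinFunctional (z : closedPolydisc n) : (Fin n → C(closedPolydisc n, ℂ)) →L[ℂ] ℂ :=
  -∑ M : Finset (Fin n), sliceFunctional (fun k => k ∉ M) z

lemma henkinFunctional_apply (z : closedPolydisc n) (g : Fin n → C(closedPolydisc n, ℂ)) :
    henkinFunctional z g = -∑ M : Finset (Fin n), sliceFunctional (fun k => k ∉ M) z g := by
  simp [henkinFunctional, sum_apply]

lemma exists_norm_henkinFunctional_le :
    ∃ C, 0 ≤ C ∧ ∀ z : closedPolydisc n, ‖henkinFunctional z‖ ≤ C := by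
  choose C hC using fun M : Finset (Fin n) => exists_norm_sliceFunctional_le fun k => k ∉ M
  refine ⟨|∑ M, C M|, abs_nonneg _, fun z => ?_⟩
  rw [henkinFunctional, norm_neg]
  exact ((norm_sum_le _ _).trans (Finset.sum_le_sum fun M _ => hC M z)).trans (le_abs_self _)

/-- For almost every `ρ` the cutoff term compensates the jump of the circle mean: their sum is
`circleRemainder + u k (z k)` on both sides of `|z k|`. These factors are continuous with derivative
`radialDensity` off finitely many radii, so the integrand is the Leibniz derivative of their
product. -/
lemma integral_radial_eq {u : Fin n → C(ℂ, ℂ)} (hu : ∀ i, IsBump (u i)) (z : Fin n → ℂ) :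
    ∫ ρ in Set.Icc (0 : ℝ) 1, ∑ s, (∏ k ∈ Finset.univ.erase s,
        (radialCut ‖z k‖ ρ * u k (z k) + circleMean (u k) (z k) ρ)) *
          radialDensity (dbar (u s)) (z s) ρ =
      (∏ k, (u k (z k) - discT (dbar (u k)) (z k))) - ∏ k, u k (z k) := by
  have hne : ∀ᵐ ρ : ℝ, ∀ k, ρ ≠ ‖z k‖ := ae_all_iff.2 fun k => Measure.ae_ne _ _
  have h1 : ∫ ρ in Set.Icc (0 : ℝ) 1, ∑ s, (∏ k ∈ Finset.univ.erase s,
        (radialCut ‖z k‖ ρ * u k (z k) + circleMean (u k) (z k) ρ)) *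
          radialDensity (dbar (u s)) (z s) ρ =
      ∫ ρ in Set.Icc (0 : ℝ) 1, ∑ s, (∏ k ∈ Finset.univ.erase s,
        (circleRemainder (u k) (z k) ρ + u k (z k))) * radialDensity (dbar (u s)) (z s) ρ := by
    refine integral_congr_ae ?_
    filter_upwards [ae_restrict_mem measurableSet_Icc, ae_restrict_of_ae hne] with ρ hρ hk
    refine Finset.sum_congr rfl fun s _ => ?_
    congr 1
    refine Finset.prod_congr rfl fun k _ => ?_
    rw [circleMean_eq (u k).continuous hρ.1 (hk k), radialCut]
    rcases lt_or_gt_of_ne (hk k) with h | h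
    · rw [if_pos h.le, if_neg h.not_gt]; ring
    · rw [if_neg h.not_ge, if_pos h]; ring
  have hcont : ∀ s : Finset (Fin n), ContinuousOn (fun ρ : ℝ => ∏ k ∈ s,
      (circleRemainder (u k) (z k) ρ + u k (z k))) (Set.Icc 0 1) := fun s =>
    continuousOn_finsetProd _ fun k _ =>
      (continuousOn_circleRemainder (hu k).contDiff_one (z k) 1).add continuousOn_const
  have hint : IntegrableOn (fun ρ : ℝ => ∑ s, (∏ k ∈ Finset.univ.erase s,
        (circleRemainder (u k) (z k) ρ + u k (z k))) * radialDensity (dbar (u s)) (z s) ρ)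
      (Set.Icc 0 1) := integrable_finsetSum _ fun s _ =>
    (integrableOn_radialDensity (continuous_dbar (hu s).contDiff_one) (z s)).continuousOn_mul
      (hcont _) isCompact_Icc
  have hftc := integral_eq_of_hasDerivAt_off_countable_of_le
    (fun ρ : ℝ => ∏ k, (circleRemainder (u k) (z k) ρ + u k (z k))) _ zero_le_one
    (Set.countable_range fun k => ‖z k‖) (hcont Finset.univ)
    (fun ρ hρ => by
      have := HasDerivAt.fun_finsetProd (u := Finset.univ)
        (f := fun k ρ => circleRemainder (u k) (z k) ρ + u k (z k))
        fun k _ => (hasDerivAt_circleRemainder (hu k).contDiff_one hρ.1.1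
          fun h => hρ.2 ⟨k, h.symm⟩).add_const (u k (z k))
      simpa only [smul_eq_mul] using this)
    ((intervalIntegrable_iff_integrableOn_Icc_of_le zero_le_one).2 hint)
  rw [h1, integral_Icc_eq_integral_Ioc, ← intervalIntegral.integral_of_le zero_le_one, hftc]
  simp only [circleRemainder_zero, zero_add, fun k => circleRemainder_one_eq (hu k).contDiff_one (z k)]
  congr 1
  exact Finset.prod_congr rfl fun k _ => by ring

lemma henkinFunctional_dbarProd {u : Fin n → C(ℂ, ℂ)} (hu : ∀ i, IsBump (u i))
    (z : closedPolydisc n) :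
    henkinFunctional z (dbarProd u) =
      prodFn u z - ∏ k, (u k (z.1 k) - discT (dbar (u k)) (z.1 k)) := by
  have h1 : ∑ M : Finset (Fin n), sliceFunctional (fun k => k ∉ M) z (dbarProd u) =
      ∫ ρ in Set.Icc (0 : ℝ) 1, ∑ s, (∏ k ∈ Finset.univ.erase s,
        (radialCut ‖z.1 k‖ ρ * u k (z.1 k) + circleMean (u k) (z.1 k) ρ)) *
          radialDensity (dbar (u s)) (z.1 s) ρ := by
    simp_rw [← sum_finset_sum_prod]
    rw [integral_finsetSum _ fun M _ => integrable_finsetSum _ fun s _ =>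
      (integral_sliceKernel_mul_dbarProd (fun k => k ∉ M) hu z s).1]
    refine Finset.sum_congr rfl fun M _ => ?_
    rw [integral_finsetSum _ fun s _ =>
      (integral_sliceKernel_mul_dbarProd (fun k => k ∉ M) hu z s).1, sliceFunctional_apply]
    exact Finset.sum_congr rfl fun s _ =>
      (integral_sliceKernel_mul_dbarProd (fun k => k ∉ M) hu z s).2
  rw [henkinFunctional_apply, h1, integral_radial_eq hu, prodFn_apply]
  ring

/-! ### Henkin's operator as a sum over sets of indices -/

/-- The key by which decreasing tuples are sorted. -/
def sortKey (z : Fin n → ℂ) (i : Fin n) : ℝ ×ₗ Fin n := toLex (-‖z i‖, i)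

lemma sortKey_injective (z : Fin n → ℂ) : Function.Injective (sortKey z) := fun _ _ h =>
  congrArg (fun x => (ofLex x).2) h

lemma isDecreasing_iff_strictMono {r : ℕ} (z : Fin n → ℂ) (J : Fin r ↪ Fin n) :
    IsDecreasing z J ↔ StrictMono (sortKey z ∘ J) := by
  refine forall_congr' fun a => forall_congr' fun b => imp_congr_right fun _ => ?_
  simp only [Function.comp_apply, sortKey, Prod.Lex.toLex_lt_toLex, neg_lt_neg_iff, neg_inj]
  rw [eq_comm (a := ‖z (J b)‖)]

lemma eq_of_isDecreasing {r : ℕ} {z : Fin n → ℂ} {J J' : Fin r ↪ Fin n} (hJ : IsDecreasing z J)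
    (hJ' : IsDecreasing z J') (h : Finset.univ.map J = Finset.univ.map J') : J = J' := by
  rw [isDecreasing_iff_strictMono] at hJ hJ'
  have hr : Set.range J = Set.range J' := by
    simpa using congrArg (fun s : Finset (Fin n) => (s : Set (Fin n))) h
  have := (hJ.range_inj hJ').1 (by rw [Set.range_comp, Set.range_comp, hr])
  ext a
  exact congrArg Fin.val (sortKey_injective z (congrFun this a))

/-- The keys are pairwise distinct elements of a linear order, so listing them increasingly yields
the tuple. -/
lemma exists_isDecreasing {r : ℕ} (z : Fin n → ℂ) {M : Finset (Fin n)} (hM : M.card = r) :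
    ∃ J : Fin r ↪ Fin n, IsDecreasing z J ∧ Finset.univ.map J = M := by
  set e := (M.map ⟨sortKey z, sortKey_injective z⟩).orderEmbOfFin
    ((Finset.card_map _).trans hM) with he
  have hmem : ∀ a, ∃ i ∈ M, sortKey z i = e a := fun a => by
    have := Finset.orderEmbOfFin_mem (M.map ⟨sortKey z, sortKey_injective z⟩)
      ((Finset.card_map _).trans hM) a
    exact Finset.mem_map.1 this
  choose f hfM hf using hmem
  have hinj : Function.Injective f := fun a b h => e.injective (by rw [← hf, ← hf, h])
  refine ⟨⟨f, hinj⟩, ?_, ?_⟩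
  · rw [isDecreasing_iff_strictMono]
    have : sortKey z ∘ (⟨f, hinj⟩ : Fin r ↪ Fin n) = e := funext hf
    rw [this]
    exact e.strictMono
  · refine Finset.eq_of_subset_of_card_le (fun i hi => ?_) (by simp [hM])
    obtain ⟨a, _, rfl⟩ := Finset.mem_map.1 hi
    exact hfM a

lemma henkin_eq (z : closedPolydisc n) (g : Fin n → C(closedPolydisc n, ℂ)) :
    henkin g z.1 = henkinFunctional z g := by
  classical
  have h1 : ∀ r, (∑ J : Fin r ↪ Fin n, if IsDecreasing z.1 J then henkinIntegral J g z.1 else 0) =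
      ∑ M ∈ Finset.powersetCard r Finset.univ, sliceFunctional (fun k => k ∉ M) z g := fun r => by
    rw [← Finset.sum_filter]
    refine Finset.sum_bij (fun J _ => Finset.univ.map J) (fun J _ => ?_) (fun J hJ J' hJ' h => ?_)
      (fun M hM => ?_) fun J _ => ?_
    · simp [Finset.mem_powersetCard]
    · exact eq_of_isDecreasing (Finset.mem_filter.1 hJ).2 (Finset.mem_filter.1 hJ').2 h
    · obtain ⟨J, hJ, hJM⟩ := exists_isDecreasing z.1 (Finset.mem_powersetCard.1 hM).2
      exact ⟨J, by simpa using hJ, hJM⟩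
    · rw [henkinIntegral_eq_sliceIntegral, sliceIntegral_eq]
  -- Henkin's sum stops at `r = n - 1`. The full index set leaves no variable to carry `dζ̄`, so
  -- including it adds an empty sum.
  have h2 : sliceFunctional (fun k => k ∉ (Finset.univ : Finset (Fin n))) z g = 0 := by
    have : IsEmpty {k : Fin n // k ∉ (Finset.univ : Finset (Fin n))} :=
      ⟨fun k => k.2 (Finset.mem_univ _)⟩
    rw [sliceFunctional_apply]
    exact Fintype.sum_empty _
  rw [henkinFunctional_apply, ← Finset.powerset_univ, Finset.sum_powerset, Finset.sum_range_succ,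
    Finset.powersetCard_self, Finset.sum_singleton, h2, add_zero, Finset.card_univ,
    Fintype.card_fin, henkin]
  congr 1
  refine Finset.sum_congr rfl fun r _ => (Eq.trans ?_ (h1 r))
  exact Finset.sum_congr rfl fun J _ => by congr

/-! ### The three operators agree -/

/-- `∂̄v = g` in the sense of distributions, for a function `v` on the open polydisc. -/
def IsWeakSolution (v : (Fin n → ℂ) → ℂ) (g : Fin n → C(closedPolydisc n, ℂ)) : Prop :=
  ∀ φ : (Fin n → ℂ) → ℂ, IsTest φ → ∀ j : Fin n,
    ∫ z in polydisc n, v z * wirtingerBar j φ z = - ∫ z in polydisc n, zeroExt (g j) z * φ z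

lemma tendsto_shrink : Filter.Tendsto shrink Filter.atTop (𝓝 1) := by
  have := (tendsto_const_nhds (x := (1 : ℝ))).sub (tendsto_mollRadius.const_mul 2)
  rwa [mul_zero, sub_zero] at this

/-- The weak equation identifies `∂̄` of the mollification with the dilation factor times the
mollification of `g`. Only `g` has to be continuous up to the boundary, so `v` may be a solution
about which nothing is known there, such as `nwExt g`. -/
lemma tendsto_mollify_snd {v : (Fin n → ℂ) → ℂ} (hv : ContinuousOn v (polydisc n))
    {g : Fin n → C(closedPolydisc n, ℂ)} (hvg : IsWeakSolution v g) :
    Filter.Tendsto (fun N => (mollify N v).2) Filter.atTop (𝓝 g) := by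
  have h : ∀ N j, (mollify N v).2 j = (shrink N : ℂ) • (mollify N (zeroExt (g j))).1 := fun N j => by
    ext z
    rw [mollify_snd_apply N hv, hvg _ (isTest_mollTest N z.2), ContinuousMap.smul_apply,
      mollify_fst_apply N (continuousOn_zeroExt_polydisc _), smul_eq_mul]
    ring
  refine tendsto_pi_nhds.2 fun j => ?_
  simp_rw [h]
  simpa using ((continuous_ofReal.tendsto 1).comp tendsto_shrink).smul (tendsto_mollify (g j))

/-- A closed subspace of forms that contains `∂̄p` for all product functions `p` contains all forms
with a weak solution. -/
lemma mem_of_isWeakSolution {S : Submodule ℂ (Fin n → C(closedPolydisc n, ℂ))}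
    (hS : IsClosed (S : Set (Fin n → C(closedPolydisc n, ℂ))))
    (h : ∀ u : Fin n → C(ℂ, ℂ), (∀ i, IsBump (u i)) → dbarProd u ∈ S)
    {v : (Fin n → ℂ) → ℂ} (hv : ContinuousOn v (polydisc n))
    {g : Fin n → C(closedPolydisc n, ℂ)} (hvg : IsWeakSolution v g) : g ∈ S := by
  refine hS.mem_of_tendsto (tendsto_mollify_snd hv hvg) (.of_forall fun N => ?_)
  have := mollify_mem (S := S.comap (LinearMap.snd ℂ _ _)) (hS.preimage continuous_snd) h N hv
  exact this

lemma isWeakSolution_nwExt {g : Fin n → C(closedPolydisc n, ℂ)} (hg : IsDbarClosed g) :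
    IsWeakSolution (nwExt g) g := fun _ hφ j => integral_nwExt_mul_wirtingerBar hg hφ j

/-- The norms are bounded uniformly on the closed polydisc, so the forms with continuous image make
up a closed subspace. It contains every `∂̄p` by the explicit formula. The Nijenhuis–Woolf function
supplies the weak solution needed for the density argument. -/
lemma continuous_henkinFunctional {g : Fin n → C(closedPolydisc n, ℂ)} (hg : IsDbarClosed g) :
    Continuous fun z => henkinFunctional z g := by
  obtain ⟨C, hC0, hC⟩ := exists_norm_henkinFunctional_le (n := n)
  let S : Submodule ℂ (Fin n → C(closedPolydisc n, ℂ)) :=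
    { carrier := {g | Continuous fun z => henkinFunctional z g}
      zero_mem' := by
        simp only [Set.mem_ofPred_eq, map_zero]
        exact continuous_const
      add_mem' := fun {f g} hf hg => by
        simp only [Set.mem_ofPred_eq, map_add] at hf hg ⊢
        exact hf.add hg
      smul_mem' := fun a f hf => by
        simp only [Set.mem_ofPred_eq, map_smul] at hf ⊢
        exact hf.const_smul a }
  have hS : IsClosed (S : Set (Fin n → C(closedPolydisc n, ℂ))) := by
    refine isClosed_of_closure_subset fun f hf => ?_
    refine continuous_of_uniform_approx_of_continuous fun U hU => ?_
    obtain ⟨ε, hε, hεU⟩ := Metric.mem_uniformity_dist.1 hU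
    obtain ⟨f', hf', hd⟩ := Metric.mem_closure_iff.1 hf (ε / (C + 1)) (by positivity)
    refine ⟨fun z => henkinFunctional z f', hf', fun z => hεU ?_⟩
    rw [dist_eq_norm, ← map_sub]
    refine (ContinuousLinearMap.le_opNorm _ _).trans_lt ?_
    rw [dist_eq_norm, lt_div_iff₀ (by positivity)] at hd
    refine lt_of_le_of_lt ?_ hd
    have := hC z
    nlinarith [norm_nonneg (f - f')]
  refine mem_of_isWeakSolution hS (fun u hu => ?_) (continuousOn_nwExt g) (isWeakSolution_nwExt hg)
  change Continuous fun z => henkinFunctional z (dbarProd u)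
  simp_rw [henkinFunctional_dbarProd hu]
  refine (prodFn u).continuous.sub (continuous_finsetProd _ fun k _ => ?_)
  have hc : Continuous fun z : closedPolydisc n => z.1 k :=
    (continuous_apply k).comp continuous_subtype_val
  refine ((u k).continuous.comp hc).sub ?_
  exact (continuousOn_discT_dbar (hu k).contDiff_one).comp_continuous hc
    fun z => mem_closedBall_zero_iff.2 (z.2 k)

/-- At an interior point both are continuous functionals, and they agree on `∂̄p` because `u - T ∂̄u
= S u` in the open disc. -/
lemma henkinFunctional_eq_nwFunctional {g : Fin n → C(closedPolydisc n, ℂ)} (hg : IsDbarClosed g)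
    (z : closedPolydisc n) (hz : z.1 ∈ polydisc n) : henkinFunctional z g = nwFunctional z g := by
  refine mem_of_isWeakSolution (S := LinearMap.eqLocus (henkinFunctional z).toLinearMap
    (nwFunctional z).toLinearMap)
    (isClosed_eq (henkinFunctional z).continuous (nwFunctional z).continuous)
    (fun u hu => ?_) (continuousOn_nwExt g) (isWeakSolution_nwExt hg)
  change henkinFunctional z (dbarProd u) = nwFunctional z (dbarProd u)
  rw [henkinFunctional_dbarProd hu, nwFunctional_dbarProd hu z hz]
  congr 1
  refine Finset.prod_congr rfl fun k _ => ?_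
  rw [← circleS_add_discT (hu k).contDiff_one (hz k), add_sub_cancel_right]

/-- The Cauchy–Green formula on the polydisc. -/
lemma eq_torusFunctional_add_nwFunctional {u : C(closedPolydisc n, ℂ)}
    {g : Fin n → C(closedPolydisc n, ℂ)} (hu : IsDbarSolution u g) (z : closedPolydisc n)
    (hz : z.1 ∈ polydisc n) : u z = torusFunctional z.1 u + nwFunctional z g := by
  have h : ∀ N, (mollify N (zeroExt u)).1 z = torusFunctional z.1 (mollify N (zeroExt u)).1 +
      nwFunctional z (mollify N (zeroExt u)).2 := fun N => by
    have := apply_mollify_eq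
      (l₁ := (ContinuousMap.evalCLM ℂ z).comp (ContinuousLinearMap.fst ℂ _ _))
      (l₂ := (torusFunctional z.1).comp
          (ContinuousLinearMap.fst ℂ _ (Fin n → C(closedPolydisc n, ℂ))) +
        (nwFunctional z).comp (ContinuousLinearMap.snd ℂ (C(closedPolydisc n, ℂ)) _))
      (fun w hw => by
        change prodFn w z = torusFunctional z.1 (prodFn w) + nwFunctional z (dbarProd w)
        rw [torusFunctional_prodFn hz, nwFunctional_dbarProd hw z hz]
        ring) N (continuousOn_zeroExt_polydisc u)
    exact this
  have h1 := tendsto_mollify u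
  have h2 := tendsto_mollify_snd (continuousOn_zeroExt_polydisc u) hu
  refine tendsto_nhds_unique (((ContinuousMap.evalCLM ℂ z).continuous.tendsto _).comp h1) ?_
  exact ((((torusFunctional z.1).continuous.tendsto _).comp h1).add
    (((nwFunctional z).continuous.tendsto _).comp h2)).congr fun N => (h N).symm

/-! ### Uniqueness and the canonical solution -/

lemma eq_of_eqOn_polydisc {u v : C(closedPolydisc n, ℂ)}
    (h : ∀ z : closedPolydisc n, z.1 ∈ polydisc n → u z = v z) : u = v := by
  ext z
  have hmem : ∀ N, (fun i => (shrink N : ℂ) * z.1 i) ∈ polydisc n := fun N i => by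
    rw [norm_mul, norm_real, Real.norm_of_nonneg (shrink_pos N).le]
    refine (mul_le_of_le_one_right (shrink_pos N).le (z.2 i)).trans_lt ?_
    unfold shrink
    linarith [mollRadius_pos N]
  set x : ℕ → closedPolydisc n := fun N => ⟨_, polydisc_subset n (hmem N)⟩ with hx
  have hlim : Filter.Tendsto x Filter.atTop (𝓝 z) := by
    refine tendsto_subtype_rng.2 (tendsto_pi_nhds.2 fun i => ?_)
    simpa using ((continuous_ofReal.tendsto 1).comp tendsto_shrink).mul_const (z.1 i)
  exact tendsto_nhds_unique ((u.continuous.tendsto z).comp hlim)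
    (((v.continuous.tendsto z).comp hlim).congr fun N => (h (x N) (hmem N)).symm)

/-- The canonical solution operator. -/
def canonicalSolution (n : ℕ) : closedForms n →ₗ[ℂ] C(closedPolydisc n, ℂ) where
  toFun g := ⟨fun z => henkinFunctional z g.1, continuous_henkinFunctional g.2⟩
  map_add' g h := by ext z; exact map_add (henkinFunctional z) g.1 h.1
  map_smul' c g := by ext z; exact map_smul (henkinFunctional z) c g.1

lemma canonicalSolution_apply (g : closedForms n) (z : closedPolydisc n) :
    canonicalSolution n g z = henkinFunctional z g.1 := rfl

lemma canonicalSolution_eq_nwFunctional (g : closedForms n) (z : closedPolydisc n)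
    (hz : z.1 ∈ polydisc n) : canonicalSolution n g z = nwFunctional z g.1 :=
  henkinFunctional_eq_nwFunctional g.2 z hz

lemma isDbarSolution_canonicalSolution (g : closedForms n) :
    IsDbarSolution (canonicalSolution n g) g.1 := fun φ hφ j => by
  rw [← integral_nwExt_mul_wirtingerBar g.2 hφ j]
  refine setIntegral_congr_fun (measurableSet_polydisc n) fun z hz => ?_
  simp only [zeroExt_of_mem _ (polydisc_subset n hz), nwExt_of_mem _ hz,
    canonicalSolution_eq_nwFunctional g ⟨z, polydisc_subset n hz⟩ hz]

lemma cauchyTorus_canonicalSolution (g : closedForms n) {z : Fin n → ℂ} (hz : z ∈ polydisc n) :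
    cauchyTorus (zeroExt (canonicalSolution n g)) z = 0 := by
  have h := eq_torusFunctional_add_nwFunctional (isDbarSolution_canonicalSolution g)
    ⟨z, polydisc_subset n hz⟩ hz
  rw [canonicalSolution_eq_nwFunctional g _ hz] at h
  rw [cauchyTorus_eq hz]
  exact right_eq_add.1 h

lemma eq_canonicalSolution {g : closedForms n} {u : C(closedPolydisc n, ℂ)}
    (hu : IsDbarSolution u g.1) (hK : ∀ z ∈ polydisc n, cauchyTorus (zeroExt u) z = 0) :
    u = canonicalSolution n g := by
  refine eq_of_eqOn_polydisc fun z hz => ?_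
  rw [eq_torusFunctional_add_nwFunctional hu z hz, ← cauchyTorus_eq hz, hK _ hz, zero_add,
    canonicalSolution_eq_nwFunctional g z hz]

end Polydisc

end
theorem corollary1 (n : ℕ) (hn : 1 ≤ n) :
    ∃ L : Polydisc.closedForms n →ₗ[ℂ] C(Polydisc.closedPolydisc n, ℂ),
      -- `L` solves the equation, `K L = 0`, and this determines `L`
      (∀ g : Polydisc.closedForms n, Polydisc.IsDbarSolution (L g) g) ∧
      (∀ g : Polydisc.closedForms n, ∀ z ∈ Polydisc.polydisc n,
        Polydisc.cauchyTorus (Polydisc.zeroExt (L g)) z = 0) ∧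
      (∀ (g : Polydisc.closedForms n) (u : C(Polydisc.closedPolydisc n, ℂ)),
        Polydisc.IsDbarSolution u g →
        (∀ z ∈ Polydisc.polydisc n, Polydisc.cauchyTorus (Polydisc.zeroExt u) z = 0) →
        u = L g) ∧
      -- `L = H`
      (∀ (g : Polydisc.closedForms n) (z : Polydisc.closedPolydisc n),
        L g z = Polydisc.henkin (g : Fin n → C(Polydisc.closedPolydisc n, ℂ)) z) ∧
      -- `L = T` on forms of class `C^{k+α}`
      (∀ (k : ℕ) (α : NNReal), 0 < α → α < 1 → ∀ g : Polydisc.closedForms n,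
        (∀ j, Polydisc.IsHolder k α ((g : Fin n → C(Polydisc.closedPolydisc n, ℂ)) j)) →
        ∀ z : Polydisc.closedPolydisc n, (z : Fin n → ℂ) ∈ Polydisc.polydisc n →
          L g z = Polydisc.nijenhuisWoolf
            (g : Fin n → C(Polydisc.closedPolydisc n, ℂ)) z) := by
  refine ⟨Polydisc.canonicalSolution n, Polydisc.isDbarSolution_canonicalSolution,
    fun g z hz => Polydisc.cauchyTorus_canonicalSolution g hz,
    fun g u hu hK => Polydisc.eq_canonicalSolution hu hK, fun g z => ?_, fun k α _ _ g _ z hz => ?_⟩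
  · rw [Polydisc.henkin_eq, Polydisc.canonicalSolution_apply]
  · rw [Polydisc.nijenhuisWoolf_eq z hz, Polydisc.canonicalSolution_eq_nwFunctional g z hz]
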